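/- **Conventions.** Let $k$ be a commutative ring. Objects of $\widetilde{\mathcal H}(\mathcal M_k)$ are pairs $(M,\mu)$ of a $k$-module and a $k$-linear automorphism. Sums are suppressed: $\Delta(h)=h_1\otimes h_2$; left coactions are written $\rho(m)=m_{(-1)}\otimes m_{(0)}$, right coactions $\sigma(m)=m_{[0]}\otimes m_{[1]}$. A *monoidal Hom-Hopf algebra* $(H,\alpha)$ is a $k$-module $H$ with a linear automorphism $\alpha$, a multiplication, an element $1$, and $k$-linear maps $\Delta:H\to H\otimes H$, $\varepsilon:H\to k$, $S:H\to H$, all compatible with $\alpha$ (that is, $\alpha(ab)=\alpha(a)\alpha(b)$, $\alpha(1)=1$, $\Delta\alpha=(\alpha\otimes\alpha)\Delta$, $\varepsilon\alpha=\varepsilon$, $S\alpha=\alpha S$), such that $\alpha(a)(bc)=(ab)\alpha(c)$, $a1=1a=\alpha(a)$, $\alpha^{-1}(c_1)\otimes\Delta(c_2)=c_{11}\otimes(c_{12}\otimes\alpha^{-1}(c_2))$, $c_1\varepsilon(c_2)=\alpha^{-1}(c)=\varepsilon(c_1)c_2$, $\Delta$ and $\varepsilon$ are multiplicative and unital, and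 $S(h_1)h_2=\varepsilon(h)1=h_1S(h_2)$. Left and right Hom-modules and Hom-comodules over $(H,\alpha)$ are objects $(M,\mu)$ of $\widetilde{\mathcal H}(\mathcal M_k)$ with an action or coaction compatible with the automorphisms and satisfying the same twisted axioms; e.g. $\mu(m)(gh)=(mg)\alpha(h)$, $m1=\mu(m)$ for right modules and $\mu^{-1}(m_{[0]})\otimes\Delta(m_{[1]})=m_{[0][0]}\otimes(m_{[0][1]}\otimes\alpha^{-1}(m_{[1]}))$, $m_{[0]}\varepsilon(m_{[1]})=\mu^{-1}(m)$ for right comodules. A *bicovariant $(H,\alpha)$-Hom-bimodule* is an object $(M,\mu)$ which is a left and right Hom-module with $(hm)\alpha(g)=\alpha(h)(mg)$ and a left and right Hom-comodule, such that $\rho((hm)\alpha(g))=\Delta(\alpha(h))(\rho(m)\Delta(g))$, $\sigma((hm)\alpha(g))=\Delta(\alpha(h))(\sigma(m)\Delta(g))$ and $\alpha(m_{[0](-1)})\otimes(m_{[0](0)}\otimes\alpha^{-1}(m_{[1]}))=m_{(-1)}\otimes(m_{(0)[0]}\otimes m_{(0)[1]})$. Morphisms are the $k$-linear maps that commute with the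 automorphisms and are $H$-linear and $H$-colinear on both sides. The category is monoidal: $M\otimes_HN$ is the quotient of $M\otimes N$ by the relations $mh\otimes n=\mu(m)\otimes h\nu^{-1}(n)$, with automorphism $\mu\otimes_H\nu$ and $$h(m\otimes_Hn)=\alpha^{-1}(h)m\otimes_H\nu(n),\qquad (m\otimes_Hn)h=\mu(m)\otimes_Hn\alpha^{-1}(h),$$ $$\rho(m\otimes_Hn)=m_{(-1)}n_{(-1)}\otimes(m_{(0)}\otimes_Hn_{(0)}),\qquad \sigma(m\otimes_Hn)=(m_{[0]}\otimes_Hn_{[0]})\otimes m_{[1]}n_{[1]};$$ the associativity constraint is $(m\otimes_Hn)\otimes_Hp\mapsto\mu(m)\otimes_H(n\otimes_H\pi^{-1}(p))$, the unit object is $(H,\alpha)$ with actions given by multiplication and coactions given by $\Delta$, and the unit constraints are $h\otimes_Hm\mapsto hm$, $m\otimes_Hh\mapsto mh$. A *right-right Yetter-Drinfel'd $(H,\alpha)$-Hom-module* is a right Hom-module (action $\lhd$) and right Hom-comodule $(N,\nu)$ with $$n_{[0]}\lhd\alpha^{-1}(h_1)\otimes n_{[1]}\alpha^{-1}(h_2)=(n\lhd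 h_2)_{[0]}\otimes\alpha^{-1}(h_1(n\lhd h_2)_{[1]}).$$ Morphisms are the $k$-linear maps that commute with the automorphisms and are right $H$-linear and right $H$-colinear. The category is monoidal with $(M\otimes N,\mu\otimes\nu)$ ($\otimes=\otimes_k$), $(m\otimes n)\lhd h=m\lhd h_1\otimes n\lhd h_2$, $\sigma(m\otimes n)=(m_{[0]}\otimes n_{[0]})\otimes m_{[1]}n_{[1]}$, associativity constraint $(m\otimes n)\otimes p\mapsto\mu(m)\otimes(n\otimes\pi^{-1}(p))$, unit object $(k,\mathrm{id})$ with $x\lhd h=\varepsilon(h)x$, $\sigma(x)=x\otimes1$, and unit constraints $x\otimes m\mapsto x\mu(m)$, $m\otimes x\mapsto x\mu(m)$. A *prebraiding* on a monoidal category is a natural family of (not necessarily invertible) morphisms $c_{X,Y}:X\otimes Y\to Y\otimes X$ satisfying both hexagon axioms and compatible with the unit constraints. **Statement.** Let $(H,\alpha)$ be a monoidal Hom-Hopf algebra over $k$ with antipode $S$. Put $P_L(m)=S(m_{(-1)})m_{(0)}$ and $P_R(m)=m_{[0]}S(m_{[1]})$. 1. The formula $c_{M,N}(m\otimes_Hn)=m_{(-1)}P_R(n_{[0]})\otimes_HP_L(m_{(0)})n_{[1]}$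 gives a well-defined prebraiding on the category of bicovariant $(H,\alpha)$-Hom-bimodules, and $c_{M,N}(m\otimes n)=\nu(n_{[0]})\otimes\mu^{-1}(m)\lhd n_{[1]}$ gives a prebraiding on the category of right-right Yetter-Drinfel'd $(H,\alpha)$-Hom-modules. 2. The functor $F(V,\nu)=(H\otimes V,\alpha\otimes\nu)$, $F(f)=\mathrm{id}\otimes f$, where $$h(g\otimes v)=\alpha^{-1}(h)g\otimes\nu(v),\qquad (g\otimes v)h=gh_1\otimes v\lhd h_2,$$ $$\rho(g\otimes v)=\alpha(g_1)\otimes(g_2\otimes\nu^{-1}(v)),\qquad \sigma(g\otimes v)=(g_1\otimes v_{[0]})\otimes g_2v_{[1]},$$ is an equivalence from the category of right-right Yetter-Drinfel'd $(H,\alpha)$-Hom-modules to the category of bicovariant $(H,\alpha)$-Hom-bimodules. It is a strong monoidal functor with structure isomorphisms $$\varphi_2\big((g\otimes v)\otimes_H(h\otimes w)\big)=g\alpha(h_1)\otimes(\nu^{-1}(v)\lhd h_2\otimes w)\quad(v\in(V,\nu)),\qquad \varphi_0(h)=\alpha^{-1}(h)\otimes1,$$ and it carries the one prebraiding to the other: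 $\varphi_2\circ c_{F(V),F(W)}=F(c_{V,W})\circ\varphi_2$. So the two categories are equivalent as prebraided monoidal categories. 3. If $S$ is bijective, then both prebraidings are braidings (all $c_{M,N}$ are isomorphisms), and $F$ with $\varphi_2,\varphi_0$ is a braided monoidal equivalence. -/

import Mathlib

open CategoryTheory TensorProduct

universe u

/-! ### Monoidal Hom-structures

An object of the category `H̃(M_k)` is a `k`-module with a `k`-linear automorphism, and its
associativity constraint is `(a ⊗ b) ⊗ c ↦ α a ⊗ (b ⊗ γ⁻¹ c)`.  All the axioms below
are written with this twisted constraint.  -/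

/-- A `k`-module together with a `k`-linear automorphism. -/
structure HomObject (k : Type u) [CommRing k] where
  carrier : Type u
  [addCommGroup : AddCommGroup carrier]
  [module : Module k carrier]
  twist : carrier ≃ₗ[k] carrier

attribute [instance] HomObject.addCommGroup HomObject.module

/-- A monoidal Hom-algebra: `α(a)(bc) = (ab)α(c)`, `a1 = 1a = α(a)`, `α` multiplicative. -/
structure MonoidalHomAlgebra (k : Type u) [CommRing k] extends HomObject k where
  mul : carrier →ₗ[k] carrier →ₗ[k] carrier
  one : carrier
  twist_mul : ∀ a b, twist (mul a b) = mul (twist a) (twist b)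
  twist_one : twist one = one
  mul_assoc : ∀ a b c, mul (twist a) (mul b c) = mul (mul a b) (twist c)
  mul_one : ∀ a, mul a one = twist a
  one_mul : ∀ a, mul one a = twist a

/-- A monoidal Hom-coalgebra:
`γ⁻¹(c₁) ⊗ Δ(c₂) = c₁₁ ⊗ (c₁₂ ⊗ γ⁻¹(c₂))`, `c₁ ε(c₂) = γ⁻¹(c) = ε(c₁) c₂`,
with `Δ` and `ε` compatible with `γ`. -/
structure MonoidalHomCoalgebra (k : Type u) [CommRing k] extends HomObject k where
  comul : carrier →ₗ[k] carrier ⊗[k] carrier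
  counit : carrier →ₗ[k] k
  comul_twist : ∀ c, comul (twist c) = TensorProduct.map twist.toLinearMap twist.toLinearMap (comul c)
  counit_twist : ∀ c, counit (twist c) = counit c
  coassoc : ∀ c,
    TensorProduct.map twist.symm.toLinearMap comul (comul c) =
      TensorProduct.assoc k carrier carrier carrier
        (TensorProduct.map comul twist.symm.toLinearMap (comul c))
  comul_counit : ∀ c,
    TensorProduct.rid k carrier (TensorProduct.map LinearMap.id counit (comul c)) = twist.symm c
  counit_comul : ∀ c,
    TensorProduct.lid k carrier (TensorProduct.map counit LinearMap.id (comul c)) = twist.symm c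

/-- A monoidal Hom-bialgebra: `Δ` and `ε` are multiplicative and unital. -/
structure MonoidalHomBialgebra (k : Type u) [CommRing k] extends
    MonoidalHomAlgebra k, MonoidalHomCoalgebra k where
  comul_mul : ∀ a b, comul (mul a b) = TensorProduct.map₂ mul mul (comul a) (comul b)
  comul_one : comul one = one ⊗ₜ[k] one
  counit_mul : ∀ a b, counit (mul a b) = counit a * counit b
  counit_one : counit one = 1

/-- A monoidal Hom-Hopf algebra: a monoidal Hom-bialgebra with an antipode `S` commuting with
`α` such that `S(h₁)h₂ = ε(h)1 = h₁S(h₂)`. -/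
structure MonoidalHomHopfAlgebra (k : Type u) [CommRing k] extends MonoidalHomBialgebra k where
  antipode : carrier →ₗ[k] carrier
  antipode_twist : ∀ a, antipode (twist a) = twist (antipode a)
  antipode_mul : ∀ a,
    TensorProduct.lift mul (TensorProduct.map antipode LinearMap.id (comul a)) = counit a • one
  mul_antipode : ∀ a,
    TensorProduct.lift mul (TensorProduct.map LinearMap.id antipode (comul a)) = counit a • one

namespace HomHopf

section Structures

variable {k : Type u} [CommRing k] (H : MonoidalHomHopfAlgebra k)
variable {M : Type u} [AddCommGroup M] [Module k M]

/-- `act : h ⊗ m ↦ hm` makes `(M, μ)` a left `(H, α)`-Hom-module. -/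
structure IsLeftModule (μ : M ≃ₗ[k] M) (act : H.carrier →ₗ[k] M →ₗ[k] M) : Prop where
  twist_act : ∀ h m, μ (act h m) = act (H.twist h) (μ m)
  act_act : ∀ g h m, act (H.twist g) (act h m) = act (H.mul g h) (μ m)
  one_act : ∀ m, act H.one m = μ m

/-- `act : m ⊗ h ↦ mh` makes `(M, μ)` a right `(H, α)`-Hom-module. -/
structure IsRightModule (μ : M ≃ₗ[k] M) (act : M →ₗ[k] H.carrier →ₗ[k] M) : Prop where
  twist_act : ∀ m h, μ (act m h) = act (μ m) (H.twist h)
  act_act : ∀ m g h, act (μ m) (H.mul g h) = act (act m g) (H.twist h)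
  act_one : ∀ m, act m H.one = μ m

/-- `ρ : m ↦ m₍₋₁₎ ⊗ m₍₀₎` makes `(M, μ)` a left `(H, α)`-Hom-comodule, that is,
`Δ(m₍₋₁₎) ⊗ μ⁻¹(m₍₀₎) = α⁻¹(m₍₋₁₎) ⊗ ρ(m₍₀₎)` up to the usual rebracketing, and
`ε(m₍₋₁₎) m₍₀₎ = μ⁻¹(m)`. -/
structure IsLeftComodule (μ : M ≃ₗ[k] M) (ρ : M →ₗ[k] H.carrier ⊗[k] M) : Prop where
  coact_twist : ∀ m, ρ (μ m) = TensorProduct.map H.twist.toLinearMap μ.toLinearMap (ρ m)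
  coassoc : ∀ m,
    TensorProduct.assoc k H.carrier H.carrier M
        (TensorProduct.map H.comul μ.symm.toLinearMap (ρ m)) =
      TensorProduct.map H.twist.symm.toLinearMap ρ (ρ m)
  counit : ∀ m,
    TensorProduct.lid k M (TensorProduct.map H.counit LinearMap.id (ρ m)) = μ.symm m

/-- `σ : m ↦ m₍₀₎ ⊗ m₍₁₎` makes `(M, μ)` a right `(H, α)`-Hom-comodule, that is,
`μ⁻¹(m₍₀₎) ⊗ Δ(m₍₁₎) = m₍₀₎₍₀₎ ⊗ (m₍₀₎₍₁₎ ⊗ α⁻¹(m₍₁₎))` and `m₍₀₎ ε(m₍₁₎) = μ⁻¹(m)`. -/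
structure IsRightComodule (μ : M ≃ₗ[k] M) (σ : M →ₗ[k] M ⊗[k] H.carrier) : Prop where
  coact_twist : ∀ m, σ (μ m) = TensorProduct.map μ.toLinearMap H.twist.toLinearMap (σ m)
  coassoc : ∀ m,
    TensorProduct.map μ.symm.toLinearMap H.comul (σ m) =
      TensorProduct.assoc k M H.carrier H.carrier
        (TensorProduct.map σ H.twist.symm.toLinearMap (σ m))
  counit : ∀ m,
    TensorProduct.rid k M (TensorProduct.map LinearMap.id H.counit (σ m)) = μ.symm m

/-- The twisted Yetter-Drinfel'd condition
`n₍₀₎ ◁ α⁻¹(h₁) ⊗ n₍₁₎ α⁻¹(h₂) = (n ◁ h₂)₍₀₎ ⊗ α⁻¹(h₁ (n ◁ h₂)₍₁₎)`.  The right-hand side is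
the image of `h₁ ⊗ h₂` under
`h₁ ⊗ h₂ ↦ h₁ ⊗ ((n ◁ h₂)₍₀₎ ⊗ (n ◁ h₂)₍₁₎) ↦ (n ◁ h₂)₍₀₎ ⊗ (h₁ ⊗ (n ◁ h₂)₍₁₎)`
followed by `α⁻¹` of the multiplication in the last two slots. -/
def YetterDrinfeldCondition (act : M →ₗ[k] H.carrier →ₗ[k] M)
    (σ : M →ₗ[k] M ⊗[k] H.carrier) : Prop :=
  ∀ (n : M) (h : H.carrier),
    TensorProduct.map₂ act H.mul (σ n)
        (TensorProduct.map H.twist.symm.toLinearMap H.twist.symm.toLinearMap (H.comul h)) =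
      TensorProduct.map LinearMap.id (H.twist.symm.toLinearMap ∘ₗ TensorProduct.lift H.mul)
        (TensorProduct.leftComm k H.carrier M H.carrier
          (TensorProduct.map LinearMap.id (σ ∘ₗ act n) (H.comul h)))

/-- The data and axioms of a bicovariant `(H, α)`-Hom-bimodule structure on `(M, μ)`. -/
structure IsBicovariant (μ : M ≃ₗ[k] M)
    (lact : H.carrier →ₗ[k] M →ₗ[k] M) (ract : M →ₗ[k] H.carrier →ₗ[k] M)
    (lcoact : M →ₗ[k] H.carrier ⊗[k] M) (rcoact : M →ₗ[k] M ⊗[k] H.carrier) : Prop where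
  left_module : IsLeftModule H μ lact
  right_module : IsRightModule H μ ract
  /-- `(hm)α(g) = α(h)(mg)` -/
  bimodule : ∀ h m g, ract (lact h m) (H.twist g) = lact (H.twist h) (ract m g)
  left_comodule : IsLeftComodule H μ lcoact
  /-- `ρ((hm)α(g)) = Δ(α(h))(ρ(m)Δ(g))` -/
  left_covariant : ∀ h m g, lcoact (ract (lact h m) (H.twist g)) =
    TensorProduct.map₂ H.mul lact (H.comul (H.twist h))
      (TensorProduct.map₂ H.mul ract (lcoact m) (H.comul g))
  right_comodule : IsRightComodule H μ rcoact
  /-- `σ((hm)α(g)) = Δ(α(h))(σ(m)Δ(g))` -/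
  right_covariant : ∀ h m g, rcoact (ract (lact h m) (H.twist g)) =
    TensorProduct.map₂ lact H.mul (H.comul (H.twist h))
      (TensorProduct.map₂ ract H.mul (rcoact m) (H.comul g))
  /-- Hom-commutativity:
  `α(m₍₀₎₍₋₁₎) ⊗ (m₍₀₎₍₀₎ ⊗ α⁻¹(m₍₁₎)) = m₍₋₁₎ ⊗ (m₍₀₎₍₀₎ ⊗ m₍₀₎₍₁₎)` -/
  coact_comm : ∀ m,
    TensorProduct.map H.twist.toLinearMap
        (TensorProduct.map LinearMap.id H.twist.symm.toLinearMap)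
        (TensorProduct.assoc k H.carrier M H.carrier
          (TensorProduct.map lcoact LinearMap.id (rcoact m))) =
      TensorProduct.map LinearMap.id rcoact (lcoact m)

/-- The axioms of a right-right Yetter-Drinfel'd `(H, α)`-Hom-module structure on `(M, μ)`. -/
structure IsYetterDrinfeld (μ : M ≃ₗ[k] M) (act : M →ₗ[k] H.carrier →ₗ[k] M)
    (coact : M →ₗ[k] M ⊗[k] H.carrier) : Prop where
  right_module : IsRightModule H μ act
  right_comodule : IsRightComodule H μ coact
  yetterDrinfeld : YetterDrinfeldCondition H act coact

end Structures

/-! ### Auxiliary facts about maps of tensor products -/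

section Aux

variable {k : Type u} [CommRing k]
variable {A B C D E F A' B' C' D' E' F' A'' B'' : Type u}
variable [AddCommGroup A] [Module k A] [AddCommGroup B] [Module k B]
variable [AddCommGroup C] [Module k C] [AddCommGroup D] [Module k D]
variable [AddCommGroup E] [Module k E] [AddCommGroup F] [Module k F]
variable [AddCommGroup A'] [Module k A'] [AddCommGroup B'] [Module k B']
variable [AddCommGroup C'] [Module k C'] [AddCommGroup D'] [Module k D']
variable [AddCommGroup E'] [Module k E'] [AddCommGroup F'] [Module k F']
variable [AddCommGroup A''] [Module k A''] [AddCommGroup B''] [Module k B'']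

open TensorProduct (map map₂)

theorem map_map₂ {f : A →ₗ[k] B →ₗ[k] C} {g : A' →ₗ[k] B' →ₗ[k] C'}
    {f' : D →ₗ[k] E →ₗ[k] F} {g' : D' →ₗ[k] E' →ₗ[k] F'}
    {c : C →ₗ[k] F} {c' : C' →ₗ[k] F'} {a : A →ₗ[k] D} {b : B →ₗ[k] E}
    {a' : A' →ₗ[k] D'} {b' : B' →ₗ[k] E'}
    (h : ∀ x y, c (f x y) = f' (a x) (b y)) (h' : ∀ x y, c' (g x y) = g' (a' x) (b' y))
    (X : A ⊗[k] A') (Y : B ⊗[k] B') :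
    map c c' (map₂ f g X Y) = map₂ f' g' (map a a' X) (map b b' Y) := by
  induction X using TensorProduct.induction_on with
  | zero => simp
  | add X X' hX hX' => simp [hX, hX']
  | tmul x x' =>
    induction Y using TensorProduct.induction_on with
    | zero => simp
    | add X X' hX hX' => simp only [map_add, hX, hX']
    | tmul y y' => simp [h, h']

theorem assoc_map₂ (f : A →ₗ[k] B →ₗ[k] C) (g : A' →ₗ[k] B' →ₗ[k] C')
    (h : D →ₗ[k] E →ₗ[k] F) (X : (A ⊗[k] A') ⊗[k] D) (Y : (B ⊗[k] B') ⊗[k] E) :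
    TensorProduct.assoc k C C' F (map₂ (map₂ f g) h X Y) =
      map₂ f (map₂ g h) (TensorProduct.assoc k A A' D X) (TensorProduct.assoc k B B' E Y) := by
  induction X using TensorProduct.induction_on with
  | zero => simp
  | add X X' hX hX' => simp [hX, hX']
  | tmul x d =>
    induction Y using TensorProduct.induction_on with
    | zero => simp
    | add X X' hX hX' => simp only [map_add, hX, hX']
    | tmul y e =>
      induction x using TensorProduct.induction_on with
      | zero => simp
      | add X X' hX hX' =>
        simp only [TensorProduct.add_tmul, map_add, LinearMap.add_apply, hX, hX']
      | tmul a a' =>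
        induction y using TensorProduct.induction_on with
        | zero => simp
        | add X X' hX hX' =>
        simp only [TensorProduct.add_tmul, map_add, hX, hX']
        | tmul y e => simp

end Aux
end HomHopf

namespace HomHopf

section Aux2

variable {k : Type u} [CommRing k]
variable {A B C D E F P A' B' C' D' E' F' P' : Type u}
variable [AddCommGroup A] [Module k A] [AddCommGroup B] [Module k B]
variable [AddCommGroup C] [Module k C] [AddCommGroup D] [Module k D]
variable [AddCommGroup E] [Module k E] [AddCommGroup F] [Module k F]
variable [AddCommGroup P] [Module k P] [AddCommGroup P'] [Module k P']
variable [AddCommGroup A'] [Module k A'] [AddCommGroup B'] [Module k B']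
variable [AddCommGroup C'] [Module k C'] [AddCommGroup D'] [Module k D']
variable [AddCommGroup E'] [Module k E'] [AddCommGroup F'] [Module k F']

open TensorProduct (map map₂)

theorem map₂_assoc {f : B →ₗ[k] C →ₗ[k] P} {f' : D →ₗ[k] E →ₗ[k] C} {F₁ : A' →ₗ[k] F →ₗ[k] P}
    {F₁' : A →ₗ[k] D →ₗ[k] A'} {p : A →ₗ[k] B} {c : E →ₗ[k] F}
    {A₂ B₂ C₂ D₂ E₂ F₂ A₂' P₂ : Type u}
    [AddCommGroup A₂] [Module k A₂] [AddCommGroup B₂] [Module k B₂]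
    [AddCommGroup C₂] [Module k C₂] [AddCommGroup D₂] [Module k D₂]
    [AddCommGroup E₂] [Module k E₂] [AddCommGroup F₂] [Module k F₂]
    [AddCommGroup A₂'] [Module k A₂'] [AddCommGroup P₂] [Module k P₂]
    {g : B₂ →ₗ[k] C₂ →ₗ[k] P₂} {g' : D₂ →ₗ[k] E₂ →ₗ[k] C₂} {G₁ : A₂' →ₗ[k] F₂ →ₗ[k] P₂}
    {G₁' : A₂ →ₗ[k] D₂ →ₗ[k] A₂'} {q : A₂ →ₗ[k] B₂} {d : E₂ →ₗ[k] F₂}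
    (h : ∀ x y z, f (p x) (f' y z) = F₁ (F₁' x y) (c z))
    (h' : ∀ x y z, g (q x) (g' y z) = G₁ (G₁' x y) (d z))
    (X : A ⊗[k] A₂) (Y : D ⊗[k] D₂) (Z : E ⊗[k] E₂) :
    map₂ f g (map p q X) (map₂ f' g' Y Z) = map₂ F₁ G₁ (map₂ F₁' G₁' X Y) (map c d Z) := by
  induction X using TensorProduct.induction_on with
  | zero => simp
  | add X X' hX hX' => simp only [map_add, LinearMap.add_apply, hX, hX']
  | tmul x x' =>
    induction Y using TensorProduct.induction_on with
    | zero => simp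
    | add X X' hX hX' => simp only [map_add, LinearMap.add_apply, hX, hX']
    | tmul y y' =>
      induction Z using TensorProduct.induction_on with
      | zero => simp
      | add X X' hX hX' => simp only [map_add, hX, hX']
      | tmul z z' => simp [h, h']

theorem map₂_tmul_right (f : A →ₗ[k] B →ₗ[k] C) (g : A' →ₗ[k] B' →ₗ[k] C')
    (X : A ⊗[k] A') (b : B) (b' : B') :
    map₂ f g X (b ⊗ₜ[k] b') = map (f.flip b) (g.flip b') X := by
  induction X using TensorProduct.induction_on with
  | zero => simp
  | add X X' hX hX' => simp only [map_add, LinearMap.add_apply, hX, hX']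
  | tmul x x' => simp

theorem rid_map₂ (f : A →ₗ[k] B →ₗ[k] C) {g : A' →ₗ[k] B' →ₗ[k] C'}
    {e : C' →ₗ[k] k} {e₁ : A' →ₗ[k] k} {e₂ : B' →ₗ[k] k} (h : ∀ x y, e (g x y) = e₁ x * e₂ y)
    (X : A ⊗[k] A') (Y : B ⊗[k] B') :
    TensorProduct.rid k C (map LinearMap.id e (map₂ f g X Y)) =
      f (TensorProduct.rid k A (map LinearMap.id e₁ X))
        (TensorProduct.rid k B (map LinearMap.id e₂ Y)) := by
  induction X using TensorProduct.induction_on with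
  | zero => simp
  | add X X' hX hX' => simp only [map_add, LinearMap.add_apply, hX, hX']
  | tmul x x' =>
    induction Y using TensorProduct.induction_on with
    | zero => simp
    | add X X' hX hX' => simp only [map_add, hX, hX']
    | tmul y y' => simp [h, smul_smul, mul_comm]

theorem lid_map₂ (f : A →ₗ[k] B →ₗ[k] C) {g : A' →ₗ[k] B' →ₗ[k] C'}
    {e : C' →ₗ[k] k} {e₁ : A' →ₗ[k] k} {e₂ : B' →ₗ[k] k} (h : ∀ x y, e (g x y) = e₁ x * e₂ y)
    (X : A' ⊗[k] A) (Y : B' ⊗[k] B) :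
    TensorProduct.lid k C (map e LinearMap.id (map₂ g f X Y)) =
      f (TensorProduct.lid k A (map e₁ LinearMap.id X))
        (TensorProduct.lid k B (map e₂ LinearMap.id Y)) := by
  induction X using TensorProduct.induction_on with
  | zero => simp
  | add X X' hX hX' => simp only [map_add, LinearMap.add_apply, hX, hX']
  | tmul x x' =>
    induction Y using TensorProduct.induction_on with
    | zero => simp
    | add X X' hX hX' => simp only [map_add, hX, hX']
    | tmul y y' => simp [h, smul_smul, mul_comm]

/-- Induction on the elements of a module generated by the values of a bilinear map. -/
theorem ind_surj {β : A →ₗ[k] B →ₗ[k] C} (hs : Function.Surjective (TensorProduct.lift β))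
    {p : C → Prop} (h0 : p 0) (hadd : ∀ x y, p x → p y → p (x + y)) (h : ∀ a b, p (β a b))
    (x : C) : p x := by
  obtain ⟨y, rfl⟩ := hs x
  induction y using TensorProduct.induction_on with
  | zero => simpa using h0
  | add X X' hX hX' => rw [map_add]; exact hadd _ _ hX hX'
  | tmul x x' => simpa using h x x'

theorem symm_bilin {β : A →ₗ[k] B →ₗ[k] C} {μ : A ≃ₗ[k] A} {ν : B ≃ₗ[k] B} {τ : C ≃ₗ[k] C}
    (h : ∀ a b, τ (β a b) = β (μ a) (ν b)) (a : A) (b : B) :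
    τ.symm (β a b) = β (μ.symm a) (ν.symm b) := by
  rw [LinearEquiv.symm_apply_eq, h]; simp

theorem map_symm_map (μ : A ≃ₗ[k] A) (ν : B ≃ₗ[k] B) (X : A ⊗[k] B) :
    map μ.symm.toLinearMap ν.symm.toLinearMap (map μ.toLinearMap ν.toLinearMap X) = X := by
  induction X using TensorProduct.induction_on with
  | zero => simp
  | add X X' hX hX' => simp only [map_add, hX, hX']
  | tmul x x' => simp

theorem map_map_symm (μ : A ≃ₗ[k] A) (ν : B ≃ₗ[k] B) (X : A ⊗[k] B) :
    map μ.toLinearMap ν.toLinearMap (map μ.symm.toLinearMap ν.symm.toLinearMap X) = X :=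
  map_symm_map μ.symm ν.symm X

end Aux2

section Basic

variable {k : Type u} [CommRing k] {H : MonoidalHomHopfAlgebra k}
variable {M N Q : Type u} [AddCommGroup M] [Module k M] [AddCommGroup N] [Module k N]
variable [AddCommGroup Q] [Module k Q]

open TensorProduct (map map₂)

theorem mul_symm (H : MonoidalHomHopfAlgebra k) (a b : H.carrier) :
    H.twist.symm (H.mul a b) = H.mul (H.twist.symm a) (H.twist.symm b) :=
  symm_bilin H.twist_mul a b

theorem symm_one (H : MonoidalHomHopfAlgebra k) : H.twist.symm H.one = H.one := by
  rw [LinearEquiv.symm_apply_eq, H.twist_one]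

theorem comul_symm (H : MonoidalHomHopfAlgebra k) (a : H.carrier) :
    H.comul (H.twist.symm a) =
      map H.twist.symm.toLinearMap H.twist.symm.toLinearMap (H.comul a) := by
  conv_rhs => rw [← H.twist.apply_symm_apply a, H.comul_twist, map_symm_map]

theorem counit_symm (H : MonoidalHomHopfAlgebra k) (a : H.carrier) :
    H.counit (H.twist.symm a) = H.counit a := by
  conv_rhs => rw [← H.twist.apply_symm_apply a, H.counit_twist]

theorem IsRightComodule.coact_symm {μ : M ≃ₗ[k] M} {σ : M →ₗ[k] M ⊗[k] H.carrier}
    (h : IsRightComodule H μ σ) (m : M) :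
    σ (μ.symm m) = map μ.symm.toLinearMap H.twist.symm.toLinearMap (σ m) := by
  conv_rhs => rw [← μ.apply_symm_apply m, h.coact_twist, map_symm_map]

theorem IsLeftComodule.coact_symm {μ : M ≃ₗ[k] M} {ρ : M →ₗ[k] H.carrier ⊗[k] M}
    (h : IsLeftComodule H μ ρ) (m : M) :
    ρ (μ.symm m) = map H.twist.symm.toLinearMap μ.symm.toLinearMap (ρ m) := by
  conv_rhs => rw [← μ.apply_symm_apply m, h.coact_twist, map_symm_map]

theorem isLeftModule_self (H : MonoidalHomHopfAlgebra k) : IsLeftModule H H.twist H.mul :=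
  ⟨H.twist_mul, H.mul_assoc, H.one_mul⟩

theorem isRightModule_self (H : MonoidalHomHopfAlgebra k) : IsRightModule H H.twist H.mul :=
  ⟨H.twist_mul, H.mul_assoc, H.mul_one⟩

theorem isLeftComodule_self (H : MonoidalHomHopfAlgebra k) : IsLeftComodule H H.twist H.comul :=
  ⟨H.comul_twist, fun c => (H.coassoc c).symm, H.counit_comul⟩

theorem isRightComodule_self (H : MonoidalHomHopfAlgebra k) : IsRightComodule H H.twist H.comul :=
  ⟨H.comul_twist, H.coassoc, H.comul_counit⟩

/-- A codiagonal coaction on a module generated by the values of a bilinear map. -/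
theorem IsRightComodule.codiag {μ : M ≃ₗ[k] M} {ν : N ≃ₗ[k] N} {τ : Q ≃ₗ[k] Q}
    {σM : M →ₗ[k] M ⊗[k] H.carrier} {σN : N →ₗ[k] N ⊗[k] H.carrier}
    {σQ : Q →ₗ[k] Q ⊗[k] H.carrier} (hM : IsRightComodule H μ σM) (hN : IsRightComodule H ν σN)
    {β : M →ₗ[k] N →ₗ[k] Q} (hs : Function.Surjective (TensorProduct.lift β))
    (hτ : ∀ m n, τ (β m n) = β (μ m) (ν n))
    (hσ : ∀ m n, σQ (β m n) = map₂ β H.mul (σM m) (σN n)) : IsRightComodule H τ σQ where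
  coact_twist q := by
    induction q using ind_surj hs with
    | h0 => simp
    | hadd x y hx hy => simp only [map_add, hx, hy]
    | h m n =>
      rw [hτ, hσ, hσ, hM.coact_twist, hN.coact_twist, map_map₂ hτ H.twist_mul]
  coassoc q := by
    induction q using ind_surj hs with
    | h0 => simp
    | hadd x y hx hy => simp only [map_add, hx, hy]
    | h m n =>
      rw [hσ, map_map₂ (a := μ.symm.toLinearMap) (b := ν.symm.toLinearMap) (symm_bilin hτ)
        H.comul_mul, hM.coassoc, hN.coassoc, ← assoc_map₂,
      map_map₂ (a := σM) (b := σN) hσ (mul_symm H)]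
  counit q := by
    induction q using ind_surj hs with
    | h0 => simp
    | hadd x y hx hy => simp only [map_add, hx, hy]
    | h m n =>
      rw [hσ, rid_map₂ β H.counit_mul, hM.counit, hN.counit, symm_bilin hτ]

theorem IsLeftComodule.codiag {μ : M ≃ₗ[k] M} {ν : N ≃ₗ[k] N} {τ : Q ≃ₗ[k] Q}
    {ρM : M →ₗ[k] H.carrier ⊗[k] M} {ρN : N →ₗ[k] H.carrier ⊗[k] N}
    {ρQ : Q →ₗ[k] H.carrier ⊗[k] Q} (hM : IsLeftComodule H μ ρM) (hN : IsLeftComodule H ν ρN)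
    {β : M →ₗ[k] N →ₗ[k] Q} (hs : Function.Surjective (TensorProduct.lift β))
    (hτ : ∀ m n, τ (β m n) = β (μ m) (ν n))
    (hρ : ∀ m n, ρQ (β m n) = map₂ H.mul β (ρM m) (ρN n)) : IsLeftComodule H τ ρQ where
  coact_twist q := by
    induction q using ind_surj hs with
    | h0 => simp
    | hadd x y hx hy => simp only [map_add, hx, hy]
    | h m n =>
      rw [hτ, hρ, hρ, hM.coact_twist, hN.coact_twist, map_map₂ H.twist_mul hτ]
  coassoc q := by
    induction q using ind_surj hs with
    | h0 => simp
    | hadd x y hx hy => simp only [map_add, hx, hy]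
    | h m n =>
      rw [hρ, map_map₂ (a' := μ.symm.toLinearMap) (b' := ν.symm.toLinearMap) H.comul_mul
        (symm_bilin hτ), assoc_map₂, hM.coassoc, hN.coassoc,
      map_map₂ (a' := ρM) (b' := ρN) (mul_symm H) hρ]
  counit q := by
    induction q using ind_surj hs with
    | h0 => simp
    | hadd x y hx hy => simp only [map_add, hx, hy]
    | h m n =>
      rw [hρ, lid_map₂ β H.counit_mul, hM.counit, hN.counit, symm_bilin hτ]

section OfSeparate

variable {μ : M ≃ₗ[k] M} {lact : H.carrier →ₗ[k] M →ₗ[k] M} {ract : M →ₗ[k] H.carrier →ₗ[k] M}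
variable {lcoact : M →ₗ[k] H.carrier ⊗[k] M} {rcoact : M →ₗ[k] M ⊗[k] H.carrier}

/-- Left and right covariance may be checked separately for the two actions. -/
theorem IsBicovariant.of_separate (h₁ : IsLeftModule H μ lact) (h₂ : IsRightModule H μ ract)
    (h₃ : ∀ h m g, ract (lact h m) (H.twist g) = lact (H.twist h) (ract m g))
    (h₄ : IsLeftComodule H μ lcoact) (h₅ : IsRightComodule H μ rcoact)
    (h₆ : ∀ m,
      TensorProduct.map H.twist.toLinearMap
          (TensorProduct.map LinearMap.id H.twist.symm.toLinearMap)
          (TensorProduct.assoc k H.carrier M H.carrier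
            (TensorProduct.map lcoact LinearMap.id (rcoact m))) =
        TensorProduct.map LinearMap.id rcoact (lcoact m))
    (h₇ : ∀ h m, lcoact (lact h m) = map₂ H.mul lact (H.comul h) (lcoact m))
    (h₈ : ∀ m h, lcoact (ract m h) = map₂ H.mul ract (lcoact m) (H.comul h))
    (h₉ : ∀ h m, rcoact (lact h m) = map₂ lact H.mul (H.comul h) (rcoact m))
    (h₁₀ : ∀ m h, rcoact (ract m h) = map₂ ract H.mul (rcoact m) (H.comul h)) :
    IsBicovariant H μ lact ract lcoact rcoact where
  left_module := h₁
  right_module := h₂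
  bimodule := h₃
  left_comodule := h₄
  right_comodule := h₅
  coact_comm := h₆
  left_covariant h m g := by
    rw [h₈, h₇, H.comul_twist, H.comul_twist]
    exact (map₂_assoc H.mul_assoc (fun x y z => (h₃ x y z).symm) _ _ _).symm
  right_covariant h m g := by
    rw [h₁₀, h₉, H.comul_twist, H.comul_twist]
    exact (map₂_assoc (fun x y z => (h₃ x y z).symm) H.mul_assoc _ _ _).symm

theorem IsBicovariant.lcoact_lact (hM : IsBicovariant H μ lact ract lcoact rcoact)
    (h : H.carrier) (m : M) :
    lcoact (lact h m) = map₂ H.mul lact (H.comul h) (lcoact m) := by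
  have e := hM.left_covariant (H.twist.symm h) (μ.symm m) H.one
  have e1 : map₂ H.mul ract (lcoact (μ.symm m)) (H.comul H.one) = lcoact m := by
    rw [H.comul_one, map₂_tmul_right]
    conv_rhs => rw [← μ.apply_symm_apply m, hM.left_comodule.coact_twist]
    congr 2
    · ext x; simp [H.mul_one]
    · ext x; simp [hM.right_module.act_one]
  rwa [H.twist_one, hM.right_module.act_one, hM.left_module.twist_act, e1,
    LinearEquiv.apply_symm_apply, LinearEquiv.apply_symm_apply] at e

theorem IsBicovariant.rcoact_lact (hM : IsBicovariant H μ lact ract lcoact rcoact)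
    (h : H.carrier) (m : M) :
    rcoact (lact h m) = map₂ lact H.mul (H.comul h) (rcoact m) := by
  have e := hM.right_covariant (H.twist.symm h) (μ.symm m) H.one
  have e1 : map₂ ract H.mul (rcoact (μ.symm m)) (H.comul H.one) = rcoact m := by
    rw [H.comul_one, map₂_tmul_right]
    conv_rhs => rw [← μ.apply_symm_apply m, hM.right_comodule.coact_twist]
    congr 2
    · ext x; simp [hM.right_module.act_one]
    · ext x; simp [H.mul_one]
  rwa [H.twist_one, hM.right_module.act_one, hM.left_module.twist_act, e1,
    LinearEquiv.apply_symm_apply, LinearEquiv.apply_symm_apply] at e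

theorem IsBicovariant.lcoact_ract (hM : IsBicovariant H μ lact ract lcoact rcoact)
    (m : M) (h : H.carrier) :
    lcoact (ract m h) = map₂ H.mul ract (lcoact m) (H.comul h) := by
  have e := hM.left_covariant H.one (μ.symm m) (H.twist.symm h)
  have e1 : ∀ X, map₂ H.mul lact (H.one ⊗ₜ[k] H.one) X =
      map H.twist.toLinearMap μ.toLinearMap X := by
    intro X
    rw [TensorProduct.map₂_apply_tmul]
    congr 2
    · ext x; simp [H.one_mul]
    · ext x; simp [hM.left_module.one_act]
  rw [H.twist_one, hM.left_module.one_act, H.comul_one, e1,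
    map_map₂ H.twist_mul hM.right_module.twist_act, ← hM.left_comodule.coact_twist,
    ← H.comul_twist] at e
  simpa using e

theorem IsBicovariant.rcoact_ract (hM : IsBicovariant H μ lact ract lcoact rcoact)
    (m : M) (h : H.carrier) :
    rcoact (ract m h) = map₂ ract H.mul (rcoact m) (H.comul h) := by
  have e := hM.right_covariant H.one (μ.symm m) (H.twist.symm h)
  have e1 : ∀ X, map₂ lact H.mul (H.one ⊗ₜ[k] H.one) X =
      map μ.toLinearMap H.twist.toLinearMap X := by
    intro X
    rw [TensorProduct.map₂_apply_tmul]
    congr 2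
    · ext x; simp [hM.left_module.one_act]
    · ext x; simp [H.one_mul]
  rw [H.twist_one, hM.left_module.one_act, H.comul_one, e1,
    map_map₂ hM.right_module.twist_act H.twist_mul, ← hM.right_comodule.coact_twist,
    ← H.comul_twist] at e
  simpa using e

end OfSeparate

end Basic

end HomHopf

namespace HomHopf

variable {k : Type u} [CommRing k]

/-! ### The category of bicovariant Hom-bimodules -/

/-- A bicovariant `(H, α)`-Hom-bimodule. -/
structure BicovariantBimodule (H : MonoidalHomHopfAlgebra k) extends HomObject k where
  lact : H.carrier →ₗ[k] carrier →ₗ[k] carrier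
  ract : carrier →ₗ[k] H.carrier →ₗ[k] carrier
  lcoact : carrier →ₗ[k] H.carrier ⊗[k] carrier
  rcoact : carrier →ₗ[k] carrier ⊗[k] H.carrier
  isBicovariant : IsBicovariant H twist lact ract lcoact rcoact

variable {H : MonoidalHomHopfAlgebra k}

namespace BicovariantBimodule

/-- Morphisms of bicovariant Hom-bimodules: morphisms in `H̃(M_k)` which are `H`-linear and
`H`-colinear on both sides. -/
@[ext]
structure Hom (M N : BicovariantBimodule H) where
  toLin : M.carrier →ₗ[k] N.carrier
  map_twist : ∀ m, toLin (M.twist m) = N.twist (toLin m)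
  map_lact : ∀ h m, toLin (M.lact h m) = N.lact h (toLin m)
  map_ract : ∀ m h, toLin (M.ract m h) = N.ract (toLin m) h
  map_lcoact : ∀ m, N.lcoact (toLin m) = TensorProduct.map LinearMap.id toLin (M.lcoact m)
  map_rcoact : ∀ m, N.rcoact (toLin m) = TensorProduct.map toLin LinearMap.id (M.rcoact m)

instance : Category (BicovariantBimodule H) where
  Hom M N := Hom M N
  id M :=
    { toLin := LinearMap.id
      map_twist := fun _ => rfl
      map_lact := fun _ _ => rfl
      map_ract := fun _ _ => rfl
      map_lcoact := fun m => by simp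
      map_rcoact := fun m => by simp }
  comp f g :=
    { toLin := g.toLin ∘ₗ f.toLin
      map_twist := fun m => by simp [f.map_twist, g.map_twist]
      map_lact := fun h m => by simp [f.map_lact, g.map_lact]
      map_ract := fun m h => by simp [f.map_ract, g.map_ract]
      map_lcoact := fun m => by
        simp [f.map_lcoact, g.map_lcoact, TensorProduct.map_map]
      map_rcoact := fun m => by
        simp [f.map_rcoact, g.map_rcoact, TensorProduct.map_map] }

@[simp] theorem id_toLin (M : BicovariantBimodule H) : Hom.toLin (𝟙 M) = LinearMap.id := rfl

@[simp] theorem comp_toLin {M N P : BicovariantBimodule H} (f : M ⟶ N) (g : N ⟶ P) :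
    Hom.toLin (f ≫ g) = Hom.toLin g ∘ₗ Hom.toLin f := rfl

@[ext] theorem hom_ext {M N : BicovariantBimodule H} {f g : M ⟶ N}
    (h : Hom.toLin f = Hom.toLin g) : f = g := Hom.ext h

/-- A morphism with a `k`-linear inverse is an isomorphism. -/
def isoOfInv {M N : BicovariantBimodule H} (f : M ⟶ N) (g : N.carrier →ₗ[k] M.carrier)
    (h₁ : ∀ m, g (Hom.toLin f m) = m) (h₂ : ∀ n, Hom.toLin f (g n) = n) : M ≅ N where
  hom := f
  inv :=
    { toLin := g
      map_twist := fun n => by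
        obtain ⟨m, rfl⟩ : ∃ m, Hom.toLin f m = n := ⟨_, h₂ n⟩
        rw [← f.map_twist, h₁, h₁]
      map_lact := fun h n => by
        obtain ⟨m, rfl⟩ : ∃ m, Hom.toLin f m = n := ⟨_, h₂ n⟩
        rw [← f.map_lact, h₁, h₁]
      map_ract := fun n h => by
        obtain ⟨m, rfl⟩ : ∃ m, Hom.toLin f m = n := ⟨_, h₂ n⟩
        rw [← f.map_ract, h₁, h₁]
      map_lcoact := fun n => by
        obtain ⟨m, rfl⟩ : ∃ m, Hom.toLin f m = n := ⟨_, h₂ n⟩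
        have e : g ∘ₗ Hom.toLin f = LinearMap.id := LinearMap.ext h₁
        rw [h₁, f.map_lcoact, TensorProduct.map_map, e]; simp
      map_rcoact := fun n => by
        obtain ⟨m, rfl⟩ : ∃ m, Hom.toLin f m = n := ⟨_, h₂ n⟩
        have e : g ∘ₗ Hom.toLin f = LinearMap.id := LinearMap.ext h₁
        rw [h₁, f.map_rcoact, TensorProduct.map_map, e]; simp }
  hom_inv_id := by ext m; exact h₁ m
  inv_hom_id := by ext m; exact h₂ m

@[simp] theorem isoOfInv_hom {M N : BicovariantBimodule H} (f : M ⟶ N)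
    (g : N.carrier →ₗ[k] M.carrier) (h₁ : ∀ m, g (Hom.toLin f m) = m)
    (h₂ : ∀ n, Hom.toLin f (g n) = n) : (isoOfInv f g h₁ h₂).hom = f := rfl

@[simp] theorem isoOfInv_inv_toLin {M N : BicovariantBimodule H} (f : M ⟶ N)
    (g : N.carrier →ₗ[k] M.carrier) (h₁ : ∀ m, g (Hom.toLin f m) = m)
    (h₂ : ∀ n, Hom.toLin f (g n) = n) : Hom.toLin (isoOfInv f g h₁ h₂).inv = g := rfl

section Symm
variable (M : BicovariantBimodule H)

theorem lact_symm (h : H.carrier) (m : M.carrier) :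
    M.twist.symm (M.lact h m) = M.lact (H.twist.symm h) (M.twist.symm m) :=
  symm_bilin M.isBicovariant.left_module.twist_act h m

theorem ract_symm (m : M.carrier) (h : H.carrier) :
    M.twist.symm (M.ract m h) = M.ract (M.twist.symm m) (H.twist.symm h) :=
  symm_bilin M.isBicovariant.right_module.twist_act m h

theorem twist_lact (h : H.carrier) (m : M.carrier) :
    M.twist (M.lact h m) = M.lact (H.twist h) (M.twist m) :=
  M.isBicovariant.left_module.twist_act h m

theorem twist_ract (m : M.carrier) (h : H.carrier) :
    M.twist (M.ract m h) = M.ract (M.twist m) (H.twist h) :=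
  M.isBicovariant.right_module.twist_act m h

end Symm

/-! #### The twisted tensor product `M ⊗_H N` -/

section Tensor

variable (M N : BicovariantBimodule H)

/-- The submodule spanned by the elements `mh ⊗ n - μ(m) ⊗ h ν⁻¹(n)`, i.e. the image of the
difference of the two maps `(M ⊗ H) ⊗ N → M ⊗ N` whose coequalizer is `M ⊗_H N`. -/
def tensorRel : Submodule k (M.carrier ⊗[k] N.carrier) :=
  Submodule.span k {x | ∃ m h n,
    x = M.ract m h ⊗ₜ[k] n - M.twist m ⊗ₜ[k] N.lact h (N.twist.symm n)}

/-- The underlying module of `M ⊗_H N`. -/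
abbrev TensorCarrier : Type u := (M.carrier ⊗[k] N.carrier) ⧸ tensorRel M N

/-- `m, n ↦ m ⊗_H n`, with values in the underlying module. -/
def preMk : M.carrier →ₗ[k] N.carrier →ₗ[k] TensorCarrier M N :=
  (TensorProduct.mk k M.carrier N.carrier).compr₂ (tensorRel M N).mkQ

variable {M N}

theorem preMk_balanced (m : M.carrier) (h : H.carrier) (n : N.carrier) :
    preMk M N (M.ract m h) n = preMk M N (M.twist m) (N.lact h (N.twist.symm n)) := by
  refine (Submodule.Quotient.eq _).2 (Submodule.subset_span ⟨m, h, n, rfl⟩)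

theorem preMk_balanced' (m : M.carrier) (h : H.carrier) (n : N.carrier) :
    preMk M N m (N.lact h n) = preMk M N (M.ract (M.twist.symm m) h) (N.twist n) := by
  simp [preMk_balanced]

theorem preMk_surj : Function.Surjective (TensorProduct.lift (preMk M N)) := by
  have : TensorProduct.lift (preMk M N) = (tensorRel M N).mkQ := by
    ext; rfl
  rw [this]; exact Submodule.mkQ_surjective _

/-- The universal property of the coequalizer. -/
def preLift {X : Type u} [AddCommGroup X] [Module k X] (f : M.carrier →ₗ[k] N.carrier →ₗ[k] X)
    (hf : ∀ m h n, f (M.ract m h) n = f (M.twist m) (N.lact h (N.twist.symm n))) :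
    TensorCarrier M N →ₗ[k] X :=
  (tensorRel M N).liftQ (TensorProduct.lift f) (by
    refine Submodule.span_le.2 ?_
    rintro _ ⟨m, h, n, rfl⟩
    simp [hf])

@[simp] theorem preLift_mk {X : Type u} [AddCommGroup X] [Module k X]
    (f : M.carrier →ₗ[k] N.carrier →ₗ[k] X)
    (hf : ∀ m h n, f (M.ract m h) n = f (M.twist m) (N.lact h (N.twist.symm n)))
    (m : M.carrier) (n : N.carrier) : preLift f hf (preMk M N m n) = f m n := by
  rfl

theorem preHom_ext {X : Type u} [AddCommGroup X] [Module k X] {f g : TensorCarrier M N →ₗ[k] X}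
    (h : ∀ m n, f (preMk M N m n) = g (preMk M N m n)) : f = g :=
  LinearMap.ext fun x => by
    induction x using ind_surj preMk_surj with
    | h0 => simp
    | hadd x y hx hy => simp only [map_add, hx, hy]
    | h m n => exact h m n

variable (M N)

/-- The automorphism `μ ⊗_H ν`. -/
def tensorTwist : TensorCarrier M N ≃ₗ[k] TensorCarrier M N :=
  LinearEquiv.ofLinearMap
    (preLift ((preMk M N).compl₁₂ M.twist.toLinearMap N.twist.toLinearMap) (fun m h n => by
      simp [twist_lact, twist_ract, preMk_balanced]))
    (preLift ((preMk M N).compl₁₂ M.twist.symm.toLinearMap N.twist.symm.toLinearMap)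
      (fun m h n => by simp [lact_symm, ract_symm, preMk_balanced]))
    (preHom_ext fun m n => by simp) (preHom_ext fun m n => by simp)

@[simp] theorem tensorTwist_mk (m : M.carrier) (n : N.carrier) :
    tensorTwist M N (preMk M N m n) = preMk M N (M.twist m) (N.twist n) := rfl

/-- `h(m ⊗_H n) = α⁻¹(h)m ⊗_H ν(n)`. -/
def tensorLact : H.carrier →ₗ[k] TensorCarrier M N →ₗ[k] TensorCarrier M N :=
  LinearMap.flip (preLift
    (LinearMap.mk₂ k (fun m n =>
        (preMk M N).flip (N.twist n) ∘ₗ M.lact.flip m ∘ₗ H.twist.symm.toLinearMap)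
      (by intros; ext; simp) (by intros; ext; simp) (by intros; ext; simp)
      (by intros; ext; simp))
    (fun m h n => by
      ext g
      have e := M.isBicovariant.bimodule (H.twist.symm (H.twist.symm g)) m h
      simp only [LinearMap.mk₂_apply, LinearMap.comp_apply, LinearMap.flip_apply,
        LinearEquiv.coe_coe, twist_lact, LinearEquiv.apply_symm_apply]
      rw [preMk_balanced']
      simp only [lact_symm, LinearEquiv.symm_apply_apply]
      rw [e]; simp))

@[simp] theorem tensorLact_mk (h : H.carrier) (m : M.carrier) (n : N.carrier) :
    tensorLact M N h (preMk M N m n) = preMk M N (M.lact (H.twist.symm h) m) (N.twist n) := rfl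

/-- `(m ⊗_H n)h = μ(m) ⊗_H nα⁻¹(h)`. -/
def tensorRact : TensorCarrier M N →ₗ[k] H.carrier →ₗ[k] TensorCarrier M N :=
  preLift
    (LinearMap.mk₂ k (fun m n =>
        preMk M N (M.twist m) ∘ₗ N.ract n ∘ₗ H.twist.symm.toLinearMap)
      (by intros; ext; simp) (by intros; ext; simp) (by intros; ext; simp)
      (by intros; ext; simp))
    (fun m h n => by
      ext g
      have e := N.isBicovariant.bimodule h (N.twist.symm n) (H.twist.symm (H.twist.symm g))
      simp only [LinearEquiv.apply_symm_apply] at e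
      simp only [LinearMap.mk₂_apply, LinearMap.comp_apply, LinearEquiv.coe_coe, twist_ract, e,
        preMk_balanced, ract_symm])

@[simp] theorem tensorRact_mk (m : M.carrier) (n : N.carrier) (h : H.carrier) :
    tensorRact M N (preMk M N m n) h = preMk M N (M.twist m) (N.ract n (H.twist.symm h)) := rfl

/-- `ρ(m ⊗_H n) = m₍₋₁₎n₍₋₁₎ ⊗ (m₍₀₎ ⊗_H n₍₀₎)`. -/
def tensorLcoact : TensorCarrier M N →ₗ[k] H.carrier ⊗[k] TensorCarrier M N :=
  preLift ((TensorProduct.map₂ H.mul (preMk M N)).compl₁₂ M.lcoact N.lcoact) (fun m h n => by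
    simp only [LinearMap.compl₁₂_apply, M.isBicovariant.lcoact_ract,
      N.isBicovariant.lcoact_lact, M.isBicovariant.left_comodule.coact_twist,
      N.isBicovariant.left_comodule.coact_symm]
    rw [map₂_assoc (F₁ := H.mul) (F₁' := H.mul) (c := H.twist.toLinearMap)
      (G₁ := preMk M N) (G₁' := M.ract) (d := N.twist.toLinearMap)
      (by intro x y z; exact H.mul_assoc x y z)
      (by intro x y z; simp [preMk_balanced]), map_map_symm])

@[simp] theorem tensorLcoact_mk (m : M.carrier) (n : N.carrier) :
    tensorLcoact M N (preMk M N m n) =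
      TensorProduct.map₂ H.mul (preMk M N) (M.lcoact m) (N.lcoact n) := rfl

/-- `σ(m ⊗_H n) = (m₍₀₎ ⊗_H n₍₀₎) ⊗ m₍₁₎n₍₁₎`. -/
def tensorRcoact : TensorCarrier M N →ₗ[k] TensorCarrier M N ⊗[k] H.carrier :=
  preLift ((TensorProduct.map₂ (preMk M N) H.mul).compl₁₂ M.rcoact N.rcoact) (fun m h n => by
    simp only [LinearMap.compl₁₂_apply, M.isBicovariant.rcoact_ract,
      N.isBicovariant.rcoact_lact, M.isBicovariant.right_comodule.coact_twist,
      N.isBicovariant.right_comodule.coact_symm]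
    rw [map₂_assoc (G₁ := H.mul) (G₁' := H.mul) (d := H.twist.toLinearMap)
      (F₁ := preMk M N) (F₁' := M.ract) (c := N.twist.toLinearMap)
      (by intro x y z; simp [preMk_balanced])
      (by intro x y z; exact H.mul_assoc x y z), map_map_symm])

@[simp] theorem tensorRcoact_mk (m : M.carrier) (n : N.carrier) :
    tensorRcoact M N (preMk M N m n) =
      TensorProduct.map₂ (preMk M N) H.mul (M.rcoact m) (N.rcoact n) := rfl

theorem tensor_isLeftModule : IsLeftModule H (tensorTwist M N) (tensorLact M N) where
  twist_act h x := by
    induction x using ind_surj preMk_surj with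
    | h0 => simp
    | hadd x y hx hy => simp only [map_add, hx, hy]
    | h m n => simp [twist_lact]
  act_act g h x := by
    induction x using ind_surj preMk_surj with
    | h0 => simp
    | hadd x y hx hy => simp only [map_add, hx, hy]
    | h m n =>
      have e := M.isBicovariant.left_module.act_act (H.twist.symm g) (H.twist.symm h) m
      simp only [LinearEquiv.apply_symm_apply] at e
      simp [mul_symm, e]
  one_act x := by
    induction x using ind_surj preMk_surj with
    | h0 => simp
    | hadd x y hx hy => simp only [map_add, hx, hy]
    | h m n => simp [symm_one, M.isBicovariant.left_module.one_act]

theorem tensor_isRightModule : IsRightModule H (tensorTwist M N) (tensorRact M N) where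
  twist_act x h := by
    induction x using ind_surj preMk_surj with
    | h0 => simp
    | hadd x y hx hy => simp only [map_add, LinearMap.add_apply, hx, hy]
    | h m n => simp [twist_ract]
  act_act x g h := by
    induction x using ind_surj preMk_surj with
    | h0 => simp
    | hadd x y hx hy => simp only [map_add, LinearMap.add_apply, hx, hy]
    | h m n =>
      have e := N.isBicovariant.right_module.act_act n (H.twist.symm g) (H.twist.symm h)
      simp only [LinearEquiv.apply_symm_apply] at e
      simp [mul_symm, e]
  act_one x := by
    induction x using ind_surj preMk_surj with
    | h0 => simp
    | hadd x y hx hy => simp only [map_add, LinearMap.add_apply, hx, hy]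
    | h m n => simp [symm_one, N.isBicovariant.right_module.act_one]

theorem tensor_isBicovariant : IsBicovariant H (tensorTwist M N) (tensorLact M N)
    (tensorRact M N) (tensorLcoact M N) (tensorRcoact M N) := by
  have hsymm := symm_bilin (tensorTwist_mk M N)
  refine .of_separate (tensor_isLeftModule M N) (tensor_isRightModule M N) ?_
    (.codiag M.isBicovariant.left_comodule N.isBicovariant.left_comodule preMk_surj
      (tensorTwist_mk M N) (tensorLcoact_mk M N))
    (.codiag M.isBicovariant.right_comodule N.isBicovariant.right_comodule preMk_surj
      (tensorTwist_mk M N) (tensorRcoact_mk M N)) ?_ ?_ ?_ ?_ ?_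
  · intro h x g
    induction x using ind_surj preMk_surj with
    | h0 => simp
    | hadd x y hx hy => simp only [map_add, LinearMap.add_apply, hx, hy]
    | h m n => simp [twist_lact, twist_ract]
  · intro x
    induction x using ind_surj preMk_surj with
    | h0 => simp
    | hadd x y hx hy => simp only [map_add, hx, hy]
    | h m n =>
      rw [tensorRcoact_mk, map_map₂ (f' := TensorProduct.map₂ H.mul (preMk M N)) (g' := H.mul)
          (a := M.lcoact) (b := N.lcoact) (a' := LinearMap.id) (b' := LinearMap.id)
          (tensorLcoact_mk M N) (fun _ _ => rfl), assoc_map₂,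
        map_map₂ (f' := H.mul) (a := H.twist.toLinearMap) (b := H.twist.toLinearMap)
          (g' := TensorProduct.map₂ (preMk M N) H.mul)
          (a' := TensorProduct.map LinearMap.id H.twist.symm.toLinearMap)
          (b' := TensorProduct.map LinearMap.id H.twist.symm.toLinearMap)
          H.twist_mul (fun X Y => map_map₂ (fun _ _ => rfl) (mul_symm H) X Y),
        M.isBicovariant.coact_comm, N.isBicovariant.coact_comm, tensorLcoact_mk,
        map_map₂ (a := LinearMap.id) (b := LinearMap.id) (fun _ _ => rfl) (tensorRcoact_mk M N)]
  · intro h x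
    induction x using ind_surj preMk_surj with
    | h0 => simp
    | hadd x y hx hy => simp only [map_add, hx, hy]
    | h m n =>
      rw [tensorLact_mk, tensorLcoact_mk, tensorLcoact_mk, M.isBicovariant.lcoact_lact,
        N.isBicovariant.left_comodule.coact_twist, comul_symm,
        ← map₂_assoc (f := H.mul) (f' := H.mul) (p := H.twist.toLinearMap)
          (g := tensorLact M N) (g' := preMk M N) (q := H.twist.toLinearMap)
          (by intro x y z; exact H.mul_assoc x y z)
          (by intro x y z; simp), map_map_symm]
  · intro x h
    induction x using ind_surj preMk_surj with
    | h0 => simp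
    | hadd x y hx hy => simp only [map_add, LinearMap.add_apply, hx, hy]
    | h m n =>
      rw [tensorRact_mk, tensorLcoact_mk, tensorLcoact_mk, N.isBicovariant.lcoact_ract,
        M.isBicovariant.left_comodule.coact_twist, comul_symm,
        map₂_assoc (F₁ := H.mul) (F₁' := H.mul) (c := H.twist.toLinearMap)
          (G₁ := tensorRact M N) (G₁' := preMk M N) (d := H.twist.toLinearMap)
          (by intro x y z; exact H.mul_assoc x y z)
          (by intro x y z; simp), map_map_symm]
  · intro h x
    induction x using ind_surj preMk_surj with
    | h0 => simp
    | hadd x y hx hy => simp only [map_add, hx, hy]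
    | h m n =>
      rw [tensorLact_mk, tensorRcoact_mk, tensorRcoact_mk, M.isBicovariant.rcoact_lact,
        N.isBicovariant.right_comodule.coact_twist, comul_symm,
        ← map₂_assoc (g := H.mul) (g' := H.mul) (q := H.twist.toLinearMap)
          (f := tensorLact M N) (f' := preMk M N) (p := H.twist.toLinearMap)
          (by intro x y z; simp)
          (by intro x y z; exact H.mul_assoc x y z), map_map_symm]
  · intro x h
    induction x using ind_surj preMk_surj with
    | h0 => simp
    | hadd x y hx hy => simp only [map_add, LinearMap.add_apply, hx, hy]
    | h m n =>
      rw [tensorRact_mk, tensorRcoact_mk, tensorRcoact_mk, N.isBicovariant.rcoact_ract,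
        M.isBicovariant.right_comodule.coact_twist, comul_symm,
        map₂_assoc (G₁ := H.mul) (G₁' := H.mul) (d := H.twist.toLinearMap)
          (F₁ := tensorRact M N) (F₁' := preMk M N) (c := H.twist.toLinearMap)
          (by intro x y z; simp)
          (by intro x y z; exact H.mul_assoc x y z), map_map_symm]

/-- The bicovariant Hom-bimodule `M ⊗_H N`. -/
def tensor : BicovariantBimodule H where
  carrier := TensorCarrier M N
  twist := tensorTwist M N
  lact := tensorLact M N
  ract := tensorRact M N
  lcoact := tensorLcoact M N
  rcoact := tensorRcoact M N
  isBicovariant := tensor_isBicovariant M N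

end Tensor

end BicovariantBimodule

end HomHopf

namespace HomHopf

variable {k : Type u} [CommRing k] {H : MonoidalHomHopfAlgebra k}

namespace BicovariantBimodule

section TensorAPI

variable {M N P : BicovariantBimodule H}

variable (M N) in
/-- `m, n ↦ m ⊗_H n`. -/
def tmk : M.carrier →ₗ[k] N.carrier →ₗ[k] (tensor M N).carrier := preMk M N

theorem tmk_balanced (m : M.carrier) (h : H.carrier) (n : N.carrier) :
    tmk M N (M.ract m h) n = tmk M N (M.twist m) (N.lact h (N.twist.symm n)) :=
  preMk_balanced m h n

theorem tmk_balanced' (m : M.carrier) (h : H.carrier) (n : N.carrier) :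
    tmk M N m (N.lact h n) = tmk M N (M.ract (M.twist.symm m) h) (N.twist n) :=
  preMk_balanced' m h n

theorem tmk_surj : Function.Surjective (TensorProduct.lift (tmk M N)) := preMk_surj

/-- The universal property of `M ⊗_H N`. -/
def lift {X : Type u} [AddCommGroup X] [Module k X] (f : M.carrier →ₗ[k] N.carrier →ₗ[k] X)
    (hf : ∀ m h n, f (M.ract m h) n = f (M.twist m) (N.lact h (N.twist.symm n))) :
    (tensor M N).carrier →ₗ[k] X := preLift f hf

@[simp] theorem lift_mk {X : Type u} [AddCommGroup X] [Module k X]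
    (f : M.carrier →ₗ[k] N.carrier →ₗ[k] X)
    (hf : ∀ m h n, f (M.ract m h) n = f (M.twist m) (N.lact h (N.twist.symm n)))
    (m : M.carrier) (n : N.carrier) : lift f hf (tmk M N m n) = f m n := rfl

theorem tensor_ext {X : Type u} [AddCommGroup X] [Module k X]
    {f g : (tensor M N).carrier →ₗ[k] X}
    (h : ∀ m n, f (tmk M N m n) = g (tmk M N m n)) : f = g := preHom_ext h

@[simp] theorem tensor_twist_mk (m : M.carrier) (n : N.carrier) :
    (tensor M N).twist (tmk M N m n) = tmk M N (M.twist m) (N.twist n) := rfl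

@[simp] theorem tensor_twist_symm_mk (m : M.carrier) (n : N.carrier) :
    (tensor M N).twist.symm (tmk M N m n) = tmk M N (M.twist.symm m) (N.twist.symm n) := rfl

@[simp] theorem tensor_lact_mk (h : H.carrier) (m : M.carrier) (n : N.carrier) :
    (tensor M N).lact h (tmk M N m n) = tmk M N (M.lact (H.twist.symm h) m) (N.twist n) := rfl

@[simp] theorem tensor_ract_mk (m : M.carrier) (n : N.carrier) (h : H.carrier) :
    (tensor M N).ract (tmk M N m n) h = tmk M N (M.twist m) (N.ract n (H.twist.symm h)) := rfl

theorem tensor_lcoact_mk (m : M.carrier) (n : N.carrier) :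
    (tensor M N).lcoact (tmk M N m n) =
      TensorProduct.map₂ H.mul (tmk M N) (M.lcoact m) (N.lcoact n) := rfl

theorem tensor_rcoact_mk (m : M.carrier) (n : N.carrier) :
    (tensor M N).rcoact (tmk M N m n) =
      TensorProduct.map₂ (tmk M N) H.mul (M.rcoact m) (N.rcoact n) := rfl

/-- A balanced bilinear map compatible with all the structures induces a morphism. -/
def homOfBilin (f : M.carrier →ₗ[k] N.carrier →ₗ[k] P.carrier)
    (hf : ∀ m h n, f (M.ract m h) n = f (M.twist m) (N.lact h (N.twist.symm n)))
    (h₁ : ∀ m n, f (M.twist m) (N.twist n) = P.twist (f m n))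
    (h₂ : ∀ h m n, f (M.lact (H.twist.symm h) m) (N.twist n) = P.lact h (f m n))
    (h₃ : ∀ m n h, f (M.twist m) (N.ract n (H.twist.symm h)) = P.ract (f m n) h)
    (h₄ : ∀ m n, P.lcoact (f m n) = TensorProduct.map₂ H.mul f (M.lcoact m) (N.lcoact n))
    (h₅ : ∀ m n, P.rcoact (f m n) = TensorProduct.map₂ f H.mul (M.rcoact m) (N.rcoact n)) :
    tensor M N ⟶ P where
  toLin := lift f hf
  map_twist x := by
    induction x using ind_surj tmk_surj with
    | h0 => simp
    | hadd x y hx hy => simp only [map_add, hx, hy]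
    | h m n => simp [h₁]
  map_lact h x := by
    induction x using ind_surj tmk_surj with
    | h0 => simp
    | hadd x y hx hy => simp only [map_add, hx, hy]
    | h m n => simp [h₂]
  map_ract x h := by
    induction x using ind_surj tmk_surj with
    | h0 => simp
    | hadd x y hx hy => simp only [map_add, LinearMap.add_apply, hx, hy]
    | h m n => simp [h₃]
  map_lcoact x := by
    induction x using ind_surj tmk_surj with
    | h0 => simp
    | hadd x y hx hy => simp only [map_add, hx, hy]
    | h m n =>
      rw [lift_mk, h₄, tensor_lcoact_mk, map_map₂ (f' := H.mul) (g' := f) (a := LinearMap.id)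
        (b := LinearMap.id) (a' := LinearMap.id) (b' := LinearMap.id) (fun _ _ => rfl)
        (fun x y => lift_mk f hf x y)]
      simp
  map_rcoact x := by
    induction x using ind_surj tmk_surj with
    | h0 => simp
    | hadd x y hx hy => simp only [map_add, hx, hy]
    | h m n =>
      rw [lift_mk, h₅, tensor_rcoact_mk, map_map₂ (g' := H.mul) (f' := f) (a := LinearMap.id)
        (b := LinearMap.id) (a' := LinearMap.id) (b' := LinearMap.id)
        (fun x y => lift_mk f hf x y) (fun _ _ => rfl)]
      simp

@[simp] theorem homOfBilin_mk (f : M.carrier →ₗ[k] N.carrier →ₗ[k] P.carrier)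
    (hf h₁ h₂ h₃ h₄ h₅) (m : M.carrier) (n : N.carrier) :
    Hom.toLin (homOfBilin (H := H) f hf h₁ h₂ h₃ h₄ h₅) (tmk M N m n) = f m n := rfl

theorem tensor_hom_ext {f g : tensor M N ⟶ P}
    (h : ∀ m n, Hom.toLin f (tmk M N m n) = Hom.toLin g (tmk M N m n)) : f = g :=
  hom_ext (tensor_ext h)

theorem map_twist_symm (f : M ⟶ N) (m : M.carrier) :
    Hom.toLin f (M.twist.symm m) = N.twist.symm (Hom.toLin f m) := by
  rw [LinearEquiv.eq_symm_apply, ← f.map_twist, LinearEquiv.apply_symm_apply]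

end TensorAPI

/-- `f ⊗_H g`. -/
def tensorMap {M N M' N' : BicovariantBimodule H} (f : M ⟶ M') (g : N ⟶ N') :
    tensor M N ⟶ tensor M' N' :=
  homOfBilin ((tmk M' N').compl₁₂ (Hom.toLin f) (Hom.toLin g))
    (fun m h n => by
      simp [f.map_ract, g.map_lact, tmk_balanced, f.map_twist, map_twist_symm])
    (fun m n => by simp [f.map_twist, g.map_twist])
    (fun h m n => by simp [f.map_lact, g.map_twist])
    (fun m n h => by simp [f.map_twist, g.map_ract])
    (fun m n => by
      rw [LinearMap.compl₁₂_apply, tensor_lcoact_mk, f.map_lcoact, g.map_lcoact,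
        ← map_map₂ (c := LinearMap.id) (c' := LinearMap.id) (f := H.mul)
          (g := (tmk M' N').compl₁₂ (Hom.toLin f) (Hom.toLin g))
          (fun _ _ => rfl) (fun _ _ => rfl)]
      simp)
    (fun m n => by
      rw [LinearMap.compl₁₂_apply, tensor_rcoact_mk, f.map_rcoact, g.map_rcoact,
        ← map_map₂ (c := LinearMap.id) (c' := LinearMap.id) (g := H.mul)
          (f := (tmk M' N').compl₁₂ (Hom.toLin f) (Hom.toLin g))
          (fun _ _ => rfl) (fun _ _ => rfl)]
      simp)

@[simp] theorem tensorMap_mk {M N M' N' : BicovariantBimodule H} (f : M ⟶ M') (g : N ⟶ N')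
    (m : M.carrier) (n : N.carrier) :
    Hom.toLin (tensorMap f g) (tmk M N m n) = tmk M' N' (Hom.toLin f m) (Hom.toLin g n) := rfl

/-- The unit object `(H, α)`, with the multiplication as actions and the comultiplication as
coactions. -/
def unit (H : MonoidalHomHopfAlgebra k) : BicovariantBimodule H where
  toHomObject := H.toHomObject
  lact := H.mul
  ract := H.mul
  lcoact := H.comul
  rcoact := H.comul
  isBicovariant := .of_separate (isLeftModule_self H) (isRightModule_self H)
    (fun h m g => (H.mul_assoc h m g).symm) (isLeftComodule_self H) (isRightComodule_self H)
    (fun m => by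
      have e := (isLeftComodule_self H).coassoc m
      have e' : ∀ X : (H.carrier ⊗[k] H.carrier) ⊗[k] H.carrier,
          TensorProduct.map LinearMap.id
            (TensorProduct.map LinearMap.id H.twist.symm.toLinearMap)
            (TensorProduct.assoc k _ _ _ X) =
          TensorProduct.assoc k _ _ _
            (TensorProduct.map LinearMap.id H.twist.symm.toLinearMap X) := by
        intro X
        exact LinearMap.congr_fun (f := TensorProduct.map LinearMap.id
            (TensorProduct.map LinearMap.id H.twist.symm.toLinearMap) ∘ₗ
              (TensorProduct.assoc k H.carrier H.carrier H.carrier).toLinearMap)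
          (g := (TensorProduct.assoc k H.carrier H.carrier H.carrier).toLinearMap ∘ₗ
            TensorProduct.map LinearMap.id H.twist.symm.toLinearMap) (by ext; simp) X
      have e1 : TensorProduct.map H.twist.toLinearMap
            (TensorProduct.map LinearMap.id H.twist.symm.toLinearMap) =
          TensorProduct.map H.twist.toLinearMap LinearMap.id ∘ₗ
            TensorProduct.map (LinearMap.id : H.carrier →ₗ[k] H.carrier)
            (TensorProduct.map (LinearMap.id : H.carrier →ₗ[k] H.carrier)
              H.twist.symm.toLinearMap) := by
        rw [← TensorProduct.map_comp]; rfl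
      rw [e1, LinearMap.comp_apply, e', TensorProduct.map_map]
      simp only [LinearMap.comp_id, LinearMap.id_comp]
      rw [e, TensorProduct.map_map]
      simp)
    (fun h m => H.comul_mul h m) (fun h m => H.comul_mul h m)
    (fun h m => H.comul_mul h m) (fun h m => H.comul_mul h m)

section Constraints

variable (M N P : BicovariantBimodule H)

/-- The bilinear map underlying the associativity constraint. -/
def assocBilin : (tensor M N).carrier →ₗ[k] P.carrier →ₗ[k] (tensor M (tensor N P)).carrier :=
  lift (LinearMap.mk₂ k
      (fun m n => tmk M (tensor N P) (M.twist m) ∘ₗ tmk N P n ∘ₗ P.twist.symm.toLinearMap)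
      (by intros; ext; simp) (by intros; ext; simp) (by intros; ext; simp)
      (by intros; ext; simp))
    (fun m h n => by
      ext p
      simp [twist_ract, tmk_balanced])

@[simp] theorem assocBilin_mk (m : M.carrier) (n : N.carrier) (p : P.carrier) :
    assocBilin M N P (tmk M N m n) p =
      tmk M (tensor N P) (M.twist m) (tmk N P n (P.twist.symm p)) := rfl

/-- The associativity constraint `(m ⊗_H n) ⊗_H p ↦ μ(m) ⊗_H (n ⊗_H π⁻¹(p))`. -/
def assocHom : tensor (tensor M N) P ⟶ tensor M (tensor N P) :=
  homOfBilin (assocBilin M N P)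
    (fun x h p => by
      induction x using ind_surj tmk_surj with
      | h0 => simp
      | hadd x y hx hy => simp only [map_add, LinearMap.add_apply, hx, hy]
      | h m n => simp [tmk_balanced, lact_symm])
    (fun x p => by
      induction x using ind_surj tmk_surj with
      | h0 => simp
      | hadd x y hx hy => simp only [map_add, LinearMap.add_apply, hx, hy]
      | h m n => simp)
    (fun h x p => by
      induction x using ind_surj tmk_surj with
      | h0 => simp
      | hadd x y hx hy => simp only [map_add, LinearMap.add_apply, hx, hy]
      | h m n => simp [twist_lact])
    (fun x p h => by
      induction x using ind_surj tmk_surj with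
      | h0 => simp
      | hadd x y hx hy => simp only [map_add, LinearMap.add_apply, hx, hy]
      | h m n => simp [ract_symm])
    (fun x p => by
      induction x using ind_surj tmk_surj with
      | h0 => simp
      | hadd x y hx hy => simp only [map_add, LinearMap.add_apply, hx, hy]
      | h m n =>
        rw [assocBilin_mk, tensor_lcoact_mk, tensor_lcoact_mk, tensor_lcoact_mk,
          M.isBicovariant.left_comodule.coact_twist, P.isBicovariant.left_comodule.coact_symm,
          map₂_assoc (f := H.mul) (F₁ := H.mul) (F₁' := H.mul) (c := H.twist.toLinearMap)
            (G₁ := assocBilin M N P) (G₁' := tmk M N) (d := P.twist.toLinearMap)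
            (by intro x y z; exact H.mul_assoc x y z) (by intro x y z; simp), map_map_symm])
    (fun x p => by
      induction x using ind_surj tmk_surj with
      | h0 => simp
      | hadd x y hx hy => simp only [map_add, LinearMap.add_apply, hx, hy]
      | h m n =>
        rw [assocBilin_mk, tensor_rcoact_mk, tensor_rcoact_mk, tensor_rcoact_mk,
          M.isBicovariant.right_comodule.coact_twist, P.isBicovariant.right_comodule.coact_symm,
          map₂_assoc (g := H.mul) (G₁ := H.mul) (G₁' := H.mul) (d := H.twist.toLinearMap)
            (F₁ := assocBilin M N P) (F₁' := tmk M N) (c := P.twist.toLinearMap)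
            (by intro x y z; simp) (by intro x y z; exact H.mul_assoc x y z), map_map_symm])

@[simp] theorem assocHom_mk (m : M.carrier) (n : N.carrier) (p : P.carrier) :
    Hom.toLin (assocHom M N P) (tmk (tensor M N) P (tmk M N m n) p) =
      tmk M (tensor N P) (M.twist m) (tmk N P n (P.twist.symm p)) := rfl

/-- The inverse `m ⊗_H (n ⊗_H p) ↦ (μ⁻¹(m) ⊗_H n) ⊗_H π(p)` of the associativity constraint. -/
def assocInv : (tensor M (tensor N P)).carrier →ₗ[k] (tensor (tensor M N) P).carrier :=
  lift (LinearMap.flip (lift (LinearMap.mk₂ k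
      (fun n p => (tmk (tensor M N) P).flip (P.twist p) ∘ₗ (tmk M N).flip n ∘ₗ
        M.twist.symm.toLinearMap)
      (by intros; ext; simp) (by intros; ext; simp) (by intros; ext; simp)
      (by intros; ext; simp))
    (fun n h p => by
      ext m
      simp [twist_lact, tmk_balanced'])))
    (fun m h x => by
      induction x using ind_surj tmk_surj with
      | h0 => simp
      | hadd x y hx hy => simp only [map_add, hx, hy]
      | h n p => simp [tmk_balanced', ract_symm])

@[simp] theorem assocInv_mk (m : M.carrier) (n : N.carrier) (p : P.carrier) :
    assocInv M N P (tmk M (tensor N P) m (tmk N P n p)) =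
      tmk (tensor M N) P (tmk M N (M.twist.symm m) n) (P.twist p) := rfl

/-- The associativity constraint. -/
def assocIso : tensor (tensor M N) P ≅ tensor M (tensor N P) :=
  isoOfInv (assocHom M N P) (assocInv M N P)
    (fun x => by
      induction x using ind_surj tmk_surj with
      | h0 => simp
      | hadd x y hx hy => simp only [map_add, hx, hy]
      | h x p =>
        induction x using ind_surj tmk_surj with
        | h0 => simp
        | hadd x y hx hy => simp only [map_add, LinearMap.add_apply, hx, hy]
        | h m n => simp)
    (fun x => by
      induction x using ind_surj tmk_surj with
      | h0 => simp
      | hadd x y hx hy => simp only [map_add, hx, hy]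
      | h m x =>
        induction x using ind_surj tmk_surj with
        | h0 => simp
        | hadd x y hx hy => simp only [map_add, hx, hy]
        | h n p => simp)

/-- The left unit constraint `h ⊗_H m ↦ hm`. -/
def leftUnitIso : tensor (unit H) M ≅ M :=
  isoOfInv
    (homOfBilin (M := unit H) M.lact
      (fun g h m => by
        have e := M.isBicovariant.left_module.act_act g h (M.twist.symm m)
        rw [LinearEquiv.apply_symm_apply] at e
        exact e.symm)
      (fun h m => (M.twist_lact h m).symm)
      (fun h g m => by
        have e := M.isBicovariant.left_module.act_act (H.twist.symm h) g m
        rw [LinearEquiv.apply_symm_apply] at e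
        exact e.symm)
      (fun g m h => by
        have e := M.isBicovariant.bimodule g m (H.twist.symm h)
        rw [LinearEquiv.apply_symm_apply] at e
        exact e.symm)
      (fun h m => M.isBicovariant.lcoact_lact h m)
      (fun h m => M.isBicovariant.rcoact_lact h m))
    (tmk (unit H) M H.one ∘ₗ M.twist.symm.toLinearMap)
    (fun x => by
      induction x using ind_surj tmk_surj with
      | h0 => simp
      | hadd x y hx hy => simp only [map_add, hx, hy]
      | h h m =>
        have e := tmk_balanced (M := unit H) (N := M) H.one (H.twist.symm h) m
        have e1 : (unit H).ract H.one (H.twist.symm h) = h := by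
          exact (H.one_mul _).trans (H.twist.apply_symm_apply h)
        have e2 : (unit H).twist H.one = H.one := H.twist_one
        rw [e1, e2] at e
        exact (congrArg (tmk (unit H) M H.one) (lact_symm M h m)).trans e.symm)
    (fun m => (M.isBicovariant.left_module.one_act _).trans (M.twist.apply_symm_apply m))

@[simp] theorem leftUnitIso_mk (h : H.carrier) (m : M.carrier) :
    Hom.toLin (leftUnitIso M).hom (tmk (unit H) M h m) = M.lact h m := rfl

/-- The right unit constraint `m ⊗_H h ↦ mh`. -/
def rightUnitIso : tensor M (unit H) ≅ M :=
  isoOfInv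
    (homOfBilin (N := unit H) M.ract
      (fun m g (h : H.carrier) => by
        have e := M.isBicovariant.right_module.act_act m g (H.twist.symm h)
        rw [LinearEquiv.apply_symm_apply] at e
        exact e.symm)
      (fun m h => (M.twist_ract m h).symm)
      (fun h m g => by
        have e := M.isBicovariant.bimodule (H.twist.symm h) m g
        rw [LinearEquiv.apply_symm_apply] at e
        exact e)
      (fun m g h => by
        have e := M.isBicovariant.right_module.act_act m g (H.twist.symm h)
        rw [LinearEquiv.apply_symm_apply] at e
        exact e)
      (fun m h => M.isBicovariant.lcoact_ract m h)
      (fun m h => M.isBicovariant.rcoact_ract m h))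
    ((tmk M (unit H)).flip H.one ∘ₗ M.twist.symm.toLinearMap)
    (fun x => by
      induction x using ind_surj tmk_surj with
      | h0 => simp
      | hadd x y hx hy => simp only [map_add, hx, hy]
      | h m h =>
        have e := tmk_balanced' (M := M) (N := unit H) m (H.twist.symm h) H.one
        have e1 : (unit H).lact (H.twist.symm h) H.one = h := by
          exact (H.mul_one _).trans (H.twist.apply_symm_apply h)
        have e2 : (unit H).twist H.one = H.one := H.twist_one
        rw [e1, e2] at e
        exact (congrArg (fun x => tmk M (unit H) x H.one) (ract_symm M m h)).trans e.symm)
    (fun m => (M.isBicovariant.right_module.act_one _).trans (M.twist.apply_symm_apply m))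

@[simp] theorem rightUnitIso_mk (m : M.carrier) (h : H.carrier) :
    Hom.toLin (rightUnitIso M).hom (tmk M (unit H) m h) = M.ract m h := rfl

end Constraints

instance : MonoidalCategoryStruct (BicovariantBimodule H) where
  tensorObj := tensor
  whiskerLeft M _ _ f := tensorMap (𝟙 M) f
  whiskerRight f N := tensorMap f (𝟙 N)
  tensorHom f g := tensorMap f g
  tensorUnit := unit H
  associator := assocIso
  leftUnitor := leftUnitIso
  rightUnitor := rightUnitIso

/-- Bicovariant Hom-bimodules form a monoidal category with the twisted tensor product `⊗_H`. -/
instance : MonoidalCategory (BicovariantBimodule H) :=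
  MonoidalCategory.ofTensorHom
    (id_tensorHom_id := fun M N => tensor_hom_ext fun _ _ => rfl)
    (id_tensorHom := fun _ _ _ _ => rfl)
    (tensorHom_id := fun _ _ => rfl)
    (tensorHom_comp_tensorHom := fun _ _ _ _ => tensor_hom_ext fun _ _ => rfl)
    (associator_naturality := fun {M N P _ _ _} f g h => tensor_hom_ext fun x p => by
      induction x using ind_surj tmk_surj with
      | h0 => simp
      | hadd x y hx hy => simp only [map_add, LinearMap.add_apply, hx, hy]
      | h m n =>
        exact congrArg₂ (fun a b => tmk _ (tensor _ _) a (tmk _ _ (Hom.toLin g n) b))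
          (f.map_twist m).symm (map_twist_symm h p).symm)
    (leftUnitor_naturality := fun f => tensor_hom_ext fun h m => (f.map_lact h m).symm)
    (rightUnitor_naturality := fun f => tensor_hom_ext fun m h => (f.map_ract m h).symm)
    (pentagon := fun M N P Q => tensor_hom_ext fun x q => by
      induction x using ind_surj tmk_surj with
      | h0 => simp
      | hadd x y hx hy => simp only [map_add, LinearMap.add_apply, hx, hy]
      | h x p =>
        induction x using ind_surj tmk_surj with
        | h0 => simp
        | hadd x y hx hy => simp only [map_add, LinearMap.add_apply, hx, hy]
        | h m n => rfl)
    (triangle := fun M N => tensor_hom_ext fun x n => by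
      induction x using ind_surj tmk_surj with
      | h0 => simp
      | hadd x y hx hy => simp only [map_add, LinearMap.add_apply, hx, hy]
      | h m h => exact (tmk_balanced m h n).symm)

end BicovariantBimodule

end HomHopf

namespace HomHopf

/-! ### Diagonal actions, codiagonal coactions and free left Hom-Hopf modules -/

section Raw

variable {k : Type u} [CommRing k] (H : MonoidalHomHopfAlgebra k)
variable {M N : Type u} [AddCommGroup M] [Module k M] [AddCommGroup N] [Module k N]

open TensorProduct (map map₂)

/-- The diagonal right action `(m ⊗ n)h = mh₁ ⊗ nh₂`. -/
def diagAct (actM : M →ₗ[k] H.carrier →ₗ[k] M) (actN : N →ₗ[k] H.carrier →ₗ[k] N) :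
    M ⊗[k] N →ₗ[k] H.carrier →ₗ[k] M ⊗[k] N :=
  (TensorProduct.map₂ actM actN).compl₂ H.comul

/-- The codiagonal right coaction `m ⊗ n ↦ (m₍₀₎ ⊗ n₍₀₎) ⊗ m₍₁₎n₍₁₎`. -/
def codiagCoact (σM : M →ₗ[k] M ⊗[k] H.carrier) (σN : N →ₗ[k] N ⊗[k] H.carrier) :
    M ⊗[k] N →ₗ[k] (M ⊗[k] N) ⊗[k] H.carrier :=
  TensorProduct.lift
    ((TensorProduct.map₂ (TensorProduct.mk k M N) H.mul).compl₁₂ σM σN)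

/-- The left action `h(g ⊗ n) = α⁻¹(h)g ⊗ ν(n)` on `H ⊗ N`. -/
def freeLact (ν : N ≃ₗ[k] N) :
    H.carrier →ₗ[k] H.carrier ⊗[k] N →ₗ[k] H.carrier ⊗[k] N :=
  (TensorProduct.mapBilinear (RingHom.id k) H.carrier N H.carrier N).flip ν.toLinearMap ∘ₗ
    H.mul ∘ₗ H.twist.symm.toLinearMap

/-- The left coaction `h ⊗ n ↦ α(h₁) ⊗ (h₂ ⊗ ν⁻¹(n))` on `H ⊗ N`. -/
def freeLcoact (ν : N ≃ₗ[k] N) :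
    H.carrier ⊗[k] N →ₗ[k] H.carrier ⊗[k] (H.carrier ⊗[k] N) :=
  TensorProduct.map H.twist.toLinearMap LinearMap.id ∘ₗ
    (TensorProduct.assoc k H.carrier H.carrier N).toLinearMap ∘ₗ
      TensorProduct.map H.comul ν.symm.toLinearMap

theorem diagAct_apply (actM : M →ₗ[k] H.carrier →ₗ[k] M) (actN : N →ₗ[k] H.carrier →ₗ[k] N)
    (x : M ⊗[k] N) (h : H.carrier) : diagAct H actM actN x h = map₂ actM actN x (H.comul h) := rfl

@[simp] theorem diagAct_tmul (actM : M →ₗ[k] H.carrier →ₗ[k] M)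
    (actN : N →ₗ[k] H.carrier →ₗ[k] N) (m : M) (n : N) (h : H.carrier) :
    diagAct H actM actN (m ⊗ₜ[k] n) h = map (actM m) (actN n) (H.comul h) := rfl

theorem codiagCoact_tmul (σM : M →ₗ[k] M ⊗[k] H.carrier) (σN : N →ₗ[k] N ⊗[k] H.carrier)
    (m : M) (n : N) :
    codiagCoact H σM σN (m ⊗ₜ[k] n) =
      map₂ (TensorProduct.mk k M N) H.mul (σM m) (σN n) := rfl

@[simp] theorem freeLact_tmul (ν : N ≃ₗ[k] N) (h g : H.carrier) (n : N) :
    freeLact H ν h (g ⊗ₜ[k] n) = H.mul (H.twist.symm h) g ⊗ₜ[k] ν n := rfl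

@[simp] theorem freeLcoact_tmul (ν : N ≃ₗ[k] N) (g : H.carrier) (n : N) :
    freeLcoact H ν (g ⊗ₜ[k] n) = map H.twist.toLinearMap LinearMap.id
      (TensorProduct.assoc k H.carrier H.carrier N (H.comul g ⊗ₜ[k] ν.symm n)) := rfl

variable {H}

theorem mk_lift_surj : Function.Surjective (TensorProduct.lift (TensorProduct.mk k M N)) := by
  intro x; exact ⟨x, by rw [TensorProduct.lift_mk]; rfl⟩

theorem diag_isRightModule {μ : M ≃ₗ[k] M} {ν : N ≃ₗ[k] N}
    {actM : M →ₗ[k] H.carrier →ₗ[k] M} {actN : N →ₗ[k] H.carrier →ₗ[k] N}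
    (hM : IsRightModule H μ actM) (hN : IsRightModule H ν actN) :
    IsRightModule H (TensorProduct.congr μ ν) (diagAct H actM actN) where
  twist_act x h := by
    rw [diagAct_apply, diagAct_apply, H.comul_twist]
    exact map_map₂ hM.twist_act hN.twist_act x (H.comul h)
  act_act x g h := by
    rw [diagAct_apply, diagAct_apply, diagAct_apply, H.comul_mul, H.comul_twist]
    exact map₂_assoc hM.act_act hN.act_act x _ _
  act_one x := by
    rw [diagAct_apply, H.comul_one, map₂_tmul_right]
    change _ = map μ.toLinearMap ν.toLinearMap x
    congr 2
    · ext m; simp [hM.act_one]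
    · ext m; simp [hN.act_one]

theorem codiag_isRightComodule {μ : M ≃ₗ[k] M} {ν : N ≃ₗ[k] N}
    {σM : M →ₗ[k] M ⊗[k] H.carrier} {σN : N →ₗ[k] N ⊗[k] H.carrier}
    (hM : IsRightComodule H μ σM) (hN : IsRightComodule H ν σN) :
    IsRightComodule H (TensorProduct.congr μ ν) (codiagCoact H σM σN) :=
  .codiag hM hN mk_lift_surj (fun _ _ => rfl) (fun _ _ => rfl)

/-- `h₁ ⊗ h₂ ↦ s(h₂)₍₀₎ ⊗ α⁻¹(h₁ s(h₂)₍₁₎)`. -/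
def ydOp (s : H.carrier →ₗ[k] N ⊗[k] H.carrier) :
    H.carrier ⊗[k] H.carrier →ₗ[k] N ⊗[k] H.carrier :=
  map LinearMap.id (H.twist.symm.toLinearMap ∘ₗ TensorProduct.lift H.mul) ∘ₗ
    (TensorProduct.leftComm k H.carrier N H.carrier).toLinearMap ∘ₗ map LinearMap.id s

theorem ydOp_tmul (s : H.carrier →ₗ[k] N ⊗[k] H.carrier) (a b : H.carrier) :
    ydOp s (a ⊗ₜ[k] b) =
      map LinearMap.id (H.twist.symm.toLinearMap ∘ₗ H.mul a) (s b) := by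
  simp only [ydOp, LinearMap.comp_apply, TensorProduct.map_tmul, LinearMap.id_apply,
    LinearEquiv.coe_coe]
  generalize s b = Z
  induction Z using TensorProduct.induction_on with
  | zero => simp
  | add X Y hX hY => simp only [TensorProduct.tmul_add, map_add, hX, hY]
  | tmul x y => simp

/-- `a ↦ x a ⊗ α(y)` for `X = x ⊗ y`. -/
def ydQ (actM : M →ₗ[k] H.carrier →ₗ[k] M) (X : M ⊗[k] H.carrier) :
    H.carrier →ₗ[k] M ⊗[k] H.carrier :=
  ((TensorProduct.mapBilinear (RingHom.id k) M H.carrier M H.carrier).flip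
    H.twist.toLinearMap ∘ₗ actM.flip).flip X

theorem ydQ_apply (actM : M →ₗ[k] H.carrier →ₗ[k] M) (X : M ⊗[k] H.carrier) (a : H.carrier) :
    ydQ actM X a = map (actM.flip a) H.twist.toLinearMap X := rfl

/-- `a ⊗ b ↦ (f(a)₍₀₎ ⊗ g(b)₍₀₎) ⊗ f(a)₍₁₎ g(b)₍₁₎`. -/
def ydK {A B : Type u} [AddCommGroup A] [Module k A] [AddCommGroup B] [Module k B]
    (f : A →ₗ[k] M ⊗[k] H.carrier) (g : B →ₗ[k] N ⊗[k] H.carrier) :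
    A ⊗[k] B →ₗ[k] (M ⊗[k] N) ⊗[k] H.carrier :=
  TensorProduct.lift ((map₂ (TensorProduct.mk k M N) H.mul).compl₁₂ f g)

theorem ydK_tmul {A B : Type u} [AddCommGroup A] [Module k A] [AddCommGroup B] [Module k B]
    (f : A →ₗ[k] M ⊗[k] H.carrier) (g : B →ₗ[k] N ⊗[k] H.carrier) (a : A) (b : B) :
    ydK f g (a ⊗ₜ[k] b) = map₂ (TensorProduct.mk k M N) H.mul (f a) (g b) := rfl

theorem ydK_map {A B A' B' : Type u} [AddCommGroup A] [Module k A] [AddCommGroup B] [Module k B]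
    [AddCommGroup A'] [Module k A'] [AddCommGroup B'] [Module k B']
    (f : A →ₗ[k] M ⊗[k] H.carrier) (g : B →ₗ[k] N ⊗[k] H.carrier)
    (p : A' →ₗ[k] A) (q : B' →ₗ[k] B) (D : A' ⊗[k] B') :
    ydK f g (map p q D) = ydK (f ∘ₗ p) (g ∘ₗ q) D := by
  induction D using TensorProduct.induction_on with
  | zero => simp
  | add X Y hX hY => simp only [map_add, hX, hY]
  | tmul x y => rfl

theorem ydCondition_iff {actM : M →ₗ[k] H.carrier →ₗ[k] M} {σM : M →ₗ[k] M ⊗[k] H.carrier} :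
    YetterDrinfeldCondition H actM σM ↔ ∀ m h,
      map₂ actM H.mul (σM m) (H.comul h) =
        ydOp (σM ∘ₗ actM m) (map H.twist.toLinearMap H.twist.toLinearMap (H.comul h)) := by
  constructor
  · intro hyd m h
    have e := hyd m (H.twist h)
    rw [H.comul_twist, map_symm_map] at e
    exact e
  · intro hyd m h
    have e := hyd m (H.twist.symm h)
    rw [comul_symm, map_map_symm] at e
    exact e

theorem ydOp_ydK (f : H.carrier →ₗ[k] M ⊗[k] H.carrier) (g : H.carrier →ₗ[k] N ⊗[k] H.carrier)
    (D : H.carrier ⊗[k] H.carrier) :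
    ydOp (ydK f g ∘ₗ H.comul) D =
      ydK (ydOp f) g ((TensorProduct.assoc k _ _ _).symm
        (map H.twist.symm.toLinearMap H.comul D)) := by
  induction D using TensorProduct.induction_on with
  | zero => simp
  | add X Y hX hY => simp only [map_add, hX, hY]
  | tmul a b =>
    rw [ydOp_tmul, LinearMap.comp_apply, TensorProduct.map_tmul]
    generalize H.comul b = E
    induction E using TensorProduct.induction_on with
    | zero => simp
    | add X Y hX hY => simp only [TensorProduct.tmul_add, map_add, hX, hY]
    | tmul c d =>
      rw [TensorProduct.assoc_symm_tmul, ydK_tmul, ydK_tmul, LinearEquiv.coe_coe, ydOp_tmul,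
        map_map₂ (f' := TensorProduct.mk k M N) (g' := H.mul) (a := LinearMap.id)
          (b := LinearMap.id) (b' := LinearMap.id)
          (a' := H.twist.symm.toLinearMap ∘ₗ H.mul (H.twist.symm a)) (fun _ _ => rfl)]
      · simp
      · intro x y
        have e := H.mul_assoc (H.twist.symm a) x y
        rw [LinearEquiv.apply_symm_apply] at e
        simp [e, mul_symm]

theorem ydK_assoc (actM : M →ₗ[k] H.carrier →ₗ[k] M) (X : M ⊗[k] H.carrier)
    (g : H.carrier →ₗ[k] N ⊗[k] H.carrier) (T : H.carrier ⊗[k] (H.carrier ⊗[k] H.carrier)) :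
    ydK (map₂ actM H.mul X ∘ₗ map H.twist.symm.toLinearMap H.twist.symm.toLinearMap) g
        ((TensorProduct.assoc k _ _ _).symm T) =
      ydK (ydQ actM X ∘ₗ H.twist.symm.toLinearMap) (ydOp g) T := by
  induction T using TensorProduct.induction_on with
  | zero => simp
  | add X Y hX hY => simp only [map_add, hX, hY]
  | tmul a E =>
    induction E using TensorProduct.induction_on with
    | zero => simp
    | add X Y hX hY => simp only [TensorProduct.tmul_add, map_add, hX, hY]
    | tmul b c =>
      rw [TensorProduct.assoc_symm_tmul, ydK_tmul, ydK_tmul, ydOp_tmul]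
      simp only [LinearMap.comp_apply, TensorProduct.map_tmul, ydQ_apply, LinearEquiv.coe_coe]
      generalize g c = Z
      induction Z using TensorProduct.induction_on with
      | zero => simp
      | add X Y hX hY => simp only [map_add, hX, hY]
      | tmul z w =>
        induction X using TensorProduct.induction_on with
        | zero => simp
        | add X Y hX hY => simp only [map_add, LinearMap.add_apply, hX, hY]
        | tmul x y =>
          have e := H.mul_assoc y (H.twist.symm b) (H.twist.symm w)
          rw [LinearEquiv.apply_symm_apply] at e
          simp [mul_symm, e]

theorem map₂_diagAct (actM : M →ₗ[k] H.carrier →ₗ[k] M) (actN : N →ₗ[k] H.carrier →ₗ[k] N)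
    (X : M ⊗[k] H.carrier) (Y : N ⊗[k] H.carrier) (D : H.carrier ⊗[k] H.carrier) :
    map₂ (diagAct H actM actN) H.mul (map₂ (TensorProduct.mk k M N) H.mul X Y) D =
      ydK (ydQ actM X) (map₂ actN H.mul Y)
        (TensorProduct.assoc k _ _ _ (map H.comul H.twist.symm.toLinearMap D)) := by
  induction D using TensorProduct.induction_on with
  | zero => simp
  | add X Y hX hY => simp only [map_add, hX, hY]
  | tmul a b =>
    rw [map₂_tmul_right, TensorProduct.map_tmul]
    have e1 : (diagAct H actM actN).flip a = (map₂ actM actN).flip (H.comul a) := rfl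
    rw [e1]
    generalize H.comul a = E
    induction E using TensorProduct.induction_on with
    | zero => simp
    | add X Y hX hY =>
      simp only [TensorProduct.add_tmul, map_add, ← hX, ← hY, TensorProduct.map_add_left,
        LinearMap.add_apply]
    | tmul c d =>
      rw [TensorProduct.assoc_tmul, ydK_tmul, ydQ_apply]
      induction X using TensorProduct.induction_on with
      | zero => simp
      | add X Y hX hY => simp only [map_add, LinearMap.add_apply, hX, hY]
      | tmul x y =>
        induction Y using TensorProduct.induction_on with
        | zero => simp
        | add X Y hX hY => simp only [map_add, LinearMap.add_apply, hX, hY]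
        | tmul z w =>
          have e := H.mul_assoc y w (H.twist.symm b)
          rw [LinearEquiv.apply_symm_apply] at e
          simp [e]

theorem ydQ_comp_symm_twist (actM : M →ₗ[k] H.carrier →ₗ[k] M) (X : M ⊗[k] H.carrier) :
    (ydQ actM X ∘ₗ H.twist.symm.toLinearMap) ∘ₗ H.twist.toLinearMap = ydQ actM X := by
  ext a; simp

theorem map_comul_symm_twist (D : H.carrier ⊗[k] H.carrier) :
    TensorProduct.assoc k _ _ _ (map H.comul H.twist.symm.toLinearMap
        (map H.twist.toLinearMap H.twist.toLinearMap D)) =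
      map H.twist.toLinearMap (map H.twist.toLinearMap H.twist.toLinearMap)
        (TensorProduct.assoc k _ _ _ (map H.comul H.twist.symm.toLinearMap D)) := by
  induction D using TensorProduct.induction_on with
  | zero => simp
  | add X Y hX hY => simp only [map_add, hX, hY]
  | tmul a b =>
    simp only [TensorProduct.map_tmul, LinearEquiv.coe_coe, H.comul_twist]
    generalize H.comul a = E
    induction E using TensorProduct.induction_on with
    | zero => simp
    | add X Y hX hY => simp only [TensorProduct.add_tmul, map_add, hX, hY]
    | tmul c d => simp

theorem ydCondition_tensor {actM : M →ₗ[k] H.carrier →ₗ[k] M} {σM : M →ₗ[k] M ⊗[k] H.carrier}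
    {actN : N →ₗ[k] H.carrier →ₗ[k] N} {σN : N →ₗ[k] N ⊗[k] H.carrier}
    (hM : YetterDrinfeldCondition H actM σM) (hN : YetterDrinfeldCondition H actN σN) :
    YetterDrinfeldCondition H (diagAct H actM actN) (codiagCoact H σM σN) := by
  rw [ydCondition_iff]
  intro x h
  induction x using TensorProduct.induction_on with
  | zero =>
    have : ydOp (codiagCoact H σM σN ∘ₗ diagAct H actM actN 0) = 0 := by
      ext a b; simp [ydOp_tmul]
    rw [this]; simp
  | add X Y hX hY =>
    have : ydOp (codiagCoact H σM σN ∘ₗ diagAct H actM actN (X + Y)) =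
        ydOp (codiagCoact H σM σN ∘ₗ diagAct H actM actN X) +
          ydOp (codiagCoact H σM σN ∘ₗ diagAct H actM actN Y) := by
      ext a b; simp [ydOp_tmul]
    rw [this, LinearMap.add_apply, ← hX, ← hY]
    simp only [map_add, LinearMap.add_apply]
  | tmul m n =>
    have e1 : codiagCoact H σM σN ∘ₗ diagAct H actM actN (m ⊗ₜ[k] n) =
        ydK (σM ∘ₗ actM m) (σN ∘ₗ actN n) ∘ₗ H.comul := by
      ext g
      simp only [LinearMap.comp_apply, diagAct_tmul]
      exact ydK_map _ _ _ _ _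
    have e2 : ydOp (σM ∘ₗ actM m) ∘ₗ H.comul =
        (map₂ actM H.mul (σM m) ∘ₗ map H.twist.symm.toLinearMap H.twist.symm.toLinearMap) ∘ₗ
          H.comul := by
      ext g; exact (hM m g).symm
    have e3 : ydOp (σN ∘ₗ actN n) ∘ₗ H.comul =
        (map₂ actN H.mul (σN n) ∘ₗ map H.twist.symm.toLinearMap H.twist.symm.toLinearMap) ∘ₗ
          H.comul := by
      ext g; exact (hN n g).symm
    have e4 : (map₂ actN H.mul (σN n) ∘ₗ
        map H.twist.symm.toLinearMap H.twist.symm.toLinearMap) ∘ₗ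
        map H.twist.toLinearMap H.twist.toLinearMap = map₂ actN H.mul (σN n) := by
      ext a b; simp
    have e5 : ∀ D : H.carrier ⊗[k] H.carrier,
        ydK (ydOp (σM ∘ₗ actM m)) (σN ∘ₗ actN n) (map H.comul H.twist.symm.toLinearMap D) =
        ydK (map₂ actM H.mul (σM m) ∘ₗ map H.twist.symm.toLinearMap H.twist.symm.toLinearMap)
          (σN ∘ₗ actN n) (map H.comul H.twist.symm.toLinearMap D) := by
      intro D
      rw [ydK_map, ydK_map, e2]
    have e6 : ∀ D : H.carrier ⊗[k] H.carrier,
        ydK (ydQ actM (σM m) ∘ₗ H.twist.symm.toLinearMap) (ydOp (σN ∘ₗ actN n))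
          (map H.twist.symm.toLinearMap H.comul D) =
        ydK (ydQ actM (σM m) ∘ₗ H.twist.symm.toLinearMap)
          (map₂ actN H.mul (σN n) ∘ₗ map H.twist.symm.toLinearMap H.twist.symm.toLinearMap)
          (map H.twist.symm.toLinearMap H.comul D) := by
      intro D
      rw [ydK_map, ydK_map, e3]
    have e7 : (TensorProduct.assoc k _ _ _).symm
        (map H.twist.symm.toLinearMap H.comul (H.comul (H.twist h))) =
        map H.comul H.twist.symm.toLinearMap (H.comul (H.twist h)) := by
      rw [H.coassoc, LinearEquiv.symm_apply_apply]
    rw [codiagCoact_tmul, map₂_diagAct, e1, ydOp_ydK, ← H.comul_twist, e7, e5, ← e7, ydK_assoc,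
      e6, H.coassoc, H.comul_twist, map_comul_symm_twist, ydK_map, ydQ_comp_symm_twist, e4]

/-- If `N` is a Yetter-Drinfel'd module, the diagonal right action on `H ⊗ N` is compatible with
the codiagonal right coaction. -/
theorem free_rcoact_ract {actN : N →ₗ[k] H.carrier →ₗ[k] N} {σN : N →ₗ[k] N ⊗[k] H.carrier}
    (hN : YetterDrinfeldCondition H actN σN) (x : H.carrier ⊗[k] N) (g : H.carrier) :
    codiagCoact H H.comul σN (diagAct H H.mul actN x g) =
      map₂ (diagAct H H.mul actN) H.mul (codiagCoact H H.comul σN x) (H.comul g) := by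
  rw [ydCondition_iff] at hN
  induction x using TensorProduct.induction_on with
  | zero => simp
  | add X Y hX hY => simp only [map_add, LinearMap.add_apply, hX, hY]
  | tmul h n =>
    have e1 : codiagCoact H H.comul σN (diagAct H H.mul actN (h ⊗ₜ[k] n) g) =
        ydK (map₂ H.mul H.mul (H.comul h) ∘ₗ H.comul) (σN ∘ₗ actN n) (H.comul g) := by
      rw [diagAct_tmul]
      refine (ydK_map _ _ _ _ _).trans ?_
      congr 2
      ext a; simp [H.comul_mul]
    have e2 : map₂ actN H.mul (σN n) ∘ₗ H.comul =
        (ydOp (σN ∘ₗ actN n) ∘ₗ map H.twist.toLinearMap H.twist.toLinearMap) ∘ₗ H.comul := by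
      ext a; exact hN n a
    rw [e1, codiagCoact_tmul, map₂_diagAct, ← H.coassoc, ydK_map, e2,
      ← ydK_map (ydQ H.mul (H.comul h))
        (ydOp (σN ∘ₗ actN n) ∘ₗ map H.twist.toLinearMap H.twist.toLinearMap), H.coassoc]
    generalize H.comul g = D
    generalize H.comul h = X
    induction D using TensorProduct.induction_on with
    | zero => simp
    | add X Y hX hY => simp only [map_add, hX, hY]
    | tmul a b =>
      rw [ydK_tmul, LinearMap.comp_apply, TensorProduct.map_tmul]
      generalize H.comul a = E
      induction E using TensorProduct.induction_on with
      | zero => simp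
      | add X Y hX hY =>
        simp only [TensorProduct.add_tmul, map_add, LinearMap.add_apply, hX, hY]
      | tmul c d =>
        rw [TensorProduct.assoc_tmul, ydK_tmul, ydQ_apply, LinearMap.comp_apply,
          LinearMap.comp_apply, TensorProduct.map_tmul, ydOp_tmul]
        simp only [LinearEquiv.coe_coe, LinearEquiv.apply_symm_apply, LinearMap.comp_apply]
        generalize σN (actN n b) = Z
        induction Z using TensorProduct.induction_on with
        | zero => simp
        | add X Y hX hY => simp only [map_add, hX, hY]
        | tmul z w =>
          induction X using TensorProduct.induction_on with
          | zero => simp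
          | add X Y hX hY => simp only [map_add, LinearMap.add_apply, hX, hY]
          | tmul x y =>
            have e := H.mul_assoc y d (H.twist.symm w)
            rw [LinearEquiv.apply_symm_apply] at e
            simp [mul_symm, e]

theorem free_lcoact_lact (ν : N ≃ₗ[k] N) (g : H.carrier) (x : H.carrier ⊗[k] N) :
    freeLcoact H ν (freeLact H ν g x) =
      map₂ H.mul (freeLact H ν) (H.comul g) (freeLcoact H ν x) := by
  induction x using TensorProduct.induction_on with
  | zero => simp
  | add X Y hX hY => simp only [map_add, hX, hY]
  | tmul h n =>
    rw [freeLact_tmul, freeLcoact_tmul, freeLcoact_tmul, H.comul_mul, comul_symm]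
    generalize H.comul g = D
    generalize H.comul h = X
    induction D using TensorProduct.induction_on with
    | zero => simp
    | add X Y hX hY =>
      simp only [TensorProduct.add_tmul, map_add, LinearMap.add_apply, hX, hY]
    | tmul a b =>
      induction X using TensorProduct.induction_on with
      | zero => simp
      | add X Y hX hY => simp only [TensorProduct.add_tmul, map_add, hX, hY]
      | tmul x y => simp [H.twist_mul]

theorem free_rcoact_lact {ν : N ≃ₗ[k] N} {σN : N →ₗ[k] N ⊗[k] H.carrier}
    (hN : IsRightComodule H ν σN) (g : H.carrier) (x : H.carrier ⊗[k] N) :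
    codiagCoact H H.comul σN (freeLact H ν g x) =
      map₂ (freeLact H ν) H.mul (H.comul g) (codiagCoact H H.comul σN x) := by
  induction x using TensorProduct.induction_on with
  | zero => simp
  | add X Y hX hY => simp only [map_add, hX, hY]
  | tmul h n =>
    rw [freeLact_tmul, codiagCoact_tmul, codiagCoact_tmul, H.comul_mul, comul_symm,
      hN.coact_twist,
      ← map₂_assoc (f := freeLact H ν) (g := H.mul) (p := H.twist.toLinearMap)
        (q := H.twist.toLinearMap) (f' := TensorProduct.mk k H.carrier N) (g' := H.mul)
        (by intro x y z; simp) (by intro x y z; exact H.mul_assoc x y z), map_map_symm]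

theorem free_lcoact_ract {ν : N ≃ₗ[k] N} {actN : N →ₗ[k] H.carrier →ₗ[k] N}
    (hN : IsRightModule H ν actN) (x : H.carrier ⊗[k] N) (g : H.carrier) :
    freeLcoact H ν (diagAct H H.mul actN x g) =
      map₂ H.mul (diagAct H H.mul actN) (freeLcoact H ν x) (H.comul g) := by
  induction x using TensorProduct.induction_on with
  | zero => simp
  | add X Y hX hY => simp only [map_add, LinearMap.add_apply, hX, hY]
  | tmul h n =>
    have e1 : ∀ D X : H.carrier ⊗[k] H.carrier,
        map H.twist.toLinearMap LinearMap.id (TensorProduct.assoc k _ _ _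
          (map (map₂ H.mul H.mul X ∘ₗ H.comul) (ν.symm.toLinearMap ∘ₗ actN n) D)) =
        map₂ (H.mul.compr₂ H.twist.toLinearMap) (map₂ H.mul actN)
          (TensorProduct.assoc k _ _ _ (X ⊗ₜ[k] ν.symm n))
          (TensorProduct.assoc k _ _ _ (map H.comul H.twist.symm.toLinearMap D)) := by
      intro D X
      induction D using TensorProduct.induction_on with
      | zero => simp
      | add X Y hX hY => simp only [map_add, hX, hY]
      | tmul a b =>
        rw [TensorProduct.map_tmul, TensorProduct.map_tmul, LinearMap.comp_apply]
        generalize H.comul a = E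
        induction E using TensorProduct.induction_on with
        | zero => simp
        | add X Y hX hY => simp only [TensorProduct.add_tmul, map_add, hX, hY]
        | tmul c d =>
          induction X using TensorProduct.induction_on with
          | zero => simp
          | add X Y hX hY =>
            simp only [TensorProduct.add_tmul, map_add, LinearMap.add_apply, hX, hY]
          | tmul x y => simp [symm_bilin hN.twist_act]
    have e2 : ∀ (D : H.carrier ⊗[k] H.carrier) (A : H.carrier ⊗[k] (H.carrier ⊗[k] N)),
        map₂ H.mul (diagAct H H.mul actN) (map H.twist.toLinearMap LinearMap.id A) D =
        map₂ (H.mul.compr₂ H.twist.toLinearMap) (map₂ H.mul actN) A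
          (map H.twist.symm.toLinearMap H.comul D) := by
      intro D A
      induction D using TensorProduct.induction_on with
      | zero => simp
      | add X Y hX hY => simp only [map_add, hX, hY]
      | tmul a b =>
        induction A using TensorProduct.induction_on with
        | zero => simp
        | add X Y hX hY => simp only [map_add, LinearMap.add_apply, hX, hY]
        | tmul x y => simp [H.twist_mul, diagAct_apply]
    have e3 : freeLcoact H ν (diagAct H H.mul actN (h ⊗ₜ[k] n) g) =
        map H.twist.toLinearMap LinearMap.id (TensorProduct.assoc k _ _ _
          (map (map₂ H.mul H.mul (H.comul h) ∘ₗ H.comul) (ν.symm.toLinearMap ∘ₗ actN n)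
            (H.comul g))) := by
      rw [diagAct_tmul]
      simp only [freeLcoact, LinearMap.comp_apply, TensorProduct.map_map, LinearEquiv.coe_coe]
      congr 4
      ext a; simp [H.comul_mul]
    rw [e3, e1, ← H.coassoc, freeLcoact_tmul, e2]

theorem free_isLeftModule (ν : N ≃ₗ[k] N) :
    IsLeftModule H (TensorProduct.congr H.twist ν) (freeLact H ν) where
  twist_act h x := by
    induction x using TensorProduct.induction_on with
    | zero => simp
    | add X Y hX hY => simp only [map_add, hX, hY]
    | tmul g n => simp [H.twist_mul]
  act_act a h x := by
    induction x using TensorProduct.induction_on with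
    | zero => simp
    | add X Y hX hY => simp only [map_add, hX, hY]
    | tmul g n =>
      have e := H.mul_assoc (H.twist.symm a) (H.twist.symm h) g
      rw [LinearEquiv.apply_symm_apply] at e
      simp [e, mul_symm]
  one_act x := by
    induction x using TensorProduct.induction_on with
    | zero => simp
    | add X Y hX hY => simp only [map_add, hX, hY]
    | tmul g n => simp [symm_one, H.one_mul]

theorem free_isLeftComodule (ν : N ≃ₗ[k] N) :
    IsLeftComodule H (TensorProduct.congr H.twist ν) (freeLcoact H ν) where
  coact_twist x := by
    induction x using TensorProduct.induction_on with
    | zero => simp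
    | add X Y hX hY => simp only [map_add, hX, hY]
    | tmul h n =>
      rw [TensorProduct.congr_tmul, freeLcoact_tmul, freeLcoact_tmul, H.comul_twist]
      generalize H.comul h = D
      induction D using TensorProduct.induction_on with
      | zero => simp
      | add X Y hX hY => simp only [TensorProduct.add_tmul, map_add, hX, hY]
      | tmul a b => simp
  coassoc x := by
    induction x using TensorProduct.induction_on with
    | zero => simp
    | add X Y hX hY => simp only [map_add, hX, hY]
    | tmul h n =>
      have e1 : ∀ D : H.carrier ⊗[k] H.carrier,
          TensorProduct.assoc k _ _ _ (map H.comul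
            (TensorProduct.congr H.twist ν).symm.toLinearMap
            (map H.twist.toLinearMap LinearMap.id (TensorProduct.assoc k _ _ _
              (D ⊗ₜ[k] ν.symm n)))) =
          map H.twist.toLinearMap (map H.twist.toLinearMap
            ((TensorProduct.mk k H.carrier N).flip (ν.symm (ν.symm n))))
            (TensorProduct.assoc k _ _ _ (map H.comul H.twist.symm.toLinearMap D)) := by
        intro D
        induction D using TensorProduct.induction_on with
        | zero => simp
        | add X Y hX hY => simp only [TensorProduct.add_tmul, map_add, hX, hY]
        | tmul a b =>
          simp only [TensorProduct.assoc_tmul, TensorProduct.map_tmul, LinearEquiv.coe_coe,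
            H.comul_twist]
          generalize H.comul a = E
          induction E using TensorProduct.induction_on with
          | zero => simp
          | add X Y hX hY => simp only [TensorProduct.add_tmul, map_add, hX, hY]
          | tmul c d => simp [TensorProduct.congr_symm]
      have e2 : ∀ D : H.carrier ⊗[k] H.carrier,
          map H.twist.symm.toLinearMap (freeLcoact H ν)
            (map H.twist.toLinearMap LinearMap.id (TensorProduct.assoc k _ _ _
              (D ⊗ₜ[k] ν.symm n))) =
          map H.twist.toLinearMap (map H.twist.toLinearMap
            ((TensorProduct.mk k H.carrier N).flip (ν.symm (ν.symm n))))
            (map H.twist.symm.toLinearMap H.comul D) := by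
        intro D
        induction D using TensorProduct.induction_on with
        | zero => simp
        | add X Y hX hY => simp only [TensorProduct.add_tmul, map_add, hX, hY]
        | tmul a b =>
          simp only [TensorProduct.assoc_tmul, TensorProduct.map_tmul, LinearEquiv.coe_coe,
            LinearMap.id_apply, freeLcoact_tmul, LinearEquiv.symm_apply_apply,
            LinearEquiv.apply_symm_apply]
          congr 1
          generalize H.comul b = E
          induction E using TensorProduct.induction_on with
          | zero => simp
          | add X Y hX hY => simp only [TensorProduct.add_tmul, map_add, hX, hY]
          | tmul c d => simp
      rw [freeLcoact_tmul, e1, e2, H.coassoc]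
  counit x := by
    induction x using TensorProduct.induction_on with
    | zero => simp
    | add X Y hX hY => simp only [map_add, hX, hY]
    | tmul h n =>
      have e1 : ∀ D : H.carrier ⊗[k] H.carrier,
          TensorProduct.lid k _ (map H.counit LinearMap.id
            (map H.twist.toLinearMap LinearMap.id (TensorProduct.assoc k _ _ _
              (D ⊗ₜ[k] ν.symm n)))) =
          TensorProduct.lid k _ (map H.counit LinearMap.id D) ⊗ₜ[k] ν.symm n := by
        intro D
        induction D using TensorProduct.induction_on with
        | zero => simp
        | add X Y hX hY => simp only [TensorProduct.add_tmul, map_add, hX, hY]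
        | tmul a b => simp [H.counit_twist, TensorProduct.smul_tmul']
      rw [freeLcoact_tmul, e1, H.counit_comul, TensorProduct.congr_symm_tmul]

theorem free_coact_comm {ν : N ≃ₗ[k] N} {σN : N →ₗ[k] N ⊗[k] H.carrier}
    (hN : IsRightComodule H ν σN) (x : H.carrier ⊗[k] N) :
    map H.twist.toLinearMap (map LinearMap.id H.twist.symm.toLinearMap)
        (TensorProduct.assoc k _ _ _
          (map (freeLcoact H ν) LinearMap.id (codiagCoact H H.comul σN x))) =
      map LinearMap.id (codiagCoact H H.comul σN) (freeLcoact H ν x) := by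
  induction x using TensorProduct.induction_on with
  | zero => simp
  | add X Y hX hY => simp only [map_add, hX, hY]
  | tmul h n =>
    have e1 : ∀ (D : H.carrier ⊗[k] H.carrier) (Y : N ⊗[k] H.carrier),
        map H.twist.toLinearMap (map LinearMap.id H.twist.symm.toLinearMap)
          (TensorProduct.assoc k _ _ _ (map (freeLcoact H ν) LinearMap.id
            (map₂ (TensorProduct.mk k H.carrier N) H.mul D Y))) =
        map (H.twist.toLinearMap ∘ₗ H.twist.toLinearMap)
          ((map₂ (TensorProduct.mk k H.carrier N) H.mul).flip
            (map ν.symm.toLinearMap H.twist.symm.toLinearMap Y))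
          (TensorProduct.assoc k _ _ _ (map H.comul H.twist.symm.toLinearMap D)) := by
      intro D Y
      induction D using TensorProduct.induction_on with
      | zero => simp
      | add X Y hX hY => simp only [map_add, LinearMap.add_apply, hX, hY]
      | tmul a b =>
        induction Y using TensorProduct.induction_on with
        | zero => simp
        | add X Y hX hY =>
          simp only [map_add, TensorProduct.map_add_right, LinearMap.add_apply, hX, hY]
        | tmul z w =>
          simp only [TensorProduct.map₂_apply_tmul, TensorProduct.map_tmul,
            TensorProduct.mk_apply, freeLcoact_tmul, LinearEquiv.coe_coe, LinearMap.id_apply]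
          generalize H.comul a = E
          induction E using TensorProduct.induction_on with
          | zero => simp
          | add X Y hX hY => simp only [TensorProduct.add_tmul, map_add, hX, hY]
          | tmul c d => simp [mul_symm]
    have e2 : ∀ D : H.carrier ⊗[k] H.carrier,
        map LinearMap.id (codiagCoact H H.comul σN)
          (map H.twist.toLinearMap LinearMap.id (TensorProduct.assoc k _ _ _
              (D ⊗ₜ[k] ν.symm n))) =
        map (H.twist.toLinearMap ∘ₗ H.twist.toLinearMap)
          ((map₂ (TensorProduct.mk k H.carrier N) H.mul).flip (σN (ν.symm n)))
          (map H.twist.symm.toLinearMap H.comul D) := by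
      intro D
      induction D using TensorProduct.induction_on with
      | zero => simp
      | add X Y hX hY => simp only [TensorProduct.add_tmul, map_add, hX, hY]
      | tmul a b => simp [codiagCoact_tmul]
    rw [codiagCoact_tmul, e1, ← hN.coact_symm, freeLcoact_tmul, e2, H.coassoc]

theorem free_isBicovariant {ν : N ≃ₗ[k] N} {actN : N →ₗ[k] H.carrier →ₗ[k] N}
    {σN : N →ₗ[k] N ⊗[k] H.carrier} (hN : IsYetterDrinfeld H ν actN σN) :
    IsBicovariant H (TensorProduct.congr H.twist ν) (freeLact H ν) (diagAct H H.mul actN)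
      (freeLcoact H ν) (codiagCoact H H.comul σN) :=
  .of_separate (free_isLeftModule ν) (diag_isRightModule (isRightModule_self H) hN.right_module)
    (fun h x g => by
      induction x using TensorProduct.induction_on with
      | zero => simp
      | add X Y hX hY => simp only [map_add, LinearMap.add_apply, hX, hY]
      | tmul a n =>
        rw [freeLact_tmul, diagAct_tmul, diagAct_tmul, H.comul_twist]
        generalize H.comul g = D
        induction D using TensorProduct.induction_on with
        | zero => simp
        | add X Y hX hY => simp only [map_add, hX, hY]
        | tmul c d =>
          have e := H.mul_assoc (H.twist.symm h) a c
          rw [LinearEquiv.apply_symm_apply] at e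
          simp [e, hN.right_module.twist_act])
    (free_isLeftComodule ν) (codiag_isRightComodule (isRightComodule_self H) hN.right_comodule)
    (free_coact_comm hN.right_comodule) (free_lcoact_lact ν) (free_lcoact_ract hN.right_module)
    (free_rcoact_lact hN.right_comodule) (free_rcoact_ract hN.yetterDrinfeld)

end Raw

end HomHopf

namespace HomHopf

variable {k : Type u} [CommRing k]

/-! ### The category of right-right Yetter-Drinfel'd Hom-modules -/

/-- A right-right Yetter-Drinfel'd `(H, α)`-Hom-module. -/
structure YetterDrinfeldModule (H : MonoidalHomHopfAlgebra k) extends HomObject k where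
  act : carrier →ₗ[k] H.carrier →ₗ[k] carrier
  coact : carrier →ₗ[k] carrier ⊗[k] H.carrier
  isYetterDrinfeld : IsYetterDrinfeld H twist act coact

variable {H : MonoidalHomHopfAlgebra k}

namespace YetterDrinfeldModule

/-- Morphisms of Yetter-Drinfel'd Hom-modules: morphisms in `H̃(M_k)` which are right `H`-linear
and right `H`-colinear. -/
@[ext]
structure Hom (M N : YetterDrinfeldModule H) where
  toLin : M.carrier →ₗ[k] N.carrier
  map_twist : ∀ m, toLin (M.twist m) = N.twist (toLin m)
  map_act : ∀ m h, toLin (M.act m h) = N.act (toLin m) h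
  map_coact : ∀ m, N.coact (toLin m) = TensorProduct.map toLin LinearMap.id (M.coact m)

instance : Category (YetterDrinfeldModule H) where
  Hom M N := Hom M N
  id M :=
    { toLin := LinearMap.id
      map_twist := fun _ => rfl
      map_act := fun _ _ => rfl
      map_coact := fun m => by simp }
  comp f g :=
    { toLin := g.toLin ∘ₗ f.toLin
      map_twist := fun m => by simp [f.map_twist, g.map_twist]
      map_act := fun m h => by simp [f.map_act, g.map_act]
      map_coact := fun m => by
        simp [f.map_coact, g.map_coact, TensorProduct.map_map] }

@[simp] theorem id_toLin (M : YetterDrinfeldModule H) : Hom.toLin (𝟙 M) = LinearMap.id := rfl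

@[simp] theorem comp_toLin {M N P : YetterDrinfeldModule H} (f : M ⟶ N) (g : N ⟶ P) :
    Hom.toLin (f ≫ g) = Hom.toLin g ∘ₗ Hom.toLin f := rfl

@[ext] theorem hom_ext {M N : YetterDrinfeldModule H} {f g : M ⟶ N}
    (h : Hom.toLin f = Hom.toLin g) : f = g := Hom.ext h

theorem map_twist_symm {M N : YetterDrinfeldModule H} (f : M ⟶ N) (m : M.carrier) :
    Hom.toLin f (M.twist.symm m) = N.twist.symm (Hom.toLin f m) := by
  rw [LinearEquiv.eq_symm_apply, ← f.map_twist, LinearEquiv.apply_symm_apply]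

/-- A linear equivalence compatible with all the structures is an isomorphism. -/
def isoOfEquiv {M N : YetterDrinfeldModule H} (e : M.carrier ≃ₗ[k] N.carrier)
    (h₁ : ∀ m, e (M.twist m) = N.twist (e m))
    (h₂ : ∀ m h, e (M.act m h) = N.act (e m) h)
    (h₃ : ∀ m, N.coact (e m) = TensorProduct.map e.toLinearMap LinearMap.id (M.coact m)) :
    M ≅ N where
  hom :=
    { toLin := e.toLinearMap
      map_twist := h₁
      map_act := h₂
      map_coact := h₃ }
  inv :=
    { toLin := e.symm.toLinearMap
      map_twist := fun n => by
        obtain ⟨m, rfl⟩ := e.surjective n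
        simp [← h₁]
      map_act := fun n h => by
        obtain ⟨m, rfl⟩ := e.surjective n
        simp [← h₂]
      map_coact := fun n => by
        obtain ⟨m, rfl⟩ := e.surjective n
        rw [h₃, TensorProduct.map_map]; simp }
  hom_inv_id := by ext m; exact e.symm_apply_apply m
  inv_hom_id := by ext m; exact e.apply_symm_apply m

@[simp] theorem isoOfEquiv_hom_toLin {M N : YetterDrinfeldModule H}
    (e : M.carrier ≃ₗ[k] N.carrier) (h₁ h₂ h₃) :
    Hom.toLin (isoOfEquiv (M := M) (N := N) e h₁ h₂ h₃).hom = e.toLinearMap := rfl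

open TensorProduct (map map₂)

/-- The tensor product of Yetter-Drinfel'd Hom-modules, with the diagonal action and the
codiagonal coaction. -/
def tensor (M N : YetterDrinfeldModule H) : YetterDrinfeldModule H where
  carrier := M.carrier ⊗[k] N.carrier
  twist := TensorProduct.congr M.twist N.twist
  act := diagAct H M.act N.act
  coact := codiagCoact H M.coact N.coact
  isYetterDrinfeld :=
    { right_module :=
        diag_isRightModule M.isYetterDrinfeld.right_module N.isYetterDrinfeld.right_module
      right_comodule :=
        codiag_isRightComodule M.isYetterDrinfeld.right_comodule N.isYetterDrinfeld.right_comodule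
      yetterDrinfeld :=
        ydCondition_tensor M.isYetterDrinfeld.yetterDrinfeld N.isYetterDrinfeld.yetterDrinfeld }

theorem tensorMap_twist {M N M' N' : YetterDrinfeldModule H} (f : M ⟶ M') (g : N ⟶ N')
    (x : M.carrier ⊗[k] N.carrier) :
    map (Hom.toLin f) (Hom.toLin g) (TensorProduct.congr M.twist N.twist x) =
      TensorProduct.congr M'.twist N'.twist (map (Hom.toLin f) (Hom.toLin g) x) := by
  induction x using TensorProduct.induction_on with
  | zero => simp
  | add X Y hX hY => simp only [map_add, hX, hY]
  | tmul m n => simp [f.map_twist, g.map_twist]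

theorem tensorMap_act {M N M' N' : YetterDrinfeldModule H} (f : M ⟶ M') (g : N ⟶ N')
    (x : M.carrier ⊗[k] N.carrier) (h : H.carrier) :
    map (Hom.toLin f) (Hom.toLin g) (diagAct H M.act N.act x h) =
      diagAct H M'.act N'.act (map (Hom.toLin f) (Hom.toLin g) x) h :=
  (map_map₂ (b := LinearMap.id) (b' := LinearMap.id) f.map_act g.map_act x _).trans
    (by rw [TensorProduct.map_id]; rfl)

theorem tensorMap_coact {M N M' N' : YetterDrinfeldModule H} (f : M ⟶ M') (g : N ⟶ N')
    (x : M.carrier ⊗[k] N.carrier) :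
    codiagCoact H M'.coact N'.coact (map (Hom.toLin f) (Hom.toLin g) x) =
      map (map (Hom.toLin f) (Hom.toLin g)) LinearMap.id
        (codiagCoact H M.coact N.coact x) := by
  induction x using TensorProduct.induction_on with
  | zero => simp
  | add X Y hX hY => simp only [map_add, hX, hY]
  | tmul m n =>
    rw [TensorProduct.map_tmul, codiagCoact_tmul, codiagCoact_tmul, f.map_coact, g.map_coact]
    exact (map_map₂ (fun _ _ => rfl) (fun _ _ => rfl) _ _).symm

/-- `f ⊗ g`. -/
def tensorMap {M N M' N' : YetterDrinfeldModule H} (f : M ⟶ M') (g : N ⟶ N') :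
    tensor M N ⟶ tensor M' N' where
  toLin := map (Hom.toLin f) (Hom.toLin g)
  map_twist := tensorMap_twist f g
  map_act := tensorMap_act f g
  map_coact := tensorMap_coact f g

/-- The unit object `k`, with `xh = ε(h)x` and `x ↦ x ⊗ 1`. -/
def unit (H : MonoidalHomHopfAlgebra k) : YetterDrinfeldModule H where
  carrier := k
  twist := LinearEquiv.refl k k
  act := (LinearMap.mul k k).compl₂ H.counit
  coact := (TensorProduct.mk k k H.carrier).flip H.one
  isYetterDrinfeld :=
    { right_module :=
        { twist_act := fun m h => by simp [H.counit_twist]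
          act_act := fun m g h => by simp [H.counit_twist, H.counit_mul, mul_assoc]
          act_one := fun m => by simp [H.counit_one] }
      right_comodule :=
        { coact_twist := fun m => by simp [H.twist_one]
          coassoc := fun m => by simp [H.comul_one, symm_one]
          counit := fun m => by simp [H.counit_one] }
      yetterDrinfeld := ydCondition_iff.2 fun x h => by
        have e1 : ∀ D : H.carrier ⊗[k] H.carrier,
            map₂ ((LinearMap.mul k k).compl₂ H.counit) H.mul
              ((TensorProduct.mk k k H.carrier).flip H.one x) D =
            x ⊗ₜ[k] H.twist (TensorProduct.lid k _ (map H.counit LinearMap.id D)) := by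
          intro D
          induction D using TensorProduct.induction_on with
          | zero => simp
          | add X Y hX hY => simp only [map_add, hX, hY, TensorProduct.tmul_add]
          | tmul a b =>
            simp [H.one_mul, TensorProduct.tmul_smul, TensorProduct.smul_tmul', mul_comm]
        have e2 : ∀ D : H.carrier ⊗[k] H.carrier,
            ydOp ((TensorProduct.mk k k H.carrier).flip H.one ∘ₗ
              (LinearMap.mul k k).compl₂ H.counit x)
              (map H.twist.toLinearMap H.twist.toLinearMap D) =
            x ⊗ₜ[k] H.twist (TensorProduct.rid k _ (map LinearMap.id H.counit D)) := by
          intro D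
          induction D using TensorProduct.induction_on with
          | zero => simp
          | add X Y hX hY => simp only [map_add, hX, hY, TensorProduct.tmul_add]
          | tmul a b =>
            simp [ydOp_tmul, H.mul_one, H.counit_twist, TensorProduct.tmul_smul,
              TensorProduct.smul_tmul', mul_comm]
        rw [e1, e2, H.comul_counit, H.counit_comul] }

section Constraints

variable (M N P : YetterDrinfeldModule H)

/-- `(m ⊗ n) ⊗ p ↦ μ(m) ⊗ (n ⊗ π⁻¹(p))`. -/
def assocEquiv : (M.carrier ⊗[k] N.carrier) ⊗[k] P.carrier ≃ₗ[k]
    M.carrier ⊗[k] (N.carrier ⊗[k] P.carrier) :=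
  TensorProduct.assoc k _ _ _ ≪≫ₗ TensorProduct.congr M.twist
    (TensorProduct.congr (LinearEquiv.refl k _) P.twist.symm)

@[simp] theorem assocEquiv_tmul (m : M.carrier) (n : N.carrier) (p : P.carrier) :
    assocEquiv M N P ((m ⊗ₜ[k] n) ⊗ₜ[k] p) = M.twist m ⊗ₜ[k] (n ⊗ₜ[k] P.twist.symm p) := rfl

theorem assocEquiv_twist (x : (M.carrier ⊗[k] N.carrier) ⊗[k] P.carrier) :
    assocEquiv M N P (TensorProduct.congr (TensorProduct.congr M.twist N.twist) P.twist x) =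
      TensorProduct.congr M.twist (TensorProduct.congr N.twist P.twist) (assocEquiv M N P x) := by
  induction x using TensorProduct.induction_on with
  | zero => simp
  | add X Y hX hY => simp only [map_add, hX, hY]
  | tmul x p =>
    induction x using TensorProduct.induction_on with
    | zero => simp
    | add X Y hX hY => simp only [TensorProduct.add_tmul, map_add, hX, hY]
    | tmul m n => simp

theorem assocEquiv_act (x : (M.carrier ⊗[k] N.carrier) ⊗[k] P.carrier) (h : H.carrier) :
    assocEquiv M N P (diagAct H (diagAct H M.act N.act) P.act x h) =
      diagAct H M.act (diagAct H N.act P.act) (assocEquiv M N P x) h := by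
  induction x using TensorProduct.induction_on with
  | zero => simp
  | add X Y hX hY => simp only [map_add, LinearMap.add_apply, hX, hY]
  | tmul x p =>
    induction x using TensorProduct.induction_on with
    | zero => simp
    | add X Y hX hY =>
      simp only [TensorProduct.add_tmul, map_add, LinearMap.add_apply, hX, hY]
    | tmul m n =>
      have e1 : ∀ D : H.carrier ⊗[k] H.carrier,
          assocEquiv M N P (map (map (M.act m) (N.act n) ∘ₗ H.comul) (P.act p) D) =
          map (M.act (M.twist m) ∘ₗ H.twist.toLinearMap)
            (map (N.act n) (P.act (P.twist.symm p)))
            (TensorProduct.assoc k _ _ _ (map H.comul H.twist.symm.toLinearMap D)) := by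
        intro D
        induction D using TensorProduct.induction_on with
        | zero => simp
        | add X Y hX hY => simp only [map_add, hX, hY]
        | tmul a b =>
          rw [TensorProduct.map_tmul, TensorProduct.map_tmul, LinearMap.comp_apply]
          generalize H.comul a = E
          induction E using TensorProduct.induction_on with
          | zero => simp
          | add X Y hX hY => simp only [TensorProduct.add_tmul, map_add, hX, hY]
          | tmul c d =>
            simp [M.isYetterDrinfeld.right_module.twist_act,
              symm_bilin P.isYetterDrinfeld.right_module.twist_act]
      have e2 : ∀ D : H.carrier ⊗[k] H.carrier,
          map (M.act (M.twist m))
            (map (N.act n) (P.act (P.twist.symm p)) ∘ₗ H.comul) D =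
          map (M.act (M.twist m) ∘ₗ H.twist.toLinearMap)
            (map (N.act n) (P.act (P.twist.symm p)))
            (map H.twist.symm.toLinearMap H.comul D) := by
        intro D
        induction D using TensorProduct.induction_on with
        | zero => simp
        | add X Y hX hY => simp only [map_add, hX, hY]
        | tmul a b => simp
      rw [diagAct_tmul, assocEquiv_tmul, diagAct_tmul]
      exact (e1 _).trans ((congrArg _ (H.coassoc h).symm).trans (e2 _).symm)

theorem assocEquiv_coact (x : (M.carrier ⊗[k] N.carrier) ⊗[k] P.carrier) :
    codiagCoact H M.coact (codiagCoact H N.coact P.coact) (assocEquiv M N P x) =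
      map (assocEquiv M N P).toLinearMap LinearMap.id
        (codiagCoact H (codiagCoact H M.coact N.coact) P.coact x) := by
  induction x using TensorProduct.induction_on with
  | zero => simp
  | add X Y hX hY => simp only [map_add, hX, hY]
  | tmul x p =>
    induction x using TensorProduct.induction_on with
    | zero => simp
    | add X Y hX hY => simp only [TensorProduct.add_tmul, map_add, hX, hY]
    | tmul m n =>
      rw [assocEquiv_tmul, codiagCoact_tmul, codiagCoact_tmul, codiagCoact_tmul,
        codiagCoact_tmul, M.isYetterDrinfeld.right_comodule.coact_twist,
        P.isYetterDrinfeld.right_comodule.coact_symm,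
        map₂_assoc (g := H.mul) (G₁ := H.mul) (G₁' := H.mul) (d := H.twist.toLinearMap)
          (F₁ := (TensorProduct.mk k (M.carrier ⊗[k] N.carrier) P.carrier).compr₂
            (assocEquiv M N P).toLinearMap)
          (F₁' := TensorProduct.mk k M.carrier N.carrier) (c := P.twist.toLinearMap)
          (by intro x y z; simp) (by intro x y z; exact H.mul_assoc x y z), map_map_symm,
        map_map₂ (f' := (TensorProduct.mk k (M.carrier ⊗[k] N.carrier) P.carrier).compr₂
            (assocEquiv M N P).toLinearMap) (g' := H.mul) (a := LinearMap.id)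
          (b := LinearMap.id) (a' := LinearMap.id) (b' := LinearMap.id)
          (fun _ _ => rfl) (fun _ _ => rfl)]
      simp

/-- The associativity constraint. -/
def assocIso : tensor (tensor M N) P ≅ tensor M (tensor N P) :=
  isoOfEquiv (assocEquiv M N P) (assocEquiv_twist M N P) (assocEquiv_act M N P)
    (assocEquiv_coact M N P)

/-- `x ⊗ m ↦ xμ(m)`. -/
def leftUnitEquiv : k ⊗[k] M.carrier ≃ₗ[k] M.carrier := TensorProduct.lid k M.carrier ≪≫ₗ M.twist

theorem leftUnitEquiv_apply (x : k ⊗[k] M.carrier) :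
    leftUnitEquiv M x = M.twist (TensorProduct.lid k M.carrier x) := rfl

theorem leftUnitEquiv_twist (x : k ⊗[k] M.carrier) :
    leftUnitEquiv M (TensorProduct.congr (LinearEquiv.refl k k) M.twist x) =
      M.twist (leftUnitEquiv M x) := by
  induction x using TensorProduct.induction_on with
  | zero => simp
  | add X Y hX hY => simp only [map_add, hX, hY]
  | tmul a m => simp [leftUnitEquiv_apply]

theorem leftUnitEquiv_act (x : k ⊗[k] M.carrier) (h : H.carrier) :
    leftUnitEquiv M (diagAct H ((LinearMap.mul k k).compl₂ H.counit) M.act x h) =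
      M.act (leftUnitEquiv M x) h := by
  induction x using TensorProduct.induction_on with
  | zero => simp
  | add X Y hX hY => simp only [map_add, LinearMap.add_apply, hX, hY]
  | tmul a m =>
    have e : ∀ D : H.carrier ⊗[k] H.carrier, TensorProduct.lid k M.carrier
        (map ((LinearMap.mul k k).compl₂ H.counit a) (M.act m) D) =
        a • M.act m (TensorProduct.lid k _ (map H.counit LinearMap.id D)) := by
      intro D
      induction D using TensorProduct.induction_on with
      | zero => simp
      | add X Y hX hY => simp only [map_add, hX, hY, smul_add]
      | tmul b c => simp [smul_smul]
    rw [diagAct_tmul, leftUnitEquiv_apply, e, H.counit_comul]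
    simp [M.isYetterDrinfeld.right_module.twist_act, leftUnitEquiv_apply]

theorem leftUnitEquiv_coact (x : k ⊗[k] M.carrier) :
    M.coact (leftUnitEquiv M x) =
      map (leftUnitEquiv M).toLinearMap LinearMap.id
        (codiagCoact H ((TensorProduct.mk k k H.carrier).flip H.one) M.coact x) := by
  induction x using TensorProduct.induction_on with
  | zero => simp
  | add X Y hX hY => simp only [map_add, hX, hY]
  | tmul a m =>
    rw [codiagCoact_tmul, leftUnitEquiv_apply,
      M.isYetterDrinfeld.right_comodule.coact_twist, TensorProduct.lid_tmul, map_smul]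
    generalize M.coact m = Z
    induction Z using TensorProduct.induction_on with
    | zero => simp
    | add X Y hX hY => simp only [map_add, hX, hY, smul_add]
    | tmul z w => simp [H.one_mul, TensorProduct.smul_tmul', leftUnitEquiv_apply]

/-- The left unit constraint `x ⊗ m ↦ xμ(m)`. -/
def leftUnitIso : tensor (unit H) M ≅ M :=
  isoOfEquiv (M := tensor (unit H) M) (leftUnitEquiv M) (leftUnitEquiv_twist M)
    (leftUnitEquiv_act M) (leftUnitEquiv_coact M)

/-- `m ⊗ x ↦ xμ(m)`. -/
def rightUnitEquiv : M.carrier ⊗[k] k ≃ₗ[k] M.carrier := TensorProduct.rid k M.carrier ≪≫ₗ M.twist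

theorem rightUnitEquiv_apply (x : M.carrier ⊗[k] k) :
    rightUnitEquiv M x = M.twist (TensorProduct.rid k M.carrier x) := rfl

theorem rightUnitEquiv_twist (x : M.carrier ⊗[k] k) :
    rightUnitEquiv M (TensorProduct.congr M.twist (LinearEquiv.refl k k) x) =
      M.twist (rightUnitEquiv M x) := by
  induction x using TensorProduct.induction_on with
  | zero => simp
  | add X Y hX hY => simp only [map_add, hX, hY]
  | tmul m a => simp [rightUnitEquiv_apply]

theorem rightUnitEquiv_act (x : M.carrier ⊗[k] k) (h : H.carrier) :
    rightUnitEquiv M (diagAct H M.act ((LinearMap.mul k k).compl₂ H.counit) x h) =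
      M.act (rightUnitEquiv M x) h := by
  induction x using TensorProduct.induction_on with
  | zero => simp
  | add X Y hX hY => simp only [map_add, LinearMap.add_apply, hX, hY]
  | tmul m a =>
    have e : ∀ D : H.carrier ⊗[k] H.carrier, TensorProduct.rid k M.carrier
        (map (M.act m) ((LinearMap.mul k k).compl₂ H.counit a) D) =
        a • M.act m (TensorProduct.rid k _ (map LinearMap.id H.counit D)) := by
      intro D
      induction D using TensorProduct.induction_on with
      | zero => simp
      | add X Y hX hY => simp only [map_add, hX, hY, smul_add]
      | tmul b c => simp [smul_smul]
    rw [diagAct_tmul, rightUnitEquiv_apply, e, H.comul_counit]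
    simp [M.isYetterDrinfeld.right_module.twist_act, rightUnitEquiv_apply]

theorem rightUnitEquiv_coact (x : M.carrier ⊗[k] k) :
    M.coact (rightUnitEquiv M x) =
      map (rightUnitEquiv M).toLinearMap LinearMap.id
        (codiagCoact H M.coact ((TensorProduct.mk k k H.carrier).flip H.one) x) := by
  induction x using TensorProduct.induction_on with
  | zero => simp
  | add X Y hX hY => simp only [map_add, hX, hY]
  | tmul m a =>
    rw [codiagCoact_tmul, rightUnitEquiv_apply,
      M.isYetterDrinfeld.right_comodule.coact_twist, TensorProduct.rid_tmul, map_smul]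
    generalize M.coact m = Z
    induction Z using TensorProduct.induction_on with
    | zero => simp
    | add X Y hX hY => simp only [map_add, LinearMap.add_apply, hX, hY, smul_add]
    | tmul z w => simp [H.mul_one, TensorProduct.smul_tmul', rightUnitEquiv_apply]

/-- The right unit constraint `m ⊗ x ↦ xμ(m)`. -/
def rightUnitIso : tensor M (unit H) ≅ M :=
  isoOfEquiv (M := tensor M (unit H)) (rightUnitEquiv M) (rightUnitEquiv_twist M)
    (rightUnitEquiv_act M) (rightUnitEquiv_coact M)

end Constraints

instance : MonoidalCategoryStruct (YetterDrinfeldModule H) where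
  tensorObj := tensor
  whiskerLeft M _ _ f := tensorMap (𝟙 M) f
  whiskerRight f N := tensorMap f (𝟙 N)
  tensorHom f g := tensorMap f g
  tensorUnit := unit H
  associator := assocIso
  leftUnitor := leftUnitIso
  rightUnitor := rightUnitIso

theorem tensor_hom_ext {M N P : YetterDrinfeldModule H} {f g : tensor M N ⟶ P}
    (h : ∀ m n, Hom.toLin f (m ⊗ₜ[k] n) = Hom.toLin g (m ⊗ₜ[k] n)) : f = g :=
  hom_ext (TensorProduct.ext' h)

theorem tensor_hom_ext₃ {M N P Q : YetterDrinfeldModule H} {f g : tensor (tensor M N) P ⟶ Q}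
    (h : ∀ m n p, Hom.toLin f ((m ⊗ₜ[k] n) ⊗ₜ[k] p) = Hom.toLin g ((m ⊗ₜ[k] n) ⊗ₜ[k] p)) :
    f = g :=
  hom_ext (TensorProduct.ext_threefold h)

/-- Yetter-Drinfel'd Hom-modules form a monoidal category with the tensor product over `k`. -/
instance : MonoidalCategory (YetterDrinfeldModule H) :=
  MonoidalCategory.ofTensorHom
    (id_tensorHom_id := fun M N => tensor_hom_ext fun _ _ => rfl)
    (id_tensorHom := fun _ _ _ _ => rfl)
    (tensorHom_id := fun _ _ => rfl)
    (tensorHom_comp_tensorHom := fun _ _ _ _ => tensor_hom_ext fun _ _ => rfl)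
    (associator_naturality := fun {M N P M' N' P'} f g h => tensor_hom_ext₃ fun m n p =>
      congrArg₂ (fun a b => a ⊗ₜ[k] (Hom.toLin g n ⊗ₜ[k] b))
        (f.map_twist m).symm (map_twist_symm h p).symm)
    (leftUnitor_naturality := fun {M N} f => tensor_hom_ext fun (x : k) m => by
      change N.twist (x • Hom.toLin f m) = Hom.toLin f (M.twist (x • m))
      rw [f.map_twist, map_smul (Hom.toLin f)])
    (rightUnitor_naturality := fun {M N} f => tensor_hom_ext fun m (x : k) => by
      change N.twist (x • Hom.toLin f m) = Hom.toLin f (M.twist (x • m))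
      rw [f.map_twist, map_smul (Hom.toLin f)])
    (pentagon := fun M N P Q => hom_ext (TensorProduct.ext_fourfold fun m n p q => rfl))
    (triangle := fun M N => tensor_hom_ext₃ fun m (x : k) n => by
      change M.twist m ⊗ₜ[k] N.twist (x • N.twist.symm n) = M.twist (x • m) ⊗ₜ[k] n
      rw [map_smul, map_smul, LinearEquiv.apply_symm_apply, TensorProduct.smul_tmul])

end YetterDrinfeldModule

end HomHopf

namespace HomHopf

/-! ### Prebraidings -/

section Prebraidings

open scoped MonoidalCategory

universe v₁ u₁ v₂ u₂

/-- A prebraiding on a monoidal category: a natural family of morphisms `X ⊗ Y ⟶ Y ⊗ X`, not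
required to be invertible, satisfying both hexagon axioms and compatible with the unit
constraints. -/
structure Prebraiding (C : Type u₁) [Category.{v₁} C] [MonoidalCategory C] where
  braiding : ∀ X Y : C, X ⊗ Y ⟶ Y ⊗ X
  naturality : ∀ {X X' Y Y' : C} (f : X ⟶ X') (g : Y ⟶ Y'),
    (f ⊗ₘ g) ≫ braiding X' Y' = braiding X Y ≫ (g ⊗ₘ f)
  hexagon_forward : ∀ X Y Z : C,
    (α_ X Y Z).hom ≫ braiding X (Y ⊗ Z) ≫ (α_ Y Z X).hom =
      (braiding X Y ▷ Z) ≫ (α_ Y X Z).hom ≫ (Y ◁ braiding X Z)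
  hexagon_reverse : ∀ X Y Z : C,
    (α_ X Y Z).inv ≫ braiding (X ⊗ Y) Z ≫ (α_ Z X Y).inv =
      (X ◁ braiding Y Z) ≫ (α_ X Z Y).inv ≫ (braiding X Z ▷ Y)
  braiding_leftUnitor : ∀ X : C, braiding X (𝟙_ C) ≫ (λ_ X).hom = (ρ_ X).hom
  braiding_rightUnitor : ∀ X : C, braiding (𝟙_ C) X ≫ (ρ_ X).hom = (λ_ X).hom

/-- A (strong) monoidal functor is prebraided if it carries one prebraiding to the other. -/
def IsPrebraided {C : Type u₁} [Category.{v₁} C] [MonoidalCategory C]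
    {D : Type u₂} [Category.{v₂} D] [MonoidalCategory D]
    (c : Prebraiding C) (d : Prebraiding D) (F : C ⥤ D) (hF : F.Monoidal) : Prop :=
  ∀ X Y : C, hF.μ X Y ≫ F.map (c.braiding X Y) =
    d.braiding (F.obj X) (F.obj Y) ≫ hF.μ Y X

end Prebraidings

variable {k : Type u} [CommRing k]

namespace BicovariantBimodule

variable {H : MonoidalHomHopfAlgebra k}

/-- `P_L(m) = S(m₍₋₁₎)m₍₀₎`. -/
def projL (M : BicovariantBimodule H) : M.carrier →ₗ[k] M.carrier :=
  TensorProduct.lift M.lact ∘ₗ TensorProduct.map H.antipode LinearMap.id ∘ₗ M.lcoact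

/-- `P_R(m) = m₍₀₎S(m₍₁₎)`. -/
def projR (M : BicovariantBimodule H) : M.carrier →ₗ[k] M.carrier :=
  TensorProduct.lift M.ract ∘ₗ TensorProduct.map LinearMap.id H.antipode ∘ₗ M.rcoact

/-- `m, n ↦ m₍₋₁₎P_R(n₍₀₎) ⊗_H P_L(m₍₀₎)n₍₁₎`. -/
def braidBilin (M N : BicovariantBimodule H) :
    M.carrier →ₗ[k] N.carrier →ₗ[k] (tensor N M).carrier :=
  ((TensorProduct.map₂ (N.lact.compl₂ N.projR) (M.ract ∘ₗ M.projL)).compr₂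
    (TensorProduct.lift (tmk N M))).compl₁₂ M.lcoact N.rcoact

end BicovariantBimodule

namespace YetterDrinfeldModule

variable {H : MonoidalHomHopfAlgebra k}

/-- `m ⊗ n ↦ ν(n₍₀₎) ⊗ μ⁻¹(m) ◁ n₍₁₎`. -/
def braidElem (M N : YetterDrinfeldModule H) (m : M.carrier) (n : N.carrier) :
    N.carrier ⊗[k] M.carrier :=
  TensorProduct.map N.twist.toLinearMap (M.act (M.twist.symm m)) (N.coact n)

end YetterDrinfeldModule

/-! ### The functor `V ↦ H ⊗ V` -/

section Free

open TensorProduct (map map₂)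

variable (H : MonoidalHomHopfAlgebra k)

/-- The bicovariant Hom-bimodule `(H ⊗ V, α ⊗ ν)` of a Yetter-Drinfel'd Hom-module `(V, ν)`:
`h(g ⊗ v) = α⁻¹(h)g ⊗ ν(v)`, `(g ⊗ v)h = gh₁ ⊗ v ◁ h₂`,
`ρ(g ⊗ v) = α(g₁) ⊗ (g₂ ⊗ ν⁻¹(v))`, `σ(g ⊗ v) = (g₁ ⊗ v₍₀₎) ⊗ g₂v₍₁₎`. -/
def freeObj (V : YetterDrinfeldModule H) : BicovariantBimodule H where
  carrier := H.carrier ⊗[k] V.carrier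
  twist := TensorProduct.congr H.twist V.twist
  lact := freeLact H V.twist
  ract := diagAct H H.mul V.act
  lcoact := freeLcoact H V.twist
  rcoact := codiagCoact H H.comul V.coact
  isBicovariant := free_isBicovariant V.isYetterDrinfeld

variable {H} {V W : YetterDrinfeldModule H} (f : V ⟶ W)

theorem freeMap_twist (x : H.carrier ⊗[k] V.carrier) :
    map LinearMap.id f.toLin (TensorProduct.congr H.twist V.twist x) =
      TensorProduct.congr H.twist W.twist (map LinearMap.id f.toLin x) := by
  induction x using TensorProduct.induction_on with
  | zero => simp
  | add X Y hX hY => simp only [map_add, hX, hY]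
  | tmul h v => simp [f.map_twist]

theorem freeMap_lact (g : H.carrier) (x : H.carrier ⊗[k] V.carrier) :
    map LinearMap.id f.toLin (freeLact H V.twist g x) =
      freeLact H W.twist g (map LinearMap.id f.toLin x) := by
  induction x using TensorProduct.induction_on with
  | zero => simp
  | add X Y hX hY => simp only [map_add, hX, hY]
  | tmul h v => simp [f.map_twist]

theorem freeMap_ract (x : H.carrier ⊗[k] V.carrier) (g : H.carrier) :
    map LinearMap.id f.toLin (diagAct H H.mul V.act x g) =
      diagAct H H.mul W.act (map LinearMap.id f.toLin x) g :=
  (map_map₂ (f' := H.mul) (a := LinearMap.id) (b := LinearMap.id) (b' := LinearMap.id)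
    (fun _ _ => rfl) f.map_act x _).trans (by rw [TensorProduct.map_id]; rfl)

theorem freeMap_lcoact (x : H.carrier ⊗[k] V.carrier) :
    freeLcoact H W.twist (map LinearMap.id f.toLin x) =
      map LinearMap.id (map LinearMap.id f.toLin) (freeLcoact H V.twist x) := by
  induction x using TensorProduct.induction_on with
  | zero => simp
  | add X Y hX hY => simp only [map_add, hX, hY]
  | tmul h v =>
    rw [TensorProduct.map_tmul, freeLcoact_tmul, freeLcoact_tmul,
      ← YetterDrinfeldModule.map_twist_symm, LinearMap.id_apply]
    generalize H.comul h = D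
    induction D using TensorProduct.induction_on with
    | zero => simp
    | add X Y hX hY => simp only [TensorProduct.add_tmul, map_add, hX, hY]
    | tmul a b => simp

theorem freeMap_rcoact (x : H.carrier ⊗[k] V.carrier) :
    codiagCoact H H.comul W.coact (map LinearMap.id f.toLin x) =
      map (map LinearMap.id f.toLin) LinearMap.id (codiagCoact H H.comul V.coact x) := by
  induction x using TensorProduct.induction_on with
  | zero => simp
  | add X Y hX hY => simp only [map_add, hX, hY]
  | tmul h v =>
    rw [TensorProduct.map_tmul, codiagCoact_tmul, codiagCoact_tmul, f.map_coact,
      map_map₂ (f' := TensorProduct.mk k H.carrier W.carrier) (g' := H.mul)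
        (a := LinearMap.id) (b := f.toLin) (a' := LinearMap.id) (b' := LinearMap.id)
        (fun _ _ => rfl) (fun _ _ => rfl), TensorProduct.map_id]
    rfl

variable (H)

/-- The functor `V ↦ H ⊗ V`, `f ↦ id ⊗ f` from Yetter-Drinfel'd Hom-modules to bicovariant
Hom-bimodules. -/
def freeFunctor : YetterDrinfeldModule H ⥤ BicovariantBimodule H where
  obj := freeObj H
  map {V W} f :=
    ({ toLin := map LinearMap.id (YetterDrinfeldModule.Hom.toLin f)
       map_twist := freeMap_twist f
       map_lact := freeMap_lact f
       map_ract := freeMap_ract f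
       map_lcoact := freeMap_lcoact f
       map_rcoact := freeMap_rcoact f } : BicovariantBimodule.Hom (freeObj H V) (freeObj H W))
  map_id _ := BicovariantBimodule.hom_ext (TensorProduct.map_id)
  map_comp _ _ := BicovariantBimodule.hom_ext (TensorProduct.ext' fun _ _ => rfl)

/-- `gα(h₁) ⊗ (ν⁻¹(v) ◁ h₂ ⊗ w)`. -/
def freeMu (V W : YetterDrinfeldModule H) (g : H.carrier) (v : V.carrier) (h : H.carrier)
    (w : W.carrier) : H.carrier ⊗[k] (V.carrier ⊗[k] W.carrier) :=
  map (H.mul g ∘ₗ H.twist.toLinearMap)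
    ((TensorProduct.mk k V.carrier W.carrier).flip w ∘ₗ V.act (V.twist.symm v)) (H.comul h)

end Free

end HomHopf

namespace HomHopf

attribute [fun_prop] IsLinearMap

/-! ### Sweedler calculus for tensors -/

section Sweedler

variable {k : Type*} [CommRing k]
variable {A B X Y Z : Type*} [AddCommGroup A] [Module k A] [AddCommGroup B] [Module k B]
variable [AddCommGroup X] [Module k X] [AddCommGroup Y] [Module k Y] [AddCommGroup Z] [Module k Z]

@[fun_prop] theorem isLinearMap_id : IsLinearMap k (fun x : X => x) :=
  ⟨fun _ _ => rfl, fun _ _ => rfl⟩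

@[fun_prop] theorem isLinearMap_comp {f : Y → Z} {g : X → Y} (hf : IsLinearMap k f)
    (hg : IsLinearMap k g) : IsLinearMap k (fun x => f (g x)) :=
  ⟨fun x y => by rw [hg.map_add, hf.map_add], fun c x => by rw [hg.map_smul, hf.map_smul]⟩

@[fun_prop] theorem isLinearMap_coe (f : X →ₗ[k] Y) : IsLinearMap k (fun x => f x) := f.isLinear

@[fun_prop] theorem isLinearMap_coe_equiv (f : X ≃ₗ[k] Y) : IsLinearMap k (fun x => f x) :=
  f.toLinearMap.isLinear

@[fun_prop] theorem isLinearMap_apply {f : X → Y →ₗ[k] Z} (hf : IsLinearMap k f) (y : Y) :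
    IsLinearMap k (fun x => f x y) :=
  ⟨fun x y => by rw [hf.map_add]; rfl, fun c x => by rw [hf.map_smul]; rfl⟩

@[fun_prop] theorem isLinearMap_tmul_right {f : X → A} (hf : IsLinearMap k f) (b : B) :
    IsLinearMap k (fun x => f x ⊗ₜ[k] b) :=
  ⟨fun x y => by rw [hf.map_add, TensorProduct.add_tmul],
    fun c x => by rw [hf.map_smul, TensorProduct.smul_tmul']⟩

@[fun_prop] theorem isLinearMap_tmul_left {f : X → B} (hf : IsLinearMap k f) (a : A) :
    IsLinearMap k (fun x => a ⊗ₜ[k] f x) :=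
  ⟨fun x y => by rw [hf.map_add, TensorProduct.tmul_add],
    fun c x => by rw [hf.map_smul, TensorProduct.tmul_smul]⟩

@[fun_prop] theorem isLinearMap_smul_left {f : X → k} (hf : IsLinearMap k f) (y : Y) :
    IsLinearMap k (fun x => f x • y) :=
  ⟨fun x y => by rw [hf.map_add, add_smul],
    fun c x => by rw [hf.map_smul, smul_eq_mul, mul_smul]⟩

@[fun_prop] theorem isLinearMap_smul_right {f : X → Y} (hf : IsLinearMap k f) (c : k) :
    IsLinearMap k (fun x => c • f x) :=
  ⟨fun x y => by rw [hf.map_add, smul_add], fun _ x => by rw [hf.map_smul, smul_comm]⟩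

theorem exists_tmul_multiset (T : A ⊗[k] B) :
    ∃ s : Multiset (A × B), (s.map fun p => p.1 ⊗ₜ[k] p.2).sum = T := by
  induction T using TensorProduct.induction_on with
  | zero => exact ⟨0, by simp⟩
  | tmul a b => exact ⟨{(a, b)}, by simp⟩
  | add S T hS hT =>
    obtain ⟨s, rfl⟩ := hS
    obtain ⟨t, rfl⟩ := hT
    exact ⟨s + t, by simp⟩

/-- Sweedler summation: `sw T F` is `∑ F a b` for a chosen presentation `T = ∑ a ⊗ b`. -/
noncomputable def sw (T : A ⊗[k] B) (F : A → B → X) : X :=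
  ((exists_tmul_multiset T).choose.map fun p => F p.1 p.2).sum

theorem sw_mk (T : A ⊗[k] B) : sw T (fun a b => a ⊗ₜ[k] b) = T :=
  (exists_tmul_multiset T).choose_spec

/-- The presentation depends on `T` only, so linear maps enter the sum with no bilinearity
assumption on `F`. -/
theorem map_sw (L : X →ₗ[k] Y) (T : A ⊗[k] B) (F : A → B → X) :
    L (sw T F) = sw T (fun a b => L (F a b)) := by
  simp [sw, map_multiset_sum, Multiset.map_map]

theorem equiv_sw (L : X ≃ₗ[k] Y) (T : A ⊗[k] B) (F : A → B → X) :
    L (sw T F) = sw T (fun a b => L (F a b)) := map_sw L.toLinearMap T F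

theorem lin_sw {L : X → Y} (hL : IsLinearMap k L) (T : A ⊗[k] B) (F : A → B → X) :
    L (sw T F) = sw T (fun a b => L (F a b)) := map_sw (hL.mk' L) T F

theorem sw_apply (T : A ⊗[k] B) (F : A → B → X →ₗ[k] Y) (x : X) :
    sw T F x = sw T (fun a b => F a b x) :=
  map_sw (LinearMap.applyₗ (R := k) x) T F

theorem sw_tmul_right (T : A ⊗[k] B) (F : A → B → X) (y : Y) :
    sw T F ⊗ₜ[k] y = sw T (fun a b => F a b ⊗ₜ[k] y) :=
  map_sw ((TensorProduct.mk k X Y).flip y) T F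

theorem sw_tmul_left (T : A ⊗[k] B) (F : A → B → X) (y : Y) :
    y ⊗ₜ[k] sw T F = sw T (fun a b => y ⊗ₜ[k] F a b) :=
  map_sw (TensorProduct.mk k Y X y) T F

theorem smul_sw (T : A ⊗[k] B) (F : A → B → X) (c : k) :
    c • sw T F = sw T (fun a b => c • F a b) :=
  map_sw (LinearMap.lsmul k X c) T F

/-- Both sides are finite double sums over fixed presentations, so no linearity is involved. -/
theorem sw_comm {A' B' W : Type*} [AddCommGroup A'] [Module k A'] [AddCommGroup B'] [Module k B']
    [AddCommGroup W]
    (T : A ⊗[k] B) (T' : A' ⊗[k] B') (F : A → B → A' → B' → W) :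
    sw T (fun a b => sw T' (fun c d => F a b c d)) =
      sw T' (fun c d => sw T (fun a b => F a b c d)) := by
  simp only [sw]
  exact Multiset.sum_map_sum_map _ _

/-- For bilinear `F` the chosen presentation is irrelevant. Every rewriting of the tensor itself, as
opposed to the summand, rests on this. -/
theorem sw_eq_lift {F : A → B → X} (h : ∀ b, IsLinearMap k (fun a => F a b))
    (h' : ∀ a, IsLinearMap k (fun b => F a b)) (T : A ⊗[k] B) :
    sw T F = TensorProduct.lift (LinearMap.mk₂ k F (fun a a' b => (h b).map_add a a')
      (fun c a b => (h b).map_smul c a) (fun a => (h' a).map_add)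
      (fun c a => (h' a).map_smul c)) T := by
  conv_rhs => rw [← sw_mk T, map_sw]
  rfl

theorem sw_tmul {F : A → B → X} (h : ∀ b, IsLinearMap k (fun a => F a b))
    (h' : ∀ a, IsLinearMap k (fun b => F a b)) (a : A) (b : B) :
    sw (a ⊗ₜ[k] b) F = F a b := by
  rw [sw_eq_lift h h']; rfl

@[fun_prop] theorem isLinearMap_sw_left {F : A → B → X} {T : Y → A ⊗[k] B}
    (h : ∀ b, IsLinearMap k (fun a => F a b)) (h' : ∀ a, IsLinearMap k (fun b => F a b))
    (hT : IsLinearMap k T) : IsLinearMap k (fun y => sw (T y) F) := by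
  simp only [sw_eq_lift h h']
  exact isLinearMap_comp (LinearMap.isLinear _) hT

-- The tensor is fixed here, so linearity in `y` is needed termwise only; in `isLinearMap_sw_left`
-- the tensor varies and `F` must be bilinear.
@[fun_prop] theorem isLinearMap_sw_right {F : Y → A → B → X} {T : A ⊗[k] B}
    (h : ∀ a b, IsLinearMap k (fun y => F y a b)) : IsLinearMap k (fun y => sw T (F y)) := by
  constructor
  · intro x y
    simp [sw, (h _ _).map_add, Multiset.sum_map_add]
  · intro c y
    simp [sw, (h _ _).map_smul, Multiset.smul_sum, Multiset.map_map]

theorem sw_sw {A' B' : Type*} [AddCommGroup A'] [Module k A'] [AddCommGroup B'] [Module k B']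
    {F : A → B → X} (h : ∀ b, IsLinearMap k (fun a => F a b))
    (h' : ∀ a, IsLinearMap k (fun b => F a b)) (T : A' ⊗[k] B') (G : A' → B' → A ⊗[k] B) :
    sw (sw T G) F = sw T (fun a b => sw (G a b) F) :=
  lin_sw (L := fun T => sw T F) (by fun_prop) T G

/-- This and the following lemmas translate the tensor combinators in the axioms into Sweedler sums:
present the tensor as a sum of pure tensors and push the map inside. -/
theorem map_eq_sw (f : A →ₗ[k] X) (g : B →ₗ[k] Y) (T : A ⊗[k] B) :
    map f g T = sw T (fun a b => f a ⊗ₜ[k] g b) := by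
  conv_lhs => rw [← sw_mk T, map_sw]
  rfl

theorem lift_eq_sw (f : A →ₗ[k] B →ₗ[k] X) (T : A ⊗[k] B) :
    TensorProduct.lift f T = sw T (fun a b => f a b) := by
  conv_lhs => rw [← sw_mk T, map_sw]
  rfl

theorem map₂_eq_sw {A' B' : Type*} [AddCommGroup A'] [Module k A'] [AddCommGroup B'] [Module k B']
    (f : A →ₗ[k] B →ₗ[k] X) (g : A' →ₗ[k] B' →ₗ[k] Y) (S : A ⊗[k] A') (T : B ⊗[k] B') :
    map₂ f g S T = sw S (fun a a' => sw T (fun b b' => f a b ⊗ₜ[k] g a' b')) := by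
  conv_lhs => rw [← sw_mk S, map_sw, sw_apply]
  simp only [map₂_apply_tmul, map_eq_sw]

theorem rid_eq_sw (T : X ⊗[k] k) : TensorProduct.rid k X T = sw T (fun x c => c • x) := by
  conv_lhs => rw [← sw_mk T, equiv_sw]
  simp

theorem assoc_eq_sw (T : (A ⊗[k] B) ⊗[k] X) : TensorProduct.assoc k A B X T =
    sw T (fun s x => sw s (fun a b => a ⊗ₜ[k] (b ⊗ₜ[k] x))) := by
  conv_lhs => rw [← sw_mk T, equiv_sw]
  congr! with s x
  conv_lhs => rw [← sw_mk s, sw_tmul_right, equiv_sw]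
  rfl

theorem leftComm_eq_sw (T : A ⊗[k] (B ⊗[k] X)) : TensorProduct.leftComm k A B X T =
    sw T (fun a s => sw s (fun b x => b ⊗ₜ[k] (a ⊗ₜ[k] x))) := by
  conv_lhs => rw [← sw_mk T, equiv_sw]
  congr! with a s
  conv_lhs => rw [← sw_mk s, sw_tmul_left, equiv_sw]
  rfl

end Sweedler
end HomHopf
namespace HomHopf

/-! ### Hom-(co)module and Hopf axioms in Sweedler form -/

section SweedlerHopf

variable {k : Type u} [CommRing k] {H : MonoidalHomHopfAlgebra k}
variable {M X : Type u} [AddCommGroup M] [Module k M] [AddCommGroup X] [Module k X]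

theorem IsLeftComodule.sw_twist {μ : M ≃ₗ[k] M} {ρ : M →ₗ[k] H.carrier ⊗[k] M}
    (hρ : IsLeftComodule H μ ρ) {F : H.carrier → M → X}
    (h₁ : ∀ b, IsLinearMap k (fun a => F a b)) (h₂ : ∀ a, IsLinearMap k (fun b => F a b)) (m : M) :
    sw (ρ (μ m)) F = sw (ρ m) (fun a x => F (H.twist a) (μ x)) := by
  rw [hρ.coact_twist, map_eq_sw, sw_sw h₁ h₂]
  simp (disch := fun_prop) only [sw_tmul, LinearEquiv.coe_coe]

theorem IsLeftComodule.sw_symm {μ : M ≃ₗ[k] M} {ρ : M →ₗ[k] H.carrier ⊗[k] M}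
    (hρ : IsLeftComodule H μ ρ) {F : H.carrier → M → X}
    (h₁ : ∀ b, IsLinearMap k (fun a => F a b)) (h₂ : ∀ a, IsLinearMap k (fun b => F a b)) (m : M) :
    sw (ρ (μ.symm m)) F = sw (ρ m) (fun a x => F (H.twist.symm a) (μ.symm x)) := by
  rw [hρ.coact_symm, map_eq_sw, sw_sw h₁ h₂]
  simp (disch := fun_prop) only [sw_tmul, LinearEquiv.coe_coe]

theorem IsLeftComodule.sw_coassoc {μ : M ≃ₗ[k] M} {ρ : M →ₗ[k] H.carrier ⊗[k] M}
    (hρ : IsLeftComodule H μ ρ) {F : H.carrier → H.carrier → M → X}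
    (h₁ : ∀ b c, IsLinearMap k (fun a => F a b c)) (h₂ : ∀ a c, IsLinearMap k (fun b => F a b c))
    (h₃ : ∀ a b, IsLinearMap k (fun c => F a b c)) (m : M) :
    sw (ρ m) (fun a x => sw (H.comul a) (fun c d => F c d x)) =
      sw (ρ m) (fun a x => sw (ρ x) (fun c y => F (H.twist.symm a) c (μ y))) := by
  -- The axiom carries `μ⁻¹` in its last slot on the side with `Δ`. Evaluating both sides with `μ`
  -- inserted there leaves that side free of twists.
  have e := congrArg (fun T => sw T (fun a s => sw s (fun c y => F a c (μ y)))) (hρ.coassoc m)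
  simp only [map_eq_sw, assoc_eq_sw] at e
  simpa (disch := fun_prop) only [sw_sw, sw_tmul, LinearEquiv.coe_coe,
    LinearEquiv.apply_symm_apply] using e

theorem IsLeftComodule.sw_counit {μ : M ≃ₗ[k] M} {ρ : M →ₗ[k] H.carrier ⊗[k] M}
    (hρ : IsLeftComodule H μ ρ) {F : M → X} (h : IsLinearMap k F) (m : M) :
    sw (ρ m) (fun a x => H.counit a • F x) = F (μ.symm m) := by
  rw [← hρ.counit m, map_eq_sw, equiv_sw, lin_sw h]
  simp [h.map_smul]

theorem IsRightComodule.sw_twist {μ : M ≃ₗ[k] M} {σ : M →ₗ[k] M ⊗[k] H.carrier}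
    (hσ : IsRightComodule H μ σ) {F : M → H.carrier → X}
    (h₁ : ∀ b, IsLinearMap k (fun a => F a b)) (h₂ : ∀ a, IsLinearMap k (fun b => F a b)) (m : M) :
    sw (σ (μ m)) F = sw (σ m) (fun x a => F (μ x) (H.twist a)) := by
  rw [hσ.coact_twist, map_eq_sw, sw_sw h₁ h₂]
  simp (disch := fun_prop) only [sw_tmul, LinearEquiv.coe_coe]

theorem IsRightComodule.sw_symm {μ : M ≃ₗ[k] M} {σ : M →ₗ[k] M ⊗[k] H.carrier}
    (hσ : IsRightComodule H μ σ) {F : M → H.carrier → X}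
    (h₁ : ∀ b, IsLinearMap k (fun a => F a b)) (h₂ : ∀ a, IsLinearMap k (fun b => F a b)) (m : M) :
    sw (σ (μ.symm m)) F = sw (σ m) (fun x a => F (μ.symm x) (H.twist.symm a)) := by
  rw [hσ.coact_symm, map_eq_sw, sw_sw h₁ h₂]
  simp (disch := fun_prop) only [sw_tmul, LinearEquiv.coe_coe]

theorem IsRightComodule.sw_coassoc {μ : M ≃ₗ[k] M} {σ : M →ₗ[k] M ⊗[k] H.carrier}
    (hσ : IsRightComodule H μ σ) {F : M → H.carrier → H.carrier → X}
    (h₁ : ∀ b c, IsLinearMap k (fun a => F a b c)) (h₂ : ∀ a c, IsLinearMap k (fun b => F a b c))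
    (h₃ : ∀ a b, IsLinearMap k (fun c => F a b c)) (m : M) :
    sw (σ m) (fun x a => sw (σ x) (fun y b => F y b a)) =
      sw (σ m) (fun x a => sw (H.comul a) (fun b c => F (μ.symm x) b (H.twist c))) := by
  -- As in the left case, `α` in the last slot cancels the `α⁻¹` in the axiom.
  have e := congrArg (fun T => sw T (fun a s => sw s (fun c y => F a c (H.twist y))))
    (hσ.coassoc m)
  simp only [map_eq_sw, assoc_eq_sw] at e
  simpa (disch := fun_prop) only [sw_sw, sw_tmul, LinearEquiv.coe_coe,
    LinearEquiv.apply_symm_apply] using e.symm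

theorem IsRightComodule.sw_counit {μ : M ≃ₗ[k] M} {σ : M →ₗ[k] M ⊗[k] H.carrier}
    (hσ : IsRightComodule H μ σ) {F : M → X} (h : IsLinearMap k F) (m : M) :
    sw (σ m) (fun x a => H.counit a • F x) = F (μ.symm m) := by
  rw [← hσ.counit m, map_eq_sw, equiv_sw, lin_sw h]
  simp [h.map_smul]

theorem sw_comul_twist {F : H.carrier → H.carrier → X} (h₁ : ∀ b, IsLinearMap k (fun a => F a b))
    (h₂ : ∀ a, IsLinearMap k (fun b => F a b)) (a : H.carrier) :
    sw (H.comul (H.twist a)) F = sw (H.comul a) (fun b c => F (H.twist b) (H.twist c)) :=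
  (isLeftComodule_self H).sw_twist h₁ h₂ a

theorem sw_comul_symm {F : H.carrier → H.carrier → X} (h₁ : ∀ b, IsLinearMap k (fun a => F a b))
    (h₂ : ∀ a, IsLinearMap k (fun b => F a b)) (a : H.carrier) :
    sw (H.comul (H.twist.symm a)) F =
      sw (H.comul a) (fun b c => F (H.twist.symm b) (H.twist.symm c)) :=
  (isLeftComodule_self H).sw_symm h₁ h₂ a

theorem sw_comul_coassoc {F : H.carrier → H.carrier → H.carrier → X}
    (h₁ : ∀ b c, IsLinearMap k (fun a => F a b c)) (h₂ : ∀ a c, IsLinearMap k (fun b => F a b c))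
    (h₃ : ∀ a b, IsLinearMap k (fun c => F a b c)) (h : H.carrier) :
    sw (H.comul h) (fun a b => sw (H.comul a) (fun c d => F c d b)) =
      sw (H.comul h) (fun a b => sw (H.comul b) (fun c d => F (H.twist.symm a) c (H.twist d))) :=
  (isLeftComodule_self H).sw_coassoc h₁ h₂ h₃ h

theorem sw_comul_counit_left {F : H.carrier → X} (hF : IsLinearMap k F) (h : H.carrier) :
    sw (H.comul h) (fun a b => H.counit a • F b) = F (H.twist.symm h) :=
  (isLeftComodule_self H).sw_counit hF h

theorem sw_comul_counit_right {F : H.carrier → X} (hF : IsLinearMap k F) (h : H.carrier) :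
    sw (H.comul h) (fun a b => H.counit b • F a) = F (H.twist.symm h) :=
  (isRightComodule_self H).sw_counit hF h

theorem sw_comul_mul {F : H.carrier → H.carrier → X} (h₁ : ∀ b, IsLinearMap k (fun a => F a b))
    (h₂ : ∀ a, IsLinearMap k (fun b => F a b)) (g h : H.carrier) :
    sw (H.comul (H.mul g h)) F =
      sw (H.comul g) (fun a b => sw (H.comul h) (fun c d => F (H.mul a c) (H.mul b d))) := by
  rw [H.comul_mul, map₂_eq_sw]
  simp (disch := fun_prop) only [sw_sw, sw_tmul]

theorem sw_comul_one {F : H.carrier → H.carrier → X} (h₁ : ∀ b, IsLinearMap k (fun a => F a b))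
    (h₂ : ∀ a, IsLinearMap k (fun b => F a b)) : sw (H.comul H.one) F = F H.one H.one := by
  rw [H.comul_one, sw_tmul h₁ h₂]

theorem sw_antipode_mul {F : H.carrier → X} (hF : IsLinearMap k F) (h : H.carrier) :
    sw (H.comul h) (fun a b => F (H.mul (H.antipode a) b)) = H.counit h • F H.one := by
  rw [← hF.map_smul, ← H.antipode_mul, map_eq_sw, map_sw, lin_sw hF]
  rfl

theorem sw_mul_antipode {F : H.carrier → X} (hF : IsLinearMap k F) (h : H.carrier) :
    sw (H.comul h) (fun a b => F (H.mul a (H.antipode b))) = H.counit h • F H.one := by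
  rw [← hF.map_smul, ← H.mul_antipode, map_eq_sw, map_sw, lin_sw hF]
  rfl

theorem antipode_symm (H : MonoidalHomHopfAlgebra k) (a : H.carrier) :
    H.twist.symm (H.antipode a) = H.antipode (H.twist.symm a) := by
  rw [LinearEquiv.symm_apply_eq, ← H.antipode_twist, LinearEquiv.apply_symm_apply]

/-- Reassociation to the right. -/
theorem mul_mul (H : MonoidalHomHopfAlgebra k) (a b c : H.carrier) :
    H.mul (H.mul a b) c = H.mul (H.twist a) (H.mul b (H.twist.symm c)) := by
  rw [H.mul_assoc, LinearEquiv.apply_symm_apply]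

end SweedlerHopf

namespace BicovariantBimodule

variable {k : Type u} [CommRing k] {H : MonoidalHomHopfAlgebra k} (M : BicovariantBimodule H)
variable {X : Type u} [AddCommGroup X] [Module k X]

/-- This and the next two lemmas are oriented to one bracketing: products of left actors open to the
right, successive right actions merge into one, and left actions move outside right actions. The
twists are absorbed by the outer factors. -/
theorem mul_lact (g h : H.carrier) (m : M.carrier) :
    M.lact (H.mul g h) m = M.lact (H.twist g) (M.lact h (M.twist.symm m)) := by
  rw [M.isBicovariant.left_module.act_act, LinearEquiv.apply_symm_apply]

theorem ract_ract (m : M.carrier) (g h : H.carrier) :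
    M.ract (M.ract m g) h = M.ract (M.twist m) (H.mul g (H.twist.symm h)) := by
  rw [M.isBicovariant.right_module.act_act, LinearEquiv.apply_symm_apply]

theorem ract_lact (h : H.carrier) (m : M.carrier) (g : H.carrier) :
    M.ract (M.lact h m) g = M.lact (H.twist h) (M.ract m (H.twist.symm g)) := by
  rw [← M.isBicovariant.bimodule, LinearEquiv.apply_symm_apply]

theorem one_lact (m : M.carrier) : M.lact H.one m = M.twist m :=
  M.isBicovariant.left_module.one_act m

theorem ract_one (m : M.carrier) : M.ract m H.one = M.twist m :=
  M.isBicovariant.right_module.act_one m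

theorem sw_lcoact_lact {F : H.carrier → M.carrier → X}
    (h₁ : ∀ b, IsLinearMap k (fun a => F a b)) (h₂ : ∀ a, IsLinearMap k (fun b => F a b))
    (h : H.carrier) (m : M.carrier) :
    sw (M.lcoact (M.lact h m)) F = sw (H.comul h) (fun a b => sw (M.lcoact m)
      (fun c x => F (H.mul a c) (M.lact b x))) := by
  rw [M.isBicovariant.lcoact_lact, map₂_eq_sw]
  simp (disch := fun_prop) only [sw_sw, sw_tmul]

theorem sw_lcoact_ract {F : H.carrier → M.carrier → X}
    (h₁ : ∀ b, IsLinearMap k (fun a => F a b)) (h₂ : ∀ a, IsLinearMap k (fun b => F a b))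
    (m : M.carrier) (h : H.carrier) :
    sw (M.lcoact (M.ract m h)) F = sw (M.lcoact m) (fun a x => sw (H.comul h)
      (fun b c => F (H.mul a b) (M.ract x c))) := by
  rw [M.isBicovariant.lcoact_ract, map₂_eq_sw]
  simp (disch := fun_prop) only [sw_sw, sw_tmul]

theorem sw_rcoact_lact {F : M.carrier → H.carrier → X}
    (h₁ : ∀ b, IsLinearMap k (fun a => F a b)) (h₂ : ∀ a, IsLinearMap k (fun b => F a b))
    (h : H.carrier) (m : M.carrier) :
    sw (M.rcoact (M.lact h m)) F = sw (H.comul h) (fun a b => sw (M.rcoact m)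
      (fun x c => F (M.lact a x) (H.mul b c))) := by
  rw [M.isBicovariant.rcoact_lact, map₂_eq_sw]
  simp (disch := fun_prop) only [sw_sw, sw_tmul]

theorem sw_rcoact_ract {F : M.carrier → H.carrier → X}
    (h₁ : ∀ b, IsLinearMap k (fun a => F a b)) (h₂ : ∀ a, IsLinearMap k (fun b => F a b))
    (m : M.carrier) (h : H.carrier) :
    sw (M.rcoact (M.ract m h)) F = sw (M.rcoact m) (fun x a => sw (H.comul h)
      (fun b c => F (M.ract x b) (H.mul a c))) := by
  rw [M.isBicovariant.rcoact_ract, map₂_eq_sw]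
  simp (disch := fun_prop) only [sw_sw, sw_tmul]

end BicovariantBimodule
end HomHopf
namespace HomHopf
-- The projection `P_L` onto left coinvariants
section
variable {k : Type u} [CommRing k] {H : MonoidalHomHopfAlgebra k}

/-- `S(a₁b₁)(a₂b₂) = ε(a)ε(b)1`. -/
theorem sw_antipode_mul_mul {X : Type u} [AddCommGroup X] [Module k X] {F : H.carrier → X}
    (hF : IsLinearMap k F) (a b : H.carrier) :
    sw (H.comul a) (fun a₁ a₂ => sw (H.comul b) (fun b₁ b₂ =>
      F (H.mul (H.antipode (H.mul a₁ b₁)) (H.mul a₂ b₂)))) =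
      H.counit a • H.counit b • F H.one := by
  -- This is the antipode axiom for the single element `ab`, because `Δ` and `ε` are multiplicative.
  rw [← mul_smul, ← H.counit_mul, ← sw_antipode_mul hF, sw_comul_mul] <;> fun_prop

end

namespace BicovariantBimodule

variable {k : Type u} [CommRing k] {H : MonoidalHomHopfAlgebra k} (M : BicovariantBimodule H)
variable {X : Type u} [AddCommGroup X] [Module k X]

theorem projL_eq_sw (m : M.carrier) :
    M.projL m = sw (M.lcoact m) (fun a x => M.lact (H.antipode a) x) := by
  rw [projL, LinearMap.comp_apply, LinearMap.comp_apply, map_eq_sw, map_sw]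
  rfl

theorem projR_eq_sw (m : M.carrier) :
    M.projR m = sw (M.rcoact m) (fun x a => M.ract x (H.antipode a)) := by
  rw [projR, LinearMap.comp_apply, LinearMap.comp_apply, map_eq_sw, map_sw]
  rfl

theorem projL_twist (m : M.carrier) : M.projL (M.twist m) = M.twist (M.projL m) := by
  rw [projL_eq_sw, projL_eq_sw, M.isBicovariant.left_comodule.sw_twist, equiv_sw]
  · simp only [twist_lact, H.antipode_twist]
  all_goals fun_prop

theorem projL_symm (m : M.carrier) :
    M.projL (M.twist.symm m) = M.twist.symm (M.projL m) := by
  rw [LinearEquiv.eq_symm_apply, ← projL_twist, LinearEquiv.apply_symm_apply]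

/-- `m₍₋₁₎P_L(m₍₀₎) = m`. -/
theorem sw_lact_projL (m : M.carrier) :
    sw (M.lcoact m) (fun a x => M.lact a (M.projL x)) = m := by
  -- Coassociativity compares `m₍₋₁₎(S(m₍₀₎₍₋₁₎)m₍₀₎₍₀₎)` with a sum in which the two legs of
  -- `Δ(m₍₋₁₎)` meet as `cS(d)`. There the antipode and counit axioms apply.
  have e := M.isBicovariant.left_comodule.sw_coassoc
    (F := fun a b x => M.lact (H.mul a (H.antipode b)) x)
    (by fun_prop) (by fun_prop) (by fun_prop) m
  simp only [projL_eq_sw, map_sw]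
  simp only [mul_lact, LinearEquiv.apply_symm_apply, LinearEquiv.symm_apply_apply] at e
  rw [← e]
  have e' : ∀ a x, sw (H.comul a) (fun c d => M.lact (H.twist c) (M.lact (H.antipode d)
      (M.twist.symm x))) = H.counit a • M.twist x := by
    intro a x
    rw [← one_lact, ← sw_mul_antipode (F := fun a => M.lact a x) (by fun_prop)]
    simp only [mul_lact]
  simp only [e']
  rw [M.isBicovariant.left_comodule.sw_counit, LinearEquiv.apply_symm_apply]
  fun_prop

/-- `P_L(hm) = ε(h)μ(P_L(m))`. -/
theorem projL_lact (h : H.carrier) (m : M.carrier) :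
    M.projL (M.lact h m) = H.counit h • M.twist (M.projL m) := by
  have e := fun a b : H.carrier => M.isBicovariant.left_comodule.sw_coassoc
    (F := fun c d x => M.lact (H.mul (H.antipode (H.mul (H.twist.symm a) c))
      (H.mul (H.twist.symm b) d)) (M.twist (M.projL x)))
    (by fun_prop) (by fun_prop) (by fun_prop) m
  -- Here `S(h₁c₁)(h₂c₂)` collapses. The antipode is applied to a whole product throughout, so its
  -- anti-multiplicativity plays no role.
  have e'' : ∀ c x, sw (H.comul c) (fun c d => sw (H.comul h) (fun a b =>
      M.lact (H.mul (H.antipode (H.mul (H.twist.symm a) c)) (H.mul (H.twist.symm b) d)) x)) =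
      H.counit h • H.counit c • M.twist x := by
    intro c x
    rw [sw_comm, ← counit_symm, ← one_lact,
      ← sw_antipode_mul_mul (F := fun a => M.lact a x) (by fun_prop),
      sw_comul_symm] <;> fun_prop
  -- Writing `x = x₍₋₁₎P_L(x₍₀₎)` supplies the factor that `S(ac)b` lacks: in `S(h₁m₍₋₁₎)(h₂m₍₀₎)`
  -- the second leg of `m₍₋₁₎` now stands beside `h₂`.
  have e₃ : ∀ a b c x, M.lact (H.antipode (H.mul a c)) (M.lact b x) =
      sw (M.lcoact x) fun d y => M.lact (H.mul (H.antipode (H.mul (H.twist.symm a)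
        (H.twist.symm c))) (H.mul (H.twist.symm b) d)) (M.twist (M.projL (M.twist y))) := by
    intro a b c x
    conv_lhs => rw [← M.sw_lact_projL x, map_sw, map_sw]
    simp only [mul_lact, projL_twist, LinearEquiv.symm_apply_apply,
      LinearEquiv.apply_symm_apply, ← H.antipode_twist, H.twist_mul]
  rw [projL_eq_sw, sw_lcoact_lact _ (by fun_prop) (by fun_prop)]
  simp only [e₃, ← e]
  rw [sw_comm]
  simp only [sw_comm (H.comul h), e'']
  rw [← smul_sw, M.isBicovariant.left_comodule.sw_counit (by fun_prop)]
  simp only [projL_symm, LinearEquiv.apply_symm_apply]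

/-- With `P_L` applied to the second leg, `P_L(hm) = ε(h)μ(P_L(m))` replaces `Δ(S(m₍₋₁₎))` by a
counit. What remains is `S(m₍₋₁₎)m₍₀₎₍₋₁₎`, so no formula for `Δ ∘ S` is needed. The full coaction
is recovered from this in `lcoact_projL`. -/
theorem sw_lcoact_projL_projL (m : M.carrier) :
    sw (M.lcoact (M.projL m)) (fun a x => a ⊗ₜ[k] M.projL x) =
      H.one ⊗ₜ[k] M.twist.symm (M.projL m) := by
  have e := M.isBicovariant.left_comodule.sw_coassoc
    (F := fun c d x => H.mul (H.antipode c) d ⊗ₜ[k] M.projL x)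
    (by fun_prop) (by fun_prop) (by fun_prop) m
  have e' : ∀ a x, sw (H.comul a) (fun c d => sw (M.lcoact x) fun b y =>
      H.mul c b ⊗ₜ[k] M.projL (M.lact d y)) =
      sw (M.lcoact x) fun b y => H.mul (H.twist.symm a) b ⊗ₜ[k] M.projL (M.twist y) := by
    intro a x
    simp only [projL_lact, ← projL_twist, TensorProduct.tmul_smul, ← smul_sw]
    rw [sw_comul_counit_right (F := fun c => sw (M.lcoact x) fun b y =>
      H.mul c b ⊗ₜ[k] M.projL (M.twist y)) (by fun_prop)]
  rw [projL_eq_sw, map_sw, sw_sw (by fun_prop) (by fun_prop)]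
  simp (disch := fun_prop) only [sw_lcoact_lact, e', antipode_symm, ← e]
  simp only [sw_antipode_mul (F := fun c => c ⊗ₜ[k] M.projL _) (isLinearMap_tmul_right
    isLinearMap_id _)]
  rw [M.isBicovariant.left_comodule.sw_counit (by fun_prop), projL_symm, projL_eq_sw]

/-- `ρ(P_L(m)) = 1 ⊗ μ⁻¹(P_L(m))`. -/
theorem lcoact_projL (m : M.carrier) :
    M.lcoact (M.projL m) = H.one ⊗ₜ[k] M.twist.symm (M.projL m) := by
  -- The map `a ⊗ x ↦ α(a₁) ⊗ a₂μ⁻¹(x)` undoes the extra `P_L`: by coassociativity and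
  -- `m₍₋₁₎P_L(m₍₀₎) = m` it sends the projected coaction back to the full one, while `1 ⊗ x` goes
  -- to `1 ⊗ x`.
  have e := M.isBicovariant.left_comodule.sw_coassoc
    (F := fun c d x => H.twist c ⊗ₜ[k] M.lact d (M.projL (M.twist.symm x)))
    (by fun_prop) (by fun_prop) (by fun_prop) (M.projL m)
  have e' := congrArg (fun T => sw T fun a x => sw (H.comul a) fun c d =>
    H.twist c ⊗ₜ[k] M.lact d (M.twist.symm x)) (M.sw_lcoact_projL_projL m)
  simp (disch := fun_prop) only [sw_sw, sw_tmul, sw_comul_one, ← projL_symm, e] at e'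
  simp only [LinearEquiv.apply_symm_apply, LinearEquiv.symm_apply_apply, ← sw_tmul_left,
    sw_lact_projL, sw_mk, one_lact, H.twist_one] at e'
  rw [e', projL_symm, LinearEquiv.apply_symm_apply, projL_symm]

/-- `P_L(v) = v` for coinvariant `v`. -/
theorem projL_of_coinvariant {v : M.carrier} (hv : M.lcoact v = H.one ⊗ₜ[k] M.twist.symm v) :
    M.projL v = v := by
  conv_rhs => rw [← M.sw_lact_projL v, hv, sw_tmul (by fun_prop) (by fun_prop), one_lact,
    projL_symm, LinearEquiv.apply_symm_apply]

@[simp] theorem projL_projL (m : M.carrier) : M.projL (M.projL m) = M.projL m :=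
  M.projL_of_coinvariant (M.lcoact_projL m)

/-- Expand `m` as `m₍₋₁₎P_L(m₍₀₎)`; the left factor moves out of `mh` and `P_L` reduces it to a
counit. This is what makes `v ◁ h = P_L(vα(h))` associative. -/
theorem projL_ract_projL (m : M.carrier) (h : H.carrier) :
    M.projL (M.ract (M.projL m) h) = M.projL (M.ract m h) := by
  conv_rhs => rw [← M.sw_lact_projL m, map_sw, sw_apply, map_sw]
  simp only [ract_lact, projL_lact, H.counit_twist, ← projL_twist]
  rw [M.isBicovariant.left_comodule.sw_counit (by fun_prop)]
  simp [twist_ract, projL_symm]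

end BicovariantBimodule
end HomHopf
-- The Yetter-Drinfel'd module of left coinvariants
namespace HomHopf

@[fun_prop] theorem isLinearMap_submodule_coe {k X Y : Type*} [CommRing k] [AddCommGroup X]
    [Module k X] [AddCommGroup Y] [Module k Y] {p : Submodule k X} {f : Y → p}
    (hf : IsLinearMap k f) : IsLinearMap k (fun y => (f y : X)) :=
  isLinearMap_comp (f := p.subtype) (LinearMap.isLinear _) hf

theorem antipode_one {k : Type u} [CommRing k] (H : MonoidalHomHopfAlgebra k) :
    H.antipode H.one = H.one := by
  have e := H.antipode_mul H.one
  rw [H.comul_one, TensorProduct.map_tmul, TensorProduct.lift.tmul, LinearMap.id_apply, H.mul_one,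
    H.counit_one, one_smul, ← H.antipode_twist, H.twist_one] at e
  exact e

namespace BicovariantBimodule

variable {k : Type u} [CommRing k] {H : MonoidalHomHopfAlgebra k} (M : BicovariantBimodule H)

/-- The right coaction of a coinvariant element has coinvariant left legs. -/
theorem sw_rcoact_projL_tmul (m : M.carrier) :
    sw (M.rcoact (M.projL m)) (fun x a => M.projL x ⊗ₜ[k] a) = M.rcoact (M.projL m) := by
  -- Apply `b ⊗ (y ⊗ a) ↦ S(α⁻¹(b))y ⊗ α(a)` to Hom-commutativity. One side acquires `P_L` on its
  -- left leg; on the other the coinvariance of `P_L(m)` makes the `H`-leg equal to `1`, and the map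
  -- becomes trivial.
  have e := congrArg (fun T => sw T fun b s => sw s fun y a =>
      M.lact (H.antipode (H.twist.symm b)) y ⊗ₜ[k] H.twist a)
    (M.isBicovariant.coact_comm (M.projL m))
  simp only [map_eq_sw, assoc_eq_sw, lcoact_projL] at e
  simp (disch := fun_prop) only [sw_sw, sw_tmul, LinearEquiv.coe_coe, LinearMap.id_apply,
    LinearEquiv.symm_apply_apply, LinearEquiv.apply_symm_apply, symm_one, antipode_one, one_lact,
    M.isBicovariant.right_comodule.sw_symm, sw_mk, ← sw_tmul_right, ← projL_eq_sw] at e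
  exact e

theorem sw_rcoact_projL {X : Type u} [AddCommGroup X] [Module k X] {F : M.carrier → H.carrier → X}
    (h₁ : ∀ b, IsLinearMap k (fun a => F a b)) (h₂ : ∀ a, IsLinearMap k (fun b => F a b))
    (m : M.carrier) :
    sw (M.rcoact (M.projL m)) (fun x a => F (M.projL x) a) = sw (M.rcoact (M.projL m)) F := by
  conv_rhs => rw [← sw_rcoact_projL_tmul, sw_sw h₁ h₂]
  simp (disch := fun_prop) only [sw_tmul]

/-- Expand `vh` as `(vh)₍₋₁₎P_L((vh)₍₀₎)` with `ρ(v) = 1 ⊗ μ⁻¹(v)`. The result moves `h` past a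
coinvariant element, so the right action on `M` is determined by the action on coinvariants. -/
theorem ract_projL (m : M.carrier) (h : H.carrier) :
    M.ract (M.projL m) h = sw (H.comul h) fun a b =>
      M.lact (H.twist a) (M.projL (M.ract (M.twist.symm (M.projL m)) b)) := by
  conv_lhs => rw [← M.sw_lact_projL (M.ract (M.projL m) h)]
  rw [sw_lcoact_ract _ (by fun_prop) (by fun_prop), lcoact_projL]
  simp (disch := fun_prop) only [sw_tmul, H.one_mul]

/-- The module of left coinvariants. -/
abbrev Coinv : Type u := LinearMap.range M.projL

/-- The projection to the coinvariants. -/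
abbrev toCoinv : M.carrier →ₗ[k] M.Coinv := M.projL.rangeRestrict

theorem projL_coe (v : M.Coinv) : M.projL (v : M.carrier) = v := by
  obtain ⟨_, m, rfl⟩ := v
  exact M.projL_projL m

theorem toCoinv_coe (v : M.Coinv) : M.toCoinv (v : M.carrier) = v := Subtype.ext (M.projL_coe v)

theorem coe_toCoinv (m : M.carrier) : (M.toCoinv m : M.carrier) = M.projL m := rfl

theorem toCoinv_ract_projL (m : M.carrier) (h : H.carrier) :
    M.toCoinv (M.ract (M.projL m) h) = M.toCoinv (M.ract m h) :=
  Subtype.ext (M.projL_ract_projL m h)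

theorem toCoinv_lact (h : H.carrier) (m : M.carrier) :
    M.toCoinv (M.lact h m) = H.counit h • M.toCoinv (M.twist m) :=
  Subtype.ext (by rw [coe_toCoinv, projL_lact, ← projL_twist]; rfl)

/-- The automorphism of the coinvariants. -/
def coinvTwist : M.Coinv ≃ₗ[k] M.Coinv :=
  LinearEquiv.ofLinearMap (M.toCoinv ∘ₗ M.twist.toLinearMap ∘ₗ Submodule.subtype _)
    (M.toCoinv ∘ₗ M.twist.symm.toLinearMap ∘ₗ Submodule.subtype _)
    (by ext v; simp [projL_symm, projL_coe])
    (by ext v; simp [projL_twist, projL_coe])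

@[simp] theorem coe_coinvTwist (v : M.Coinv) :
    (M.coinvTwist v : M.carrier) = M.twist v := by
  change M.projL (M.twist v) = _
  rw [projL_twist, projL_coe]

@[simp] theorem coe_coinvTwist_symm (v : M.Coinv) :
    (M.coinvTwist.symm v : M.carrier) = M.twist.symm v := by
  change M.projL (M.twist.symm v) = _
  rw [projL_symm, projL_coe]

theorem toCoinv_twist (m : M.carrier) : M.toCoinv (M.twist m) = M.coinvTwist (M.toCoinv m) :=
  Subtype.ext (by rw [coe_coinvTwist, coe_toCoinv, coe_toCoinv, projL_twist])

theorem toCoinv_symm (m : M.carrier) :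
    M.toCoinv (M.twist.symm m) = M.coinvTwist.symm (M.toCoinv m) :=
  Subtype.ext (by rw [coe_coinvTwist_symm, coe_toCoinv, coe_toCoinv, projL_symm])

/-- `v ◁ h = P_L(vα(h))`. -/
def coinvAct : M.Coinv →ₗ[k] H.carrier →ₗ[k] M.Coinv :=
  ((M.ract.compr₂ M.toCoinv).compl₂ H.twist.toLinearMap) ∘ₗ Submodule.subtype _

theorem coinvAct_apply (v : M.Coinv) (h : H.carrier) :
    M.coinvAct v h = M.toCoinv (M.ract v (H.twist h)) := rfl

/-- The right coaction of the coinvariants, `v ↦ v₍₀₎ ⊗ α⁻¹(v₍₁₎)`. -/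
def coinvCoact : M.Coinv →ₗ[k] M.Coinv ⊗[k] H.carrier :=
  TensorProduct.map M.toCoinv H.twist.symm.toLinearMap ∘ₗ M.rcoact ∘ₗ Submodule.subtype _

theorem coinvCoact_apply (v : M.Coinv) : M.coinvCoact v =
    sw (M.rcoact v) fun x a => M.toCoinv x ⊗ₜ[k] H.twist.symm a := map_eq_sw _ _ _

theorem sw_coinvCoact {X : Type u} [AddCommGroup X] [Module k X] {F : M.Coinv → H.carrier → X}
    (h₁ : ∀ b, IsLinearMap k (fun a => F a b)) (h₂ : ∀ a, IsLinearMap k (fun b => F a b))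
    (v : M.Coinv) :
    sw (M.coinvCoact v) F = sw (M.rcoact v) fun x a => F (M.toCoinv x) (H.twist.symm a) := by
  rw [coinvCoact_apply, sw_sw h₁ h₂]
  simp (disch := fun_prop) only [sw_tmul]

theorem sw_rcoact_coe {X : Type u} [AddCommGroup X] [Module k X] {F : M.carrier → H.carrier → X}
    (h₁ : ∀ b, IsLinearMap k (fun a => F a b)) (h₂ : ∀ a, IsLinearMap k (fun b => F a b))
    (v : M.Coinv) : sw (M.rcoact v) (fun x a => F (M.projL x) a) = sw (M.rcoact v) F := by
  rw [← projL_coe, sw_rcoact_projL _ h₁ h₂]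

/-- The twists in `coinvAct` and `coinvCoact` are forced by `F`. In `H ⊗ V` one has `(1 ⊗ v)h =
α(h₁) ⊗ v ◁ h₂`, which `P_L` sends to `1 ⊗ v ◁ α⁻¹(h)`, and `σ(1 ⊗ v) = (1 ⊗ v₍₀₎) ⊗ α(v₍₁₎)`. -/
theorem coinv_isRightModule : IsRightModule H M.coinvTwist M.coinvAct where
  twist_act v h := by
    rw [coinvAct_apply, coinvAct_apply, ← toCoinv_twist, twist_ract, coe_coinvTwist]
  act_act v g h := by
    rw [coinvAct_apply, coinvAct_apply, coinvAct_apply, coe_toCoinv, toCoinv_ract_projL,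
      coe_coinvTwist, H.twist_mul, M.isBicovariant.right_module.act_act]
  act_one v := by
    rw [coinvAct_apply, H.twist_one, ract_one, toCoinv_twist, toCoinv_coe]

theorem coinv_isRightComodule : IsRightComodule H M.coinvTwist M.coinvCoact where
  coact_twist v := by
    rw [map_eq_sw, sw_coinvCoact _ (by fun_prop) (by fun_prop), coinvCoact_apply, coe_coinvTwist,
      M.isBicovariant.right_comodule.sw_twist (by fun_prop) (by fun_prop)]
    simp only [toCoinv_twist, LinearEquiv.coe_coe, LinearEquiv.symm_apply_apply,
      LinearEquiv.apply_symm_apply]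
  coassoc v := by
    rw [map_eq_sw, map_eq_sw, assoc_eq_sw, sw_coinvCoact _ (by fun_prop) (by fun_prop)]
    simp (disch := fun_prop) only [sw_sw, sw_tmul, sw_coinvCoact, coe_toCoinv, LinearEquiv.coe_coe]
    -- The left legs of `σ(v)` are already coinvariant, so the inner projection can be dropped;
    -- afterwards coassociativity of `σ` on `M` applies.
    rw [M.sw_rcoact_coe (F := fun x a => sw (M.rcoact x) fun x b =>
      M.toCoinv x ⊗ₜ[k] (H.twist.symm b ⊗ₜ[k] H.twist.symm (H.twist.symm a))) (by fun_prop) (by fun_prop),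
      M.isBicovariant.right_comodule.sw_coassoc
        (F := fun x b a => M.toCoinv x ⊗ₜ[k] (H.twist.symm b ⊗ₜ[k]
          H.twist.symm (H.twist.symm a)))
        (by fun_prop) (by fun_prop) (by fun_prop)]
    simp only [LinearEquiv.symm_apply_apply, ← sw_tmul_left, toCoinv_symm]
    congr! 3 with x a
    rw [comul_symm, map_eq_sw]
    rfl
  counit v := by
    rw [map_eq_sw, rid_eq_sw, sw_coinvCoact _ (by fun_prop) (by fun_prop)]
    simp (disch := fun_prop) only [sw_sw, sw_tmul, LinearMap.id_apply, counit_symm]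
    rw [M.isBicovariant.right_comodule.sw_counit (by fun_prop), toCoinv_symm, toCoinv_coe]

/-- Both sides compute `P_L(x) ⊗ α⁻¹(a)` summed over `σ(vh) = x ⊗ a`. Compatibility of `σ` with the
right action gives one of them; expanding `vh = α(h₁)μ⁻¹(P_L(vα(h₂)))` and using its compatibility
with the left action gives the other. -/
theorem coinv_yetterDrinfeld : YetterDrinfeldCondition H M.coinvAct M.coinvCoact := by
  intro v h
  have e₁ : M.ract v h = sw (H.comul h) fun a b =>
      M.lact (H.twist a) (M.twist.symm (M.projL (M.ract v (H.twist b)))) := by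
    rw [← projL_coe, ract_projL]
    simp only [← projL_symm, ract_symm, LinearEquiv.symm_apply_apply]
  have e₂ := congrArg (fun T => sw (M.rcoact T) fun x a => M.toCoinv x ⊗ₜ[k] H.twist.symm a) e₁
  simp only [map_sw] at e₂
  simp (disch := fun_prop) only [sw_sw, sw_rcoact_ract, sw_comul_twist, sw_rcoact_lact,
    M.isBicovariant.right_comodule.sw_symm, toCoinv_lact, LinearEquiv.apply_symm_apply,
    ← TensorProduct.smul_tmul', ← smul_sw, H.counit_twist] at e₂
  -- `P_L` has turned the left factor into `ε`, so the iterated comultiplication of `h` shrinks back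
  -- to `h₁ ⊗ h₂`.
  have e₃ : ∀ a c, sw (H.comul a) (fun a b => H.counit a •
      sw (M.rcoact (M.projL (M.ract v (H.twist c)))) fun x d =>
        M.toCoinv x ⊗ₜ[k] H.twist.symm (H.mul (H.twist b) (H.twist.symm d))) =
      sw (M.rcoact (M.projL (M.ract v (H.twist c)))) fun x d =>
        M.toCoinv x ⊗ₜ[k] H.twist.symm (H.mul a (H.twist.symm d)) := by
    intro a c
    rw [sw_comul_counit_left (F := fun b => sw (M.rcoact (M.projL (M.ract v (H.twist c))))
      fun x d => M.toCoinv x ⊗ₜ[k] H.twist.symm (H.mul (H.twist b) (H.twist.symm d)))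
      (by fun_prop)]
    simp only [LinearEquiv.apply_symm_apply]
  simp only [e₃] at e₂
  rw [map₂_eq_sw, map_eq_sw, map_eq_sw, map_eq_sw, leftComm_eq_sw]
  simp (disch := fun_prop) only [sw_sw, sw_tmul, sw_coinvCoact, LinearMap.comp_apply,
    LinearMap.id_apply, LinearEquiv.coe_coe, TensorProduct.lift.tmul, coinvAct_apply, coe_toCoinv]
  rw [← e₂, ← M.sw_rcoact_coe (by fun_prop) (by fun_prop)]
  simp only [toCoinv_ract_projL, mul_symm, LinearEquiv.apply_symm_apply]

/-- The Yetter-Drinfel'd Hom-module of left coinvariants. -/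
def coinv : YetterDrinfeldModule H where
  carrier := M.Coinv
  twist := M.coinvTwist
  act := M.coinvAct
  coact := M.coinvCoact
  isYetterDrinfeld :=
    ⟨M.coinv_isRightModule, M.coinv_isRightComodule, M.coinv_yetterDrinfeld⟩

end BicovariantBimodule
end HomHopf
-- Free bicovariant bimodules and the fundamental theorem
namespace HomHopf

theorem tmul_induction {k A B X : Type*} [CommRing k] [AddCommGroup A] [Module k A]
    [AddCommGroup B] [Module k B] [AddCommGroup X] [Module k X] {f g : A ⊗[k] B → X}
    (hf : IsLinearMap k f) (hg : IsLinearMap k g) (h : ∀ a b, f (a ⊗ₜ[k] b) = g (a ⊗ₜ[k] b))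
    (x : A ⊗[k] B) : f x = g x :=
  LinearMap.congr_fun (f := hf.mk') (g := hg.mk') (TensorProduct.ext' h) x

section Free

variable {k : Type u} [CommRing k] {H : MonoidalHomHopfAlgebra k}
variable (V W : YetterDrinfeldModule H)

/-- `g, v ↦ g ⊗ v` with values in the free bicovariant Hom-bimodule. -/
def fmk : H.carrier →ₗ[k] V.carrier →ₗ[k] (freeObj H V).carrier :=
  TensorProduct.mk k H.carrier V.carrier

/-- The linear map on the free bicovariant Hom-bimodule given by a bilinear map. -/
def flift {X : Type u} [AddCommGroup X] [Module k X] (f : H.carrier →ₗ[k] V.carrier →ₗ[k] X) :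
    (freeObj H V).carrier →ₗ[k] X := TensorProduct.lift f

@[simp] theorem flift_fmk {X : Type u} [AddCommGroup X] [Module k X]
    (f : H.carrier →ₗ[k] V.carrier →ₗ[k] X) (g : H.carrier) (v : V.carrier) :
    flift V f (fmk V g v) = f g v := rfl

-- `fmk` and `flift` keep elements and maps typed over the carrier of `freeObj`, so that its module
-- structure is the one that appears syntactically; this lemma reduces linear identities over that
-- carrier to the elements `fmk V g v`.
variable {V W} in
theorem free_induction {X : Type u} [AddCommGroup X] [Module k X]
    {f f' : (freeObj H V).carrier → X} (hf : IsLinearMap k f) (hf' : IsLinearMap k f')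
    (h : ∀ g v, f (fmk V g v) = f' (fmk V g v)) (x : (freeObj H V).carrier) : f x = f' x :=
  tmul_induction (f := f) (g := f') hf hf' h x

variable {V W} in
theorem free_hom_ext {M : BicovariantBimodule H} {f f' : freeObj H V ⟶ M}
    (h : ∀ g v, BicovariantBimodule.Hom.toLin f (fmk V g v) =
      BicovariantBimodule.Hom.toLin f' (fmk V g v)) : f = f' :=
  BicovariantBimodule.hom_ext (TensorProduct.ext' h)

@[simp] theorem fmk_twist (g : H.carrier) (v : V.carrier) :
    (freeObj H V).twist (fmk V g v) = fmk V (H.twist g) (V.twist v) := rfl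

@[simp] theorem fmk_symm (g : H.carrier) (v : V.carrier) :
    (freeObj H V).twist.symm (fmk V g v) = fmk V (H.twist.symm g) (V.twist.symm v) := rfl

@[simp] theorem fmk_lact (h g : H.carrier) (v : V.carrier) :
    (freeObj H V).lact h (fmk V g v) = fmk V (H.mul (H.twist.symm h) g) (V.twist v) := rfl

theorem fmk_ract (g : H.carrier) (v : V.carrier) (h : H.carrier) :
    (freeObj H V).ract (fmk V g v) h =
      sw (H.comul h) fun a b => fmk V (H.mul g a) (V.act v b) := map_eq_sw _ _ _

theorem fmk_lcoact (g : H.carrier) (v : V.carrier) :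
    (freeObj H V).lcoact (fmk V g v) =
      sw (H.comul g) fun a b => H.twist a ⊗ₜ[k] fmk V b (V.twist.symm v) := by
  refine (freeLcoact_tmul _ _ _ _).trans ?_
  rw [assoc_eq_sw, map_eq_sw]
  simp (disch := fun_prop) only [sw_sw, sw_tmul, LinearEquiv.coe_coe, LinearMap.id_apply]
  rfl

theorem fmk_rcoact (g : H.carrier) (v : V.carrier) :
    (freeObj H V).rcoact (fmk V g v) = sw (H.comul g) fun a b => sw (V.coact v) fun x c =>
      fmk V a x ⊗ₜ[k] H.mul b c := (codiagCoact_tmul _ _ _ _ _).trans (map₂_eq_sw _ _ _ _)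

section
variable {X : Type u} [AddCommGroup X] [Module k X]

theorem sw_fmk_lcoact {F : H.carrier → (freeObj H V).carrier → X}
    (h₁ : ∀ b, IsLinearMap k (fun a => F a b)) (h₂ : ∀ a, IsLinearMap k (fun b => F a b))
    (g : H.carrier) (v : V.carrier) :
    sw ((freeObj H V).lcoact (fmk V g v)) F =
      sw (H.comul g) fun a b => F (H.twist a) (fmk V b (V.twist.symm v)) := by
  rw [fmk_lcoact]
  simp (disch := fun_prop) only [sw_sw, sw_tmul]

theorem sw_fmk_rcoact {F : (freeObj H V).carrier → H.carrier → X}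
    (h₁ : ∀ b, IsLinearMap k (fun a => F a b)) (h₂ : ∀ a, IsLinearMap k (fun b => F a b))
    (g : H.carrier) (v : V.carrier) :
    sw ((freeObj H V).rcoact (fmk V g v)) F = sw (H.comul g) fun a b => sw (V.coact v) fun x c =>
      F (fmk V a x) (H.mul b c) := by
  rw [fmk_rcoact]
  simp (disch := fun_prop) only [sw_sw, sw_tmul]

end

/-- `P_L(g ⊗ v) = ε(g)1 ⊗ v`. -/
theorem projL_fmk (g : H.carrier) (v : V.carrier) :
    (freeObj H V).projL (fmk V g v) = H.counit g • fmk V H.one v := by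
  rw [BicovariantBimodule.projL_eq_sw, sw_fmk_lcoact _ (by fun_prop) (by fun_prop),
    ← sw_antipode_mul (F := fun a => fmk V a v) (by fun_prop)]
  simp only [fmk_lact, antipode_symm, LinearEquiv.symm_apply_apply, LinearEquiv.apply_symm_apply]

end Free

namespace BicovariantBimodule

variable {k : Type u} [CommRing k] {H : MonoidalHomHopfAlgebra k} (M : BicovariantBimodule H)
variable {X : Type u} [AddCommGroup X] [Module k X]

/-- The inclusion of the coinvariants. -/
def incl : M.coinv.carrier →ₗ[k] M.carrier := Submodule.subtype _

/-- The projection to the coinvariants. -/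
def proj : M.carrier →ₗ[k] M.coinv.carrier := M.toCoinv

theorem incl_proj (m : M.carrier) : M.incl (M.proj m) = M.projL m := rfl

theorem projL_incl (v : M.coinv.carrier) : M.projL (M.incl v) = M.incl v := M.projL_coe v

theorem incl_injective : Function.Injective M.incl := Subtype.val_injective

theorem incl_twist (v : M.coinv.carrier) : M.incl (M.coinv.twist v) = M.twist (M.incl v) :=
  M.coe_coinvTwist v

theorem incl_symm (v : M.coinv.carrier) :
    M.incl (M.coinv.twist.symm v) = M.twist.symm (M.incl v) :=
  M.coe_coinvTwist_symm v

theorem incl_act (v : M.coinv.carrier) (h : H.carrier) :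
    M.incl (M.coinv.act v h) = M.projL (M.ract (M.incl v) (H.twist h)) := rfl

theorem lcoact_incl (v : M.coinv.carrier) :
    M.lcoact (M.incl v) = H.one ⊗ₜ[k] M.twist.symm (M.incl v) := by
  rw [← projL_incl, lcoact_projL]

/-- The coaction on coinvariants, pushed into `M`, is the coaction of `M` up to `α⁻¹`: the
projection in its definition acts trivially on these legs. -/
theorem sw_coact_incl {F : M.carrier → H.carrier → X} (h₁ : ∀ b, IsLinearMap k (fun a => F a b))
    (h₂ : ∀ a, IsLinearMap k (fun b => F a b)) (v : M.coinv.carrier) :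
    sw (M.coinv.coact v) (fun x a => F (M.incl x) a) =
      sw (M.rcoact (M.incl v)) fun x a => F x (H.twist.symm a) := by
  have h₁' : ∀ b, IsLinearMap k (fun x => F (M.incl x) b) := by fun_prop
  exact (M.sw_coinvCoact h₁' (fun x => h₂ (M.incl x)) v).trans
    (M.sw_rcoact_coe (F := fun x a => F x (H.twist.symm a)) (by fun_prop) (by fun_prop) v)

/-- `g ⊗ v ↦ gμ⁻¹(v)`. -/
def freeCoinvLin : (freeObj H M.coinv).carrier →ₗ[k] M.carrier :=
  flift _ (M.lact.compl₂ (M.twist.symm.toLinearMap ∘ₗ M.incl))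

theorem freeCoinvLin_fmk (g : H.carrier) (v : M.coinv.carrier) :
    M.freeCoinvLin (fmk _ g v) = M.lact g (M.twist.symm (M.incl v)) := rfl

theorem ract_incl (v : M.coinv.carrier) (h : H.carrier) :
    M.ract (M.incl v) h = sw (H.comul h) fun a b =>
      M.lact (H.twist a) (M.twist.symm (M.incl (M.coinv.act v b))) := by
  rw [← projL_incl, ract_projL]
  simp only [incl_act, projL_incl, ← projL_symm, ract_symm, LinearEquiv.symm_apply_apply]

/-- The morphism `H ⊗ V ⟶ M`, `g ⊗ v ↦ gμ⁻¹(v)`, for the coinvariants `V` of `M`. -/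
def freeCoinvHom : freeObj H M.coinv ⟶ M where
  toLin := M.freeCoinvLin
  map_twist := free_induction (by fun_prop) (by fun_prop) fun g v => by
    simp only [fmk_twist, freeCoinvLin_fmk, twist_lact, LinearEquiv.apply_symm_apply, incl_twist,
      LinearEquiv.symm_apply_apply]
  map_lact h := free_induction (by fun_prop) (by fun_prop) fun g v => by
    simp only [fmk_lact, freeCoinvLin_fmk, mul_lact, LinearEquiv.apply_symm_apply, incl_twist,
      LinearEquiv.symm_apply_apply]
  map_ract x h := free_induction (f := fun x => M.freeCoinvLin ((freeObj H M.coinv).ract x h))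
    (f' := fun x => M.ract (M.freeCoinvLin x) h) (by fun_prop) (by fun_prop) (fun g v => by
      -- Both sides become the sum of `α(g)(h₁μ⁻²(v ◁ h₂))`; on the side of `M` this comes from
      -- moving `h` past the coinvariant by `ract_incl`.
      simp only [fmk_ract, map_sw, freeCoinvLin_fmk, ract_lact, ← incl_symm, ract_incl,
        mul_lact]
      rw [sw_comul_symm (by fun_prop) (by fun_prop)]
      simp only [symm_bilin M.coinv.isYetterDrinfeld.right_module.twist_act,
        LinearEquiv.apply_symm_apply]) x
  map_lcoact := free_induction (by fun_prop) (by fun_prop) fun g v => by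
    simp (disch := fun_prop) only [fmk_lcoact, map_sw, map_tmul, freeCoinvLin_fmk,
      M.isBicovariant.lcoact_lact, map₂_eq_sw, ← incl_symm, lcoact_incl, sw_tmul, H.mul_one,
      LinearMap.id_apply]
  map_rcoact := free_induction (by fun_prop) (by fun_prop) fun g v => by
    simp only [fmk_rcoact, map_sw, map_tmul, freeCoinvLin_fmk, M.isBicovariant.rcoact_lact,
      map₂_eq_sw, LinearMap.id_apply]
    congr! 3 with a b
    -- With the legs of `Δ(g)` matched, it remains to compare the coactions of `v` as an element of
    -- `V` and of `M`.
    rw [M.isBicovariant.right_comodule.sw_symm (by fun_prop) (by fun_prop)]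
    exact (M.sw_coact_incl (F := fun x c => M.lact a (M.twist.symm x) ⊗ₜ[k] H.mul b c)
      (by fun_prop) (by fun_prop) v).symm

@[simp] theorem freeCoinvHom_fmk (g : H.carrier) (v : M.coinv.carrier) :
    Hom.toLin M.freeCoinvHom (fmk _ g v) = M.lact g (M.twist.symm (M.incl v)) := rfl

/-- `m ↦ m₍₋₁₎ ⊗ P_L(μ(m₍₀₎))`. -/
def freeCoinvInv : M.carrier →ₗ[k] (freeObj H M.coinv).carrier :=
  TensorProduct.lift ((fmk M.coinv).compl₂ (M.proj ∘ₗ M.twist.toLinearMap)) ∘ₗ M.lcoact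

theorem freeCoinvInv_apply (m : M.carrier) :
    M.freeCoinvInv m = sw (M.lcoact m) fun a x => fmk M.coinv a (M.proj (M.twist x)) :=
  lift_eq_sw _ _

/-- The fundamental theorem: `M` is free on its coinvariants. -/
def freeCoinvIso : freeObj H M.coinv ≅ M :=
  isoOfInv M.freeCoinvHom M.freeCoinvInv
    (free_induction (f := fun x => M.freeCoinvInv (Hom.toLin M.freeCoinvHom x)) (by fun_prop)
      (by fun_prop) fun g v => by
        have e : M.lcoact (M.twist.symm (M.incl v)) =
            H.one ⊗ₜ[k] M.twist.symm (M.twist.symm (M.incl v)) := by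
          rw [← incl_symm, lcoact_incl]
        -- The element `v` is coinvariant, so `gμ⁻¹(v)` has second coaction leg `g₂μ⁻²(v)`, and
        -- `P_L` turns `g₂` into `ε(g₂)`.
        have e' : ∀ a b, fmk M.coinv (H.twist a) (M.proj (M.twist (M.lact b
            (M.twist.symm (M.twist.symm (M.incl v)))))) = H.counit b • fmk M.coinv (H.twist a) v := by
          intro a b
          rw [← map_smul]
          congr 1
          apply M.incl_injective
          rw [map_smul, incl_proj, twist_lact, projL_lact, H.counit_twist,
            LinearEquiv.apply_symm_apply, projL_symm, projL_incl, LinearEquiv.apply_symm_apply]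
        rw [freeCoinvHom_fmk, freeCoinvInv_apply, sw_lcoact_lact _ (by fun_prop) (by fun_prop), e]
        simp (disch := fun_prop) only [sw_tmul, H.mul_one, e']
        rw [sw_comul_counit_right (F := fun a => fmk M.coinv (H.twist a) v) (by fun_prop),
          LinearEquiv.apply_symm_apply])
    (fun m => by
      -- This composite sends `m` to `m₍₋₁₎P_L(m₍₀₎)`, the twists `μ` and `μ⁻¹` cancelling.
      rw [freeCoinvInv_apply, map_sw]
      simp only [freeCoinvHom_fmk, incl_proj, projL_twist, LinearEquiv.symm_apply_apply]
      exact M.sw_lact_projL m)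

variable {M} in
theorem map_projL {N : BicovariantBimodule H} (f : M ⟶ N) (m : M.carrier) :
    Hom.toLin f (M.projL m) = N.projL (Hom.toLin f m) := by
  rw [projL_eq_sw, projL_eq_sw, f.map_lcoact, map_sw, map_eq_sw, sw_sw (by fun_prop) (by fun_prop)]
  simp (disch := fun_prop) only [sw_tmul, f.map_lact, LinearMap.id_apply]

variable {M} in
theorem map_projR {N : BicovariantBimodule H} (f : M ⟶ N) (m : M.carrier) :
    Hom.toLin f (M.projR m) = N.projR (Hom.toLin f m) := by
  rw [projR_eq_sw, projR_eq_sw, f.map_rcoact, map_sw, map_eq_sw, sw_sw (by fun_prop) (by fun_prop)]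
  simp (disch := fun_prop) only [sw_tmul, f.map_ract, LinearMap.id_apply]

end BicovariantBimodule

/-! ### Full faithfulness and essential surjectivity of `V ↦ H ⊗ V` -/

section Equivalence

variable {k : Type u} [CommRing k] {H : MonoidalHomHopfAlgebra k}
variable {V W : YetterDrinfeldModule H}

/-- `g ⊗ v ↦ ε(g)v`. -/
def fcounit (V : YetterDrinfeldModule H) : (freeObj H V).carrier →ₗ[k] V.carrier :=
  flift V ((LinearMap.lsmul k V.carrier).comp H.counit)

theorem fcounit_fmk (g : H.carrier) (v : V.carrier) :
    fcounit V (fmk V g v) = H.counit g • v := rfl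

theorem fcounit_one (v : V.carrier) : fcounit V (fmk V H.one v) = v := by
  rw [fcounit_fmk, H.counit_one, one_smul]

/-- The coinvariants of `F(V)` are `1 ⊗ V`, and `fcounit` reads off the `V`-component of `P_L`. -/
theorem fmk_one_fcounit (x : (freeObj H V).carrier) :
    fmk V H.one (fcounit V x) = (freeObj H V).projL x :=
  free_induction (f := fun x => fmk V H.one (fcounit V x)) (by fun_prop) (by fun_prop)
    (fun g v => by rw [fcounit_fmk, projL_fmk, map_smul]) x

/-- The linear map `V → W` underlying a morphism of free bicovariant Hom-bimodules. -/
def unfreeLin (f : freeObj H V ⟶ freeObj H W) : V.carrier →ₗ[k] W.carrier :=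
  fcounit W ∘ₗ BicovariantBimodule.Hom.toLin f ∘ₗ fmk V H.one

/-- Morphisms commute with `P_L`, and `1 ⊗ v` is fixed by it. -/
theorem map_fmk_one (f : freeObj H V ⟶ freeObj H W) (v : V.carrier) :
    BicovariantBimodule.Hom.toLin f (fmk V H.one v) = fmk W H.one (unfreeLin f v) := by
  rw [unfreeLin, LinearMap.comp_apply, fmk_one_fcounit, LinearMap.comp_apply,
    ← BicovariantBimodule.map_projL, projL_fmk, H.counit_one, one_smul]

theorem unfreeLin_twist (f : freeObj H V ⟶ freeObj H W) (v : V.carrier) :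
    unfreeLin f (V.twist v) = W.twist (unfreeLin f v) := by
  have e := f.map_twist (fmk V H.one v)
  rw [fmk_twist, H.twist_one] at e
  have e' := (map_fmk_one f (V.twist v)).symm.trans (e.trans (congrArg _ (map_fmk_one f v)))
  rw [fmk_twist, H.twist_one] at e'
  simpa only [fcounit_one] using congrArg (fcounit W) e'

/-- Since `g ⊗ v = g(1 ⊗ ν⁻¹(v))`, left linearity reduces the claim to the coinvariants. This is
fullness at the level of linear maps. -/
theorem map_fmk (f : freeObj H V ⟶ freeObj H W) (g : H.carrier) (v : V.carrier) :
    BicovariantBimodule.Hom.toLin f (fmk V g v) = fmk W g (unfreeLin f v) := by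
  have e := f.map_lact g (fmk V H.one (V.twist.symm v))
  rw [fmk_lact, H.mul_one, LinearEquiv.apply_symm_apply, LinearEquiv.apply_symm_apply] at e
  refine e.trans ((congrArg _ (map_fmk_one f _)).trans ?_)
  rw [fmk_lact, H.mul_one, LinearEquiv.apply_symm_apply, ← unfreeLin_twist,
    LinearEquiv.apply_symm_apply]

theorem fcounit_map (f : freeObj H V ⟶ freeObj H W) (x : (freeObj H V).carrier) :
    fcounit W (BicovariantBimodule.Hom.toLin f x) = unfreeLin f (fcounit V x) :=
  free_induction (f := fun x => fcounit W (BicovariantBimodule.Hom.toLin f x))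
    (f' := fun x => unfreeLin f (fcounit V x)) (by fun_prop) (by fun_prop)
    (fun g v => by rw [map_fmk, fcounit_fmk, fcounit_fmk, map_smul]) x

/-- Together with `sw_rcoact_fcounit` this recovers the structure of `V` from that of `F(V)`, so the
linear map obtained from a morphism of free bimodules inherits linearity and colinearity. -/
theorem fcounit_ract (v : V.carrier) (h : H.carrier) :
    fcounit V ((freeObj H V).ract (fmk V H.one v) (H.twist h)) = V.act v h := by
  rw [fmk_ract, map_sw]
  simp only [fcounit_fmk, H.one_mul, H.counit_twist]
  rw [sw_comul_counit_left (by fun_prop), LinearEquiv.symm_apply_apply]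

theorem sw_rcoact_fcounit (v : V.carrier) :
    sw ((freeObj H V).rcoact (fmk V H.one v)) (fun x a => fcounit V x ⊗ₜ[k] H.twist.symm a) =
      V.coact v := by
  rw [sw_fmk_rcoact _ (by fun_prop) (by fun_prop), sw_comul_one (by fun_prop) (by fun_prop)]
  simp only [fcounit_one, H.one_mul, LinearEquiv.symm_apply_apply, sw_mk]

/-- The morphism `V ⟶ W` underlying a morphism of free bicovariant Hom-bimodules. -/
def unfree (f : freeObj H V ⟶ freeObj H W) : V ⟶ W where
  toLin := unfreeLin f
  map_twist := unfreeLin_twist f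
  map_act v h := by
    rw [← fcounit_ract, ← fcounit_map, f.map_ract, map_fmk, fcounit_ract]
  map_coact v := by
    rw [← sw_rcoact_fcounit, ← map_fmk, f.map_rcoact, map_eq_sw,
      sw_sw (by fun_prop) (by fun_prop), ← sw_rcoact_fcounit, map_sw]
    simp (disch := fun_prop) only [sw_tmul, fcounit_map, map_tmul, LinearMap.id_apply]

instance : (freeFunctor H).Faithful where
  map_injective {V W f g} h := by
    ext v
    have e : fcounit W (fmk W H.one (YetterDrinfeldModule.Hom.toLin f v)) =
        fcounit W (fmk W H.one (YetterDrinfeldModule.Hom.toLin g v)) :=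
      congrArg (fun f => fcounit W (BicovariantBimodule.Hom.toLin f (fmk V H.one v))) h
    simpa only [fcounit_one] using e

instance : (freeFunctor H).Full where
  map_surjective f := ⟨unfree f, free_hom_ext fun g v => (map_fmk f g v).symm⟩

instance : (freeFunctor H).EssSurj where
  mem_essImage M := ⟨M.coinv, ⟨M.freeCoinvIso⟩⟩

instance : (freeFunctor H).IsEquivalence where

end Equivalence
end HomHopf
-- The prebraiding of Yetter-Drinfel'd modules
namespace HomHopf

/-- The bilinear map bundling a function linear in each of two variables. -/
def bilin {k A B X : Type*} [CommRing k] [AddCommGroup A] [Module k A]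
    [AddCommGroup B] [Module k B] [AddCommGroup X] [Module k X] (F : A → B → X)
    (h : ∀ b, IsLinearMap k (fun a => F a b)) (h' : ∀ a, IsLinearMap k (fun b => F a b)) :
    A →ₗ[k] B →ₗ[k] X :=
  LinearMap.mk₂ k F (fun a a' b => (h b).map_add a a') (fun c a b => (h b).map_smul c a)
    (fun a => (h' a).map_add) (fun c a => (h' a).map_smul c)

namespace YetterDrinfeldModule

variable {k : Type u} [CommRing k] {H : MonoidalHomHopfAlgebra k}
variable (M N P : YetterDrinfeldModule H) {X : Type u} [AddCommGroup X] [Module k X]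

theorem twist_act (m : M.carrier) (h : H.carrier) :
    M.twist (M.act m h) = M.act (M.twist m) (H.twist h) :=
  M.isYetterDrinfeld.right_module.twist_act m h

theorem act_symm (m : M.carrier) (h : H.carrier) :
    M.twist.symm (M.act m h) = M.act (M.twist.symm m) (H.twist.symm h) :=
  symm_bilin M.twist_act m h

theorem act_act (m : M.carrier) (g h : H.carrier) :
    M.act (M.act m g) h = M.act (M.twist m) (H.mul g (H.twist.symm h)) := by
  rw [M.isYetterDrinfeld.right_module.act_act, LinearEquiv.apply_symm_apply]

theorem act_one (m : M.carrier) : M.act m H.one = M.twist m :=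
  M.isYetterDrinfeld.right_module.act_one m

/-- The Yetter-Drinfel'd condition. -/
theorem sw_yetterDrinfeld {F : M.carrier → H.carrier → X}
    (h₁ : ∀ b, IsLinearMap k (fun a => F a b)) (h₂ : ∀ a, IsLinearMap k (fun b => F a b))
    (m : M.carrier) (h : H.carrier) :
    sw (M.coact m) (fun x a => sw (H.comul h) fun b c =>
      F (M.act x (H.twist.symm b)) (H.mul a (H.twist.symm c))) =
    sw (H.comul h) fun b c => sw (M.coact (M.act m c)) fun x a =>
      F x (H.twist.symm (H.mul b a)) := by
  have e := congrArg (fun T => sw T F) (M.isYetterDrinfeld.yetterDrinfeld m h)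
  simp only [map₂_eq_sw, map_eq_sw, leftComm_eq_sw] at e
  simpa (disch := fun_prop) only [sw_sw, sw_tmul, LinearMap.comp_apply, LinearMap.id_apply,
    LinearEquiv.coe_coe, TensorProduct.lift.tmul] using e

/-- `m, n ↦ m ⊗ n` with values in the tensor product of Yetter-Drinfel'd Hom-modules. -/
def ymk : M.carrier →ₗ[k] N.carrier →ₗ[k] (tensor M N).carrier :=
  TensorProduct.mk k M.carrier N.carrier

/-- The linear map on the tensor product given by a bilinear map. -/
def ylift (f : M.carrier →ₗ[k] N.carrier →ₗ[k] X) : (tensor M N).carrier →ₗ[k] X :=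
  TensorProduct.lift f

@[simp] theorem ylift_ymk (f : M.carrier →ₗ[k] N.carrier →ₗ[k] X) (m : M.carrier)
    (n : N.carrier) : ylift M N f (ymk M N m n) = f m n := rfl

variable {M N P} in
theorem tensor_induction {f f' : (tensor M N).carrier → X} (hf : IsLinearMap k f)
    (hf' : IsLinearMap k f') (h : ∀ m n, f (ymk M N m n) = f' (ymk M N m n))
    (x : (tensor M N).carrier) : f x = f' x :=
  tmul_induction (f := f) (g := f') hf hf' h x

@[simp] theorem ymk_twist (m : M.carrier) (n : N.carrier) :
    (tensor M N).twist (ymk M N m n) = ymk M N (M.twist m) (N.twist n) := rfl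

@[simp] theorem ymk_symm (m : M.carrier) (n : N.carrier) :
    (tensor M N).twist.symm (ymk M N m n) = ymk M N (M.twist.symm m) (N.twist.symm n) := rfl

theorem ymk_act (m : M.carrier) (n : N.carrier) (h : H.carrier) :
    (tensor M N).act (ymk M N m n) h =
      sw (H.comul h) fun a b => ymk M N (M.act m a) (N.act n b) := map_eq_sw _ _ _

theorem ymk_coact (m : M.carrier) (n : N.carrier) :
    (tensor M N).coact (ymk M N m n) = sw (M.coact m) fun x a => sw (N.coact n) fun y b =>
      ymk M N x y ⊗ₜ[k] H.mul a b :=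
  (codiagCoact_tmul _ _ _ _ _).trans (map₂_eq_sw _ _ _ _)

theorem sw_ymk_coact {F : (tensor M N).carrier → H.carrier → X}
    (h₁ : ∀ b, IsLinearMap k (fun a => F a b)) (h₂ : ∀ a, IsLinearMap k (fun b => F a b))
    (m : M.carrier) (n : N.carrier) :
    sw ((tensor M N).coact (ymk M N m n)) F = sw (M.coact m) fun x a => sw (N.coact n) fun y b =>
      F (ymk M N x y) (H.mul a b) := by
  rw [ymk_coact]
  simp (disch := fun_prop) only [sw_sw, sw_tmul]

@[simp] theorem assocIso_hom_ymk (m : M.carrier) (n : N.carrier) (p : P.carrier) :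
    Hom.toLin (assocIso M N P).hom (ymk (tensor M N) P (ymk M N m n) p) =
      ymk M (tensor N P) (M.twist m) (ymk N P n (P.twist.symm p)) := rfl

@[simp] theorem assocIso_inv_ymk (m : M.carrier) (n : N.carrier) (p : P.carrier) :
    Hom.toLin (assocIso M N P).inv (ymk M (tensor N P) m (ymk N P n p)) =
      ymk (tensor M N) P (ymk M N (M.twist.symm m) n) (P.twist p) := rfl

@[simp] theorem tensorMap_ymk {M' N' : YetterDrinfeldModule H} (f : M ⟶ M') (g : N ⟶ N')
    (m : M.carrier) (n : N.carrier) : Hom.toLin (tensorMap f g) (ymk M N m n) =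
      ymk M' N' (Hom.toLin f m) (Hom.toLin g n) := rfl

/-- The linear map `m ⊗ n ↦ ν(n₍₀₎) ⊗ μ⁻¹(m) ◁ n₍₁₎`. -/
noncomputable def braidLin : (tensor M N).carrier →ₗ[k] (tensor N M).carrier :=
  ylift M N (bilin (fun m n => sw (N.coact n) fun y a =>
    ymk N M (N.twist y) (M.act (M.twist.symm m) a)) (by fun_prop) (by fun_prop))

theorem braidLin_ymk (m : M.carrier) (n : N.carrier) :
    braidLin M N (ymk M N m n) = sw (N.coact n) fun y a =>
      ymk N M (N.twist y) (M.act (M.twist.symm m) a) := rfl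

/-- After `m ◁ (ab)` is reassembled, this is the Yetter-Drinfel'd condition of `N` under the linear
map `y ⊗ a ↦ ν(y) ⊗ m ◁ a`. From `M` only the module axioms enter. -/
theorem braidLin_act (x : (tensor M N).carrier) (h : H.carrier) :
    braidLin M N ((tensor M N).act x h) = (tensor N M).act (braidLin M N x) h := by
  refine tensor_induction (f := fun x => braidLin M N ((tensor M N).act x h))
    (f' := fun x => (tensor N M).act (braidLin M N x) h) (by fun_prop) (by fun_prop)
    (fun m n => ?_) x
  have e := N.sw_yetterDrinfeld (F := fun y a => ymk N M (N.twist y) (M.act m a))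
    (by fun_prop) (by fun_prop) n h
  simp only [ymk_act, braidLin_ymk, map_sw, act_symm, act_act, LinearEquiv.apply_symm_apply,
    sw_apply]
  simp only [mul_symm, twist_act, LinearEquiv.apply_symm_apply] at e
  exact e.symm

/-- Here the Yetter-Drinfel'd condition of `M` is needed, while `N` contributes coassociativity. -/
theorem braidLin_coact (x : (tensor M N).carrier) :
    (tensor N M).coact (braidLin M N x) =
      TensorProduct.map (braidLin M N) LinearMap.id ((tensor M N).coact x) := by
  refine tensor_induction (f := fun x => (tensor N M).coact (braidLin M N x))
    (f' := fun x => TensorProduct.map (braidLin M N) LinearMap.id ((tensor M N).coact x))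
    (by fun_prop) (by fun_prop) (fun m n => ?_) x
  simp only [ymk_coact, braidLin_ymk, map_sw, map_tmul, LinearMap.id_apply, sw_tmul_right]
  simp (disch := fun_prop) only [N.isYetterDrinfeld.right_comodule.sw_twist]
  -- Iterated coactions of `n` are rewritten as `n₍₀₎ ⊗ Δ(n₍₁₎)`, so that both sides are sums over
  -- the same tensor.
  rw [N.isYetterDrinfeld.right_comodule.sw_coassoc (F := fun y b a =>
      sw (M.coact (M.act (M.twist.symm m) a)) fun x c =>
        ymk N M (N.twist y) x ⊗ₜ[k] H.mul (H.twist b) c)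
      (by fun_prop) (by fun_prop) (by fun_prop)]
  -- The same normalisation of `n` on the other side.
  have e : ∀ x c, sw (N.coact n) (fun y a => sw (N.coact y) fun y b =>
      ymk N M (N.twist y) (M.act (M.twist.symm x) b) ⊗ₜ[k] H.mul c a) =
      sw (N.coact n) fun y a => sw (H.comul a) fun b d =>
      ymk N M y (M.act (M.twist.symm x) b) ⊗ₜ[k] H.mul c (H.twist d) := by
    intro x c
    rw [N.isYetterDrinfeld.right_comodule.sw_coassoc (F := fun y b a =>
      ymk N M (N.twist y) (M.act (M.twist.symm x) b) ⊗ₜ[k] H.mul c a)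
      (by fun_prop) (by fun_prop) (by fun_prop)]
    simp only [LinearEquiv.apply_symm_apply]
  simp only [e]
  rw [sw_comm]
  congr! 3 with y a
  -- For fixed `y ⊗ a` the identity is the condition for `μ⁻¹(m)` and `α(a)`; the `α` in `F` cancels
  -- the outer `α⁻¹` of the condition.
  have e₂ := M.sw_yetterDrinfeld (F := fun x b => ymk N M y x ⊗ₜ[k] H.twist b)
    (by fun_prop) (by fun_prop) (M.twist.symm m) (H.twist a)
  simp (disch := fun_prop) only [sw_comul_twist, M.isYetterDrinfeld.right_comodule.sw_symm,
    LinearEquiv.symm_apply_apply, LinearEquiv.apply_symm_apply, H.twist_mul] at e₂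
  rw [e₂]
  simp only [LinearEquiv.apply_symm_apply]

/-- The prebraiding `m ⊗ n ↦ ν(n₍₀₎) ⊗ μ⁻¹(m) ◁ n₍₁₎`. -/
noncomputable def braidHom : tensor M N ⟶ tensor N M where
  toLin := braidLin M N
  map_twist := tensor_induction (by fun_prop) (by fun_prop) fun m n => by
    rw [ymk_twist, braidLin_ymk, braidLin_ymk, equiv_sw,
      N.isYetterDrinfeld.right_comodule.sw_twist (by fun_prop) (by fun_prop)]
    simp only [ymk_twist, twist_act, LinearEquiv.apply_symm_apply, LinearEquiv.symm_apply_apply]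
  map_act := braidLin_act M N
  map_coact := braidLin_coact M N

@[simp] theorem braidHom_ymk (m : M.carrier) (n : N.carrier) :
    Hom.toLin (braidHom M N) (ymk M N m n) = sw (N.coact n) fun y a =>
      ymk N M (N.twist y) (M.act (M.twist.symm m) a) := rfl

theorem braidHom_ymk_eq (m : M.carrier) (n : N.carrier) :
    Hom.toLin (braidHom M N) (m ⊗ₜ[k] n) = M.braidElem N m n :=
  (map_eq_sw _ _ _).symm

variable {M N P}

theorem ymk_hom_ext {f g : tensor M N ⟶ P}
    (h : ∀ m n, Hom.toLin f (ymk M N m n) = Hom.toLin g (ymk M N m n)) : f = g :=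
  tensor_hom_ext h

theorem ymk_hom_ext_left {Q : YetterDrinfeldModule H} {f g : tensor (tensor M N) P ⟶ Q}
    (h : ∀ m n p, Hom.toLin f (ymk _ P (ymk M N m n) p) =
      Hom.toLin g (ymk _ P (ymk M N m n) p)) : f = g :=
  tensor_hom_ext₃ h

theorem ymk_hom_ext_right {Q : YetterDrinfeldModule H} {f g : tensor M (tensor N P) ⟶ Q}
    (h : ∀ m n p, Hom.toLin f (ymk M _ m (ymk N P n p)) =
      Hom.toLin g (ymk M _ m (ymk N P n p))) : f = g :=
  hom_ext (TensorProduct.ext (LinearMap.ext fun m => TensorProduct.ext' fun n p => h m n p))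

open scoped MonoidalCategory

theorem braidHom_naturality {M' N' : YetterDrinfeldModule H} (f : M ⟶ M') (g : N ⟶ N') :
    tensorMap f g ≫ braidHom M' N' = braidHom M N ≫ tensorMap g f := by
  apply ymk_hom_ext
  intro m n
  simp only [comp_toLin, LinearMap.comp_apply, tensorMap_ymk, braidHom_ymk, map_sw, g.map_coact,
    f.map_act, map_twist_symm, map_eq_sw]
  simp (disch := fun_prop) only [sw_sw, sw_tmul, g.map_twist, LinearMap.id_apply]

/-- The coaction of `N ⊗ P` multiplies `n₍₁₎p₍₁₎`, so this hexagon is associativity of the action on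
`M`. -/
theorem braidHom_forward (M N P : YetterDrinfeldModule H) :
    (assocIso M N P).hom ≫ braidHom M (tensor N P) ≫ (assocIso N P M).hom =
      tensorMap (braidHom M N) (𝟙 P) ≫ (assocIso N M P).hom ≫ tensorMap (𝟙 N) (braidHom M P) := by
  apply ymk_hom_ext_left
  intro m n p
  simp (disch := fun_prop) only [comp_toLin, LinearMap.comp_apply, tensorMap_ymk, braidHom_ymk,
    map_sw, assocIso_hom_ymk, sw_ymk_coact, id_toLin, LinearMap.id_apply, sw_apply, ymk_twist,
    P.isYetterDrinfeld.right_comodule.sw_symm, act_symm, act_act, mul_symm,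
    LinearEquiv.symm_apply_apply, LinearEquiv.apply_symm_apply]

/-- The action on `M ⊗ N` is through `Δ(p₍₁₎)`, so this hexagon is coassociativity of the coaction
on `P`. -/
theorem braidHom_reverse (M N P : YetterDrinfeldModule H) :
    (assocIso M N P).inv ≫ braidHom (tensor M N) P ≫ (assocIso P M N).inv =
      tensorMap (𝟙 M) (braidHom N P) ≫ (assocIso M P N).inv ≫ tensorMap (braidHom M P) (𝟙 N) := by
  apply ymk_hom_ext_right
  intro m n p
  simp (disch := fun_prop) only [comp_toLin, LinearMap.comp_apply, tensorMap_ymk, braidHom_ymk,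
    map_sw, assocIso_inv_ymk, ymk_symm, ymk_act, id_toLin, LinearMap.id_apply, sw_apply,
    P.isYetterDrinfeld.right_comodule.sw_twist, sw_comul_twist,
    LinearEquiv.symm_apply_apply, LinearEquiv.apply_symm_apply, twist_act]
  rw [P.isYetterDrinfeld.right_comodule.sw_coassoc (F := fun p a b =>
    ymk (tensor P M) N (ymk P M (P.twist (P.twist p))
      (M.act (M.twist.symm (M.twist.symm m)) (H.twist a))) (N.act n (H.twist b)))
      (by fun_prop) (by fun_prop) (by fun_prop)]
  simp only [LinearEquiv.apply_symm_apply]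

/-- The underlying scalar of an element of the unit object. -/
def unitVal (H : MonoidalHomHopfAlgebra k) : (unit H).carrier →ₗ[k] k := LinearMap.id

theorem unit_twist (x : (unit H).carrier) : (unit H).twist x = x := rfl

theorem unit_symm (x : (unit H).carrier) : (unit H).twist.symm x = x := rfl

theorem unitVal_act (x : (unit H).carrier) (h : H.carrier) :
    unitVal H ((unit H).act x h) = H.counit h * unitVal H x := mul_comm _ _

theorem unit_coact (x : (unit H).carrier) : (unit H).coact x = x ⊗ₜ[k] H.one := rfl

theorem leftUnitIso_ymk (x : (unit H).carrier) (m : M.carrier) :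
    Hom.toLin (leftUnitIso M).hom (ymk (unit H) M x m) = unitVal H x • M.twist m :=
  M.twist.map_smul (unitVal H x) m

theorem rightUnitIso_ymk (m : M.carrier) (x : (unit H).carrier) :
    Hom.toLin (rightUnitIso M).hom (ymk M (unit H) m x) = unitVal H x • M.twist m :=
  M.twist.map_smul (unitVal H x) m

/-- The coaction on the unit object gives `1`, which acts as `μ`; in the mirror statement the action
on the unit is `ε`, which the counit axiom of `M` absorbs. -/
theorem braidHom_unit (M : YetterDrinfeldModule H) :
    braidHom M (unit H) ≫ (leftUnitIso M).hom = (rightUnitIso M).hom := by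
  apply ymk_hom_ext
  intro m x
  rw [comp_toLin, LinearMap.comp_apply, braidHom_ymk, map_sw, unit_coact, rightUnitIso_ymk]
  simp only [leftUnitIso_ymk, unit_twist]
  rw [sw_tmul (by fun_prop) (by fun_prop), act_one, LinearEquiv.apply_symm_apply]

theorem unit_braidHom (M : YetterDrinfeldModule H) :
    braidHom (unit H) M ≫ (rightUnitIso M).hom = (leftUnitIso M).hom := by
  apply ymk_hom_ext
  intro x m
  rw [comp_toLin, LinearMap.comp_apply, braidHom_ymk, map_sw, leftUnitIso_ymk]
  simp only [rightUnitIso_ymk, unitVal_act, unit_symm, mul_smul]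
  rw [M.isYetterDrinfeld.right_comodule.sw_counit (F := fun y => unitVal H x • M.twist (M.twist y))
    (by fun_prop), LinearEquiv.apply_symm_apply]

/-- The prebraiding of Yetter-Drinfel'd Hom-modules. -/
noncomputable def prebraiding (H : MonoidalHomHopfAlgebra k) :
    Prebraiding (YetterDrinfeldModule H) where
  braiding := braidHom
  naturality := braidHom_naturality
  hexagon_forward := braidHom_forward
  hexagon_reverse := braidHom_reverse
  braiding_leftUnitor := braidHom_unit
  braiding_rightUnitor := unit_braidHom

end YetterDrinfeldModule
end HomHopf
-- Anti-multiplicativity of the antipode and its inverse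
namespace HomHopf

section Antipode

variable {k : Type u} [CommRing k] {H : MonoidalHomHopfAlgebra k}
variable {X : Type u} [AddCommGroup X] [Module k X]

/-- `S(h₁b)α(h₂) = ε(h)S(α²(b))`. -/
theorem sw_antipode_mul_twist (h b : H.carrier) :
    sw (H.comul h) (fun x y => H.mul (H.antipode (H.mul x b)) (H.twist y)) =
      H.counit h • H.antipode (H.twist (H.twist b)) := by
  -- The factor `d₁S(d₂) = ε(d)1`, taken from `Δ(α(b))`, is inserted on the right. It supplies the
  -- leg of `b` that `h₂` needs as a partner.
  have e : ∀ x y, sw (H.comul (H.twist b)) (fun c d => sw (H.comul d) fun d₁ d₂ =>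
      H.mul (H.antipode (H.mul x c)) (H.mul y (H.mul d₁ (H.antipode d₂)))) =
      H.mul (H.antipode (H.mul x b)) (H.twist y) := by
    intro x y
    have e' : ∀ c d, sw (H.comul d) (fun d₁ d₂ =>
      H.mul (H.antipode (H.mul x c)) (H.mul y (H.mul d₁ (H.antipode d₂)))) =
      H.counit d • H.mul (H.antipode (H.mul x c)) (H.mul y H.one) := fun c d =>
      sw_mul_antipode (F := fun d => H.mul (H.antipode (H.mul x c)) (H.mul y d)) (by fun_prop) d
    simp only [e']
    rw [sw_comul_counit_right (F := fun c => H.mul (H.antipode (H.mul x c)) (H.mul y H.one))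
      (by fun_prop), LinearEquiv.symm_apply_apply, H.mul_one]
  -- Coassociativity regroups the legs of `b` into `S(xb₁)(yb₂)` times `S(b₃)`, up to twists.
  have e₂ : ∀ x y, sw (H.comul (H.twist b)) (fun c d => sw (H.comul d) fun d₁ d₂ =>
      H.mul (H.antipode (H.mul x c)) (H.mul y (H.mul d₁ (H.antipode d₂)))) =
      sw (H.comul (H.twist b)) (fun c d => sw (H.comul c) fun c₁ c₂ =>
      H.mul (H.mul (H.antipode (H.mul (H.twist.symm x) c₁)) (H.mul (H.twist.symm y) c₂))
        (H.antipode (H.twist d))) := by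
    intro x y
    rw [sw_comul_coassoc (F := fun c₁ c₂ d => H.mul (H.mul (H.antipode
      (H.mul (H.twist.symm x) c₁)) (H.mul (H.twist.symm y) c₂)) (H.antipode (H.twist d)))
      (by fun_prop) (by fun_prop) (by fun_prop)]
    simp only [mul_mul, H.antipode_twist, LinearEquiv.apply_symm_apply, ← mul_symm,
      ← antipode_symm, LinearEquiv.symm_apply_apply]
  simp only [← e, e₂]
  rw [sw_comm]
  -- The first bracket collapses by the antipode axiom for a product, leaving only the last leg of
  -- `b`.
  have e₃ : ∀ c d, sw (H.comul h) (fun x y => sw (H.comul c) fun c₁ c₂ =>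
      H.mul (H.mul (H.antipode (H.mul (H.twist.symm x) c₁)) (H.mul (H.twist.symm y) c₂))
        (H.antipode (H.twist d))) =
      H.counit c • H.counit h • H.antipode (H.twist (H.twist d)) := by
    intro c d
    have e := sw_antipode_mul_mul (F := fun z => H.mul z (H.antipode (H.twist d))) (by fun_prop)
      (H.twist.symm h) c
    rw [sw_comul_symm (by fun_prop) (by fun_prop)] at e
    rw [e, counit_symm, H.one_mul, smul_comm, ← H.antipode_twist]
  simp only [e₃]
  rw [sw_comul_counit_left (F := fun d => H.counit h • H.antipode (H.twist (H.twist d)))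
    (by fun_prop), LinearEquiv.symm_apply_apply]

/-- The antipode reverses products. -/
theorem antipode_mul_rev (h b : H.carrier) :
    H.antipode (H.mul h b) = H.mul (H.antipode b) (H.antipode h) := by
  -- Replacing `b` by `α²(b)` absorbs the twist in `sw_antipode_mul_twist`.
  obtain ⟨b, rfl⟩ := H.twist.surjective b
  obtain ⟨b, rfl⟩ := H.twist.surjective b
  -- The sum of `(S(h₁b)α(h₂))S(α(h₃))` is evaluated in two ways: joining the first two factors
  -- gives `S(α²(b))S(h)`, joining the last two by the antipode axiom gives `S(hα²(b))`.
  have e := sw_comul_coassoc (F := fun x y z => H.mul (H.mul (H.antipode (H.mul x b)) (H.twist y))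
    (H.antipode (H.twist z))) (by fun_prop) (by fun_prop) (by fun_prop) h
  have e₁ : ∀ a c, sw (H.comul a) (fun x y => H.mul (H.mul (H.antipode (H.mul x b)) (H.twist y))
      (H.antipode (H.twist c))) =
      H.counit a • H.mul (H.antipode (H.twist (H.twist b))) (H.antipode (H.twist c)) := by
    intro a c
    rw [← lin_sw (L := fun z => H.mul z (H.antipode (H.twist c))) (by fun_prop),
      sw_antipode_mul_twist, map_smul]
    rfl
  have e₂ : ∀ a c, sw (H.comul c) (fun x y => H.mul (H.mul (H.antipode (H.mul (H.twist.symm a) b))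
      (H.twist x)) (H.antipode (H.twist (H.twist y)))) =
      H.counit c • H.antipode (H.mul (H.twist a) (H.twist (H.twist b))) := by
    intro a c
    have e' : ∀ x y, H.mul (H.mul (H.antipode (H.mul (H.twist.symm a) b)) (H.twist x))
        (H.antipode (H.twist (H.twist y))) =
        H.mul (H.antipode (H.twist (H.mul (H.twist.symm a) b)))
          (H.twist (H.mul x (H.antipode y))) := fun x y => by
      rw [mul_mul, ← H.antipode_twist, H.antipode_twist (H.twist y), LinearEquiv.symm_apply_apply,
        H.twist_mul x, H.antipode_twist y]
    simp only [e']
    rw [sw_mul_antipode (F := fun z => H.mul (H.antipode (H.twist (H.mul (H.twist.symm a) b)))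
      (H.twist z)) (by fun_prop), H.twist_one, H.mul_one, ← H.antipode_twist]
    simp only [H.twist_mul, LinearEquiv.apply_symm_apply]
  simp only [e₁, e₂] at e
  rw [sw_comul_counit_left (F := fun c => H.mul (H.antipode (H.twist (H.twist b)))
    (H.antipode (H.twist c))) (by fun_prop), sw_comul_counit_right
    (F := fun a => H.antipode (H.mul (H.twist a) (H.twist (H.twist b)))) (by fun_prop),
    LinearEquiv.apply_symm_apply] at e
  exact e.symm

/-- The inverse of a bijective antipode. -/
noncomputable def antipodeInv (hS : Function.Bijective H.antipode) : H.carrier →ₗ[k] H.carrier :=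
  (LinearEquiv.ofBijective H.antipode hS).symm.toLinearMap

variable (hS : Function.Bijective H.antipode)

theorem antipode_antipodeInv (a : H.carrier) : H.antipode (antipodeInv hS a) = a :=
  (LinearEquiv.ofBijective H.antipode hS).apply_symm_apply a

theorem antipodeInv_twist (a : H.carrier) :
    antipodeInv hS (H.twist a) = H.twist (antipodeInv hS a) :=
  hS.1 (by rw [H.antipode_twist, antipode_antipodeInv, antipode_antipodeInv])

theorem antipodeInv_symm (a : H.carrier) :
    H.twist.symm (antipodeInv hS a) = antipodeInv hS (H.twist.symm a) := by
  rw [LinearEquiv.symm_apply_eq, ← antipodeInv_twist, LinearEquiv.apply_symm_apply]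

/-- `S⁻¹(h₂)h₁ = ε(h)1`. -/
theorem sw_antipodeInv_mul {F : H.carrier → X} (hF : IsLinearMap k F) (h : H.carrier) :
    sw (H.comul h) (fun a b => F (H.mul (antipodeInv hS b) a)) = H.counit h • F H.one := by
  rw [← lin_sw hF, ← hF.map_smul]
  congr 1
  -- After the injective `S` is applied, anti-multiplicativity turns the sum into that of `S(h₁)h₂`.
  apply hS.1
  rw [map_sw, map_smul, antipode_one]
  simp only [antipode_mul_rev, antipode_antipodeInv]
  exact sw_antipode_mul (F := fun a => a) (by fun_prop) h

/-- `h₂S⁻¹(h₁) = ε(h)1`. -/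
theorem sw_mul_antipodeInv {F : H.carrier → X} (hF : IsLinearMap k F) (h : H.carrier) :
    sw (H.comul h) (fun a b => F (H.mul b (antipodeInv hS a))) = H.counit h • F H.one := by
  rw [← lin_sw hF, ← hF.map_smul]
  congr 1
  -- Under `S` the sum becomes that of `h₁S(h₂)`.
  apply hS.1
  rw [map_sw, map_smul, antipode_one]
  simp only [antipode_mul_rev, antipode_antipodeInv]
  exact sw_mul_antipode (F := fun a => a) (by fun_prop) h

end Antipode

/-! ### Invertibility of the Yetter-Drinfel'd prebraiding -/

namespace YetterDrinfeldModule

variable {k : Type u} [CommRing k] {H : MonoidalHomHopfAlgebra k}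
variable (M N : YetterDrinfeldModule H) (hS : Function.Bijective H.antipode)

/-- The linear map `n ⊗ m ↦ μ⁻¹(m) ◁ S⁻¹(n₍₁₎) ⊗ ν(n₍₀₎)`. -/
noncomputable def braidInv : (tensor N M).carrier →ₗ[k] (tensor M N).carrier :=
  ylift N M (bilin (fun n m => sw (N.coact n) fun y a =>
    ymk M N (M.act (M.twist.symm m) (antipodeInv hS a)) (N.twist y)) (by fun_prop) (by fun_prop))

theorem braidInv_ymk (n : N.carrier) (m : M.carrier) :
    braidInv M N hS (ymk N M n m) = sw (N.coact n) fun y a =>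
      ymk M N (M.act (M.twist.symm m) (antipodeInv hS a)) (N.twist y) := rfl

/-- Coassociativity of `N` turns the two coaction legs acting on `m` into the legs of one `Δ(n₍₁₎)`,
in the order `h₂S⁻¹(h₁)`; the counit then removes them. -/
theorem braidInv_braidLin (x : (tensor M N).carrier) :
    braidInv M N hS (braidLin M N x) = x := by
  refine tensor_induction (f := fun x => braidInv M N hS (braidLin M N x)) (f' := fun x => x)
    (by fun_prop) (by fun_prop) (fun m n => ?_) x
  simp (disch := fun_prop) only [braidLin_ymk, map_sw, braidInv_ymk, act_symm, act_act,
    N.isYetterDrinfeld.right_comodule.sw_twist, antipodeInv_twist, LinearEquiv.symm_apply_apply,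
    LinearEquiv.apply_symm_apply]
  rw [N.isYetterDrinfeld.right_comodule.sw_coassoc (F := fun y b a =>
    ymk M N (M.act (M.twist.symm m) (H.mul (H.twist.symm a) (antipodeInv hS b)))
      (N.twist (N.twist y))) (by fun_prop) (by fun_prop) (by fun_prop)]
  simp only [LinearEquiv.symm_apply_apply, LinearEquiv.apply_symm_apply]
  have e : ∀ y a, sw (H.comul a) (fun b c => ymk M N (M.act (M.twist.symm m)
      (H.mul c (antipodeInv hS b))) (N.twist y)) = H.counit a • ymk M N m (N.twist y) := by
    intro y a
    rw [sw_mul_antipodeInv hS (F := fun z => ymk M N (M.act (M.twist.symm m) z) (N.twist y))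
      (by fun_prop), act_one, LinearEquiv.apply_symm_apply]
  simp only [e]
  rw [N.isYetterDrinfeld.right_comodule.sw_counit (F := fun y => ymk M N m (N.twist y))
    (by fun_prop), LinearEquiv.apply_symm_apply]

/-- Here the legs act in the opposite order, `S⁻¹(h₂)h₁`. -/
theorem braidLin_braidInv (x : (tensor N M).carrier) :
    braidLin M N (braidInv M N hS x) = x := by
  refine tensor_induction (f := fun x => braidLin M N (braidInv M N hS x)) (f' := fun x => x)
    (by fun_prop) (by fun_prop) (fun n m => ?_) x
  simp (disch := fun_prop) only [braidLin_ymk, map_sw, braidInv_ymk, act_symm, act_act,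
    N.isYetterDrinfeld.right_comodule.sw_twist, antipodeInv_symm, LinearEquiv.symm_apply_apply,
    LinearEquiv.apply_symm_apply]
  rw [N.isYetterDrinfeld.right_comodule.sw_coassoc (F := fun y b a =>
    ymk N M (N.twist (N.twist y)) (M.act (M.twist.symm m)
      (H.mul (antipodeInv hS (H.twist.symm a)) b))) (by fun_prop) (by fun_prop) (by fun_prop)]
  simp only [LinearEquiv.symm_apply_apply, LinearEquiv.apply_symm_apply]
  have e : ∀ y a, sw (H.comul a) (fun b c => ymk N M (N.twist y) (M.act (M.twist.symm m)
      (H.mul (antipodeInv hS c) b))) = H.counit a • ymk N M (N.twist y) m := by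
    intro y a
    rw [sw_antipodeInv_mul hS (F := fun z => ymk N M (N.twist y) (M.act (M.twist.symm m) z))
      (by fun_prop), act_one, LinearEquiv.apply_symm_apply]
  simp only [e]
  rw [N.isYetterDrinfeld.right_comodule.sw_counit (F := fun y => ymk N M (N.twist y) m)
    (by fun_prop), LinearEquiv.apply_symm_apply]

/-- The prebraiding is invertible if the antipode is bijective. -/
theorem isIso_braidHom (M N : YetterDrinfeldModule H) (hS : Function.Bijective H.antipode) :
    IsIso (braidHom M N) := by
  -- A linear inverse of a morphism is automatically linear and colinear over `H`, so `braidInv`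
  -- needs no further verification.
  have e := (isoOfEquiv (LinearEquiv.ofLinearMap (braidLin M N) (braidInv M N hS)
    (LinearMap.ext (braidLin_braidInv M N hS)) (LinearMap.ext (braidInv_braidLin M N hS)))
    (braidHom M N).map_twist (braidHom M N).map_act (braidHom M N).map_coact).isIso_hom
  exact e

end YetterDrinfeldModule
end HomHopf
-- The strong monoidal structure of `V ↦ H ⊗ V`
namespace HomHopf

open scoped MonoidalCategory

section FreeMonoidal

variable {k : Type u} [CommRing k] {H : MonoidalHomHopfAlgebra k}
variable (V W : YetterDrinfeldModule H)

open BicovariantBimodule (tmk)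
open YetterDrinfeldModule (ymk ylift)

variable {V W} in
theorem free_tensor_induction {X : Type u} [AddCommGroup X] [Module k X]
    {f f' : (freeObj H (YetterDrinfeldModule.tensor V W)).carrier → X} (hf : IsLinearMap k f)
    (hf' : IsLinearMap k f')
    (h : ∀ g v w, f (fmk _ g (ymk V W v w)) = f' (fmk _ g (ymk V W v w))) (x) : f x = f' x :=
  free_induction hf hf' (fun g y => YetterDrinfeldModule.tensor_induction
    (f := fun y => f (fmk _ g y)) (f' := fun y => f' (fmk _ g y)) (by fun_prop) (by fun_prop)
    (h g) y) x

theorem fmk_one_lact (h : H.carrier) (v : V.carrier) :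
    (freeObj H V).lact h (fmk V H.one v) = fmk V h (V.twist v) := by
  rw [fmk_lact, H.mul_one, LinearEquiv.apply_symm_apply]

/-- `g ⊗ (v ⊗ w) ↦ (α⁻¹(g) ⊗ v) ⊗_H (1 ⊗ w)`. -/
noncomputable def freeDeltaLin : (freeObj H (YetterDrinfeldModule.tensor V W)).carrier →ₗ[k]
    (BicovariantBimodule.tensor (freeObj H V) (freeObj H W)).carrier :=
  flift _ (bilin (fun g x => ylift V W (bilin (fun v w =>
    tmk (freeObj H V) (freeObj H W) (fmk V (H.twist.symm g) v) (fmk W H.one w))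
    (by fun_prop) (by fun_prop)) x)
    (fun x => ⟨fun a b => YetterDrinfeldModule.tensor_induction (f := fun x => ylift V W _ x)
        (f' := fun x => ylift V W _ x + ylift V W _ x) (by fun_prop)
        (LinearMap.isLinear (ylift V W _ + ylift V W _)) (fun v w => by
          simp [bilin]) x,
      fun c a => YetterDrinfeldModule.tensor_induction (f := fun x => ylift V W _ x)
        (f' := fun x => c • ylift V W _ x) (by fun_prop) (by fun_prop) (fun v w => by
          simp [bilin]) x⟩) (by fun_prop))

@[simp] theorem freeDeltaLin_fmk (g : H.carrier) (v : V.carrier) (w : W.carrier) :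
    freeDeltaLin V W (fmk _ g (ymk V W v w)) =
      tmk (freeObj H V) (freeObj H W) (fmk V (H.twist.symm g) v) (fmk W H.one w) := rfl

/-- The morphism `g ⊗ (v ⊗ w) ↦ (α⁻¹(g) ⊗ v) ⊗_H (1 ⊗ w)`. -/
noncomputable def freeDelta : freeObj H (YetterDrinfeldModule.tensor V W) ⟶
    BicovariantBimodule.tensor (freeObj H V) (freeObj H W) where
  toLin := freeDeltaLin V W
  map_twist := free_tensor_induction (by fun_prop) (by fun_prop) fun g v w => by
    simp only [fmk_twist, YetterDrinfeldModule.ymk_twist, freeDeltaLin_fmk,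
      BicovariantBimodule.tensor_twist_mk, LinearEquiv.symm_apply_apply,
      LinearEquiv.apply_symm_apply, H.twist_one]
  map_lact h := free_tensor_induction (by fun_prop) (by fun_prop) fun g v w => by
    simp only [fmk_lact, YetterDrinfeldModule.ymk_twist, freeDeltaLin_fmk,
      BicovariantBimodule.tensor_lact_mk, fmk_twist, H.twist_one, mul_symm]
  map_ract x h := free_tensor_induction
    (f := fun x => freeDeltaLin V W ((freeObj H (YetterDrinfeldModule.tensor V W)).ract x h))
    (f' := fun x => (BicovariantBimodule.tensor (freeObj H V) (freeObj H W)).ract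
      (freeDeltaLin V W x) h) (by fun_prop) (by fun_prop) (fun g v w => by
      -- The factor `a` of the second tensorand is moved across `⊗_H`, where it acts diagonally on
      -- the first; this restores the form `· ⊗_H (1 ⊗ ·)`.
      have e : ∀ a b, tmk (freeObj H V) (freeObj H W) (fmk V g (V.twist v)) (fmk W a b) =
          sw (H.comul a) fun c d => tmk (freeObj H V) (freeObj H W)
            (fmk V (H.mul (H.twist.symm g) c) (V.act v d)) (fmk W H.one b) := by
        intro a b
        have e := BicovariantBimodule.tmk_balanced' (M := freeObj H V) (N := freeObj H W)
          (fmk V g (V.twist v)) a (fmk W H.one (W.twist.symm b))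
        rw [fmk_one_lact, fmk_symm, fmk_ract, fmk_twist, map_sw, sw_apply] at e
        simpa only [LinearEquiv.apply_symm_apply, LinearEquiv.symm_apply_apply, H.twist_one]
          using e
      simp only [fmk_ract, YetterDrinfeldModule.ymk_act, map_sw, freeDeltaLin_fmk,
        BicovariantBimodule.tensor_ract_mk, fmk_twist, LinearEquiv.apply_symm_apply, H.one_mul]
      rw [sw_comul_symm (by fun_prop) (by fun_prop)]
      simp only [LinearEquiv.apply_symm_apply, e]
      -- The remaining difference is whether `h` is split as `h₁₁, h₁₂, h₂` or `h₁, h₂₁, h₂₂`.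
      rw [sw_comul_coassoc (F := fun c d a => tmk (freeObj H V) (freeObj H W)
            (fmk V (H.mul (H.twist.symm g) c) (V.act v d)) (fmk W H.one (W.act w
              (H.twist.symm a)))) (by fun_prop) (by fun_prop) (by fun_prop)]
      simp only [LinearEquiv.symm_apply_apply, mul_symm]) x
  map_lcoact := free_tensor_induction (by fun_prop) (by fun_prop) fun g v w => by
    rw [fmk_lcoact, freeDeltaLin_fmk, BicovariantBimodule.tensor_lcoact_mk, map₂_eq_sw]
    simp (disch := fun_prop) only [YetterDrinfeldModule.ymk_symm, map_sw, map_tmul,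
      freeDeltaLin_fmk, LinearMap.id_apply, sw_fmk_lcoact, sw_comul_symm, sw_comul_one,
      H.twist_one, H.mul_one, LinearEquiv.apply_symm_apply]
  map_rcoact := free_tensor_induction (by fun_prop) (by fun_prop) fun g v w => by
    rw [fmk_rcoact, freeDeltaLin_fmk, BicovariantBimodule.tensor_rcoact_mk, map₂_eq_sw]
    simp (disch := fun_prop) only [YetterDrinfeldModule.sw_ymk_coact, map_sw, map_tmul,
      freeDeltaLin_fmk, LinearMap.id_apply, sw_fmk_rcoact, sw_comul_symm, sw_comul_one, mul_mul,
      H.one_mul, LinearEquiv.apply_symm_apply, LinearEquiv.symm_apply_apply]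

theorem freeDelta_fmk (g : H.carrier) (v : V.carrier) (w : W.carrier) :
    BicovariantBimodule.Hom.toLin (freeDelta V W) (fmk _ g (ymk V W v w)) =
      tmk (freeObj H V) (freeObj H W) (fmk V (H.twist.symm g) v) (fmk W H.one w) := rfl

/-- `x ↦ (h ⊗ w ↦ gα(h₁) ⊗ (ν⁻¹(v) ◁ h₂ ⊗ w))` for `x = g ⊗ v`. -/
noncomputable def freeMuBilin : (freeObj H V).carrier →ₗ[k] (freeObj H W).carrier →ₗ[k]
    (freeObj H (YetterDrinfeldModule.tensor V W)).carrier :=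
  flift V (bilin (fun g v => flift W (bilin (fun h w => sw (H.comul h) fun a b =>
    fmk (YetterDrinfeldModule.tensor V W) (H.mul g (H.twist a))
      (ymk V W (V.act (V.twist.symm v) b) w)) (by fun_prop) (by fun_prop)))
    (fun v => ⟨fun a b => LinearMap.ext (free_induction (by fun_prop)
      (LinearMap.isLinear (flift W _ + flift W _)) fun h w => by
        simp only [LinearMap.add_apply, flift_fmk, bilin, LinearMap.mk₂_apply]
        exact IsLinearMap.map_add (f := fun g => sw (H.comul h) fun a b =>
          fmk (YetterDrinfeldModule.tensor V W) (H.mul g (H.twist a))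
            (ymk V W (V.act (V.twist.symm v) b) w)) (R := k) (by fun_prop) a b),
      fun c a => LinearMap.ext (free_induction (by fun_prop)
      (LinearMap.isLinear (c • flift W _)) fun h w => by
        simp only [LinearMap.smul_apply, flift_fmk, bilin, LinearMap.mk₂_apply]
        exact IsLinearMap.map_smul (f := fun g => sw (H.comul h) fun a b =>
          fmk (YetterDrinfeldModule.tensor V W) (H.mul g (H.twist a))
            (ymk V W (V.act (V.twist.symm v) b) w)) (R := k) (by fun_prop) c a)⟩)
    (fun g => ⟨fun a b => LinearMap.ext (free_induction (by fun_prop)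
      (LinearMap.isLinear (flift W _ + flift W _)) fun h w => by
        simp only [LinearMap.add_apply, flift_fmk, bilin, LinearMap.mk₂_apply]
        exact IsLinearMap.map_add (f := fun v => sw (H.comul h) fun a b =>
          fmk (YetterDrinfeldModule.tensor V W) (H.mul g (H.twist a))
            (ymk V W (V.act (V.twist.symm v) b) w)) (R := k) (by fun_prop) a b),
      fun c a => LinearMap.ext (free_induction (by fun_prop)
      (LinearMap.isLinear (c • flift W _)) fun h w => by
        simp only [LinearMap.smul_apply, flift_fmk, bilin, LinearMap.mk₂_apply]
        exact IsLinearMap.map_smul (f := fun v => sw (H.comul h) fun a b =>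
          fmk (YetterDrinfeldModule.tensor V W) (H.mul g (H.twist a))
            (ymk V W (V.act (V.twist.symm v) b) w)) (R := k) (by fun_prop) c a)⟩))

theorem freeMuBilin_fmk (g : H.carrier) (v : V.carrier) (h : H.carrier) (w : W.carrier) :
    freeMuBilin V W (fmk V g v) (fmk W h w) = sw (H.comul h) fun a b =>
      fmk (YetterDrinfeldModule.tensor V W) (H.mul g (H.twist a))
        (ymk V W (V.act (V.twist.symm v) b) w) := rfl

/-- Both sides have as summands the products of `g`, `h₁` and `h'₁` and the action of `h₂`, then
`h'₂`, on `v`, since `Δ` is multiplicative and the action associative. Hence `φ₂` descends to `⊗_H`.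
-/
theorem freeMuBilin_ract (x : (freeObj H V).carrier) (h : H.carrier)
    (y : (freeObj H W).carrier) :
    freeMuBilin V W ((freeObj H V).ract x h) y =
      freeMuBilin V W ((freeObj H V).twist x)
        ((freeObj H W).lact h ((freeObj H W).twist.symm y)) := by
  refine free_induction (f := fun x => freeMuBilin V W ((freeObj H V).ract x h) y)
    (f' := fun x => freeMuBilin V W ((freeObj H V).twist x)
      ((freeObj H W).lact h ((freeObj H W).twist.symm y))) (by fun_prop) (by fun_prop)
    (fun g v => ?_) x
  refine free_induction (f := fun y => freeMuBilin V W ((freeObj H V).ract (fmk V g v) h) y)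
    (f' := fun y => freeMuBilin V W ((freeObj H V).twist (fmk V g v))
      ((freeObj H W).lact h ((freeObj H W).twist.symm y))) (by fun_prop) (by fun_prop)
    (fun h' w => ?_) y
  simp (disch := fun_prop) only [fmk_ract, map_sw, sw_apply, freeMuBilin_fmk, fmk_twist, fmk_lact,
    fmk_symm, ← mul_symm, sw_comul_symm, sw_comul_mul, LinearEquiv.apply_symm_apply,
    LinearEquiv.symm_apply_apply, mul_mul, YetterDrinfeldModule.act_symm,
    YetterDrinfeldModule.act_act]

/-- `φ₂` as a linear map. -/
noncomputable def freeMuLin :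
    (BicovariantBimodule.tensor (freeObj H V) (freeObj H W)).carrier →ₗ[k]
      (freeObj H (YetterDrinfeldModule.tensor V W)).carrier :=
  BicovariantBimodule.lift (freeMuBilin V W) (freeMuBilin_ract V W)

theorem freeMuLin_tmk (x : (freeObj H V).carrier) (y : (freeObj H W).carrier) :
    freeMuLin V W (tmk _ _ x y) = freeMuBilin V W x y := rfl

/-- Only `Δ(1) = 1 ⊗ 1` is involved, because the second tensorand is `1 ⊗ w`. -/
theorem freeMuLin_freeDelta (x : (freeObj H (YetterDrinfeldModule.tensor V W)).carrier) :
    freeMuLin V W (BicovariantBimodule.Hom.toLin (freeDelta V W) x) = x := by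
  refine free_tensor_induction (f := fun x => freeMuLin V W
    (BicovariantBimodule.Hom.toLin (freeDelta V W) x)) (f' := fun x => x) (by fun_prop)
    (by fun_prop) (fun g v w => ?_) x
  rw [freeDelta_fmk, freeMuLin_tmk, freeMuBilin_fmk, sw_comul_one (by fun_prop) (by fun_prop),
    H.twist_one, H.mul_one, LinearEquiv.apply_symm_apply, YetterDrinfeldModule.act_one,
    LinearEquiv.apply_symm_apply]

/-- Balancing brings every `(g ⊗ v) ⊗_H (h ⊗ w)` to a sum of elements `(· ⊗ ·) ⊗_H (1 ⊗ w)`, and the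
formula for `φ₂` records the result. Thus `φ₂` is a morphism, being the linear inverse of one. -/
theorem freeDelta_freeMuLin
    (x : (BicovariantBimodule.tensor (freeObj H V) (freeObj H W)).carrier) :
    BicovariantBimodule.Hom.toLin (freeDelta V W) (freeMuLin V W x) = x := by
  refine LinearMap.congr_fun (f := BicovariantBimodule.Hom.toLin (freeDelta V W) ∘ₗ freeMuLin V W)
    (g := LinearMap.id) (BicovariantBimodule.tensor_ext fun x y => ?_) x
  refine free_induction (f := fun x => BicovariantBimodule.Hom.toLin (freeDelta V W)
    (freeMuLin V W (tmk _ _ x y))) (f' := fun x => tmk _ _ x y) (by fun_prop) (by fun_prop)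
    (fun g v => ?_) x
  refine free_induction (f := fun y => BicovariantBimodule.Hom.toLin (freeDelta V W)
    (freeMuLin V W (tmk _ _ (fmk V g v) y))) (f' := fun y => tmk _ _ (fmk V g v) y)
    (by fun_prop) (by fun_prop) (fun h w => ?_) y
  have e := BicovariantBimodule.tmk_balanced' (M := freeObj H V) (N := freeObj H W)
    (fmk V g v) h (fmk W H.one (W.twist.symm w))
  rw [fmk_one_lact, fmk_symm, fmk_ract, fmk_twist, map_sw, sw_apply, H.twist_one,
    LinearEquiv.apply_symm_apply] at e
  rw [freeMuLin_tmk, freeMuBilin_fmk, map_sw, e]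
  simp only [freeDelta_fmk, mul_symm, LinearEquiv.symm_apply_apply]

/-- `F(V ⊗ W) ≅ F(V) ⊗_H F(W)`. -/
noncomputable def freeDeltaIso : freeObj H (YetterDrinfeldModule.tensor V W) ≅
    BicovariantBimodule.tensor (freeObj H V) (freeObj H W) :=
  BicovariantBimodule.isoOfInv (freeDelta V W) (freeMuLin V W) (freeMuLin_freeDelta V W)
    (freeDelta_freeMuLin V W)

/-- The identity map from `H` to the unit bicovariant Hom-bimodule. -/
def unitMk (H : MonoidalHomHopfAlgebra k) : H.carrier →ₗ[k] (BicovariantBimodule.unit H).carrier :=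
  LinearMap.id

theorem unitMk_surjective : Function.Surjective (unitMk H) := fun h => ⟨h, rfl⟩

theorem unitMk_twist (h : H.carrier) :
    (BicovariantBimodule.unit H).twist (unitMk H h) = unitMk H (H.twist h) := rfl

theorem unitMk_lact (g h : H.carrier) :
    (BicovariantBimodule.unit H).lact g (unitMk H h) = unitMk H (H.mul g h) := rfl

theorem unitMk_ract (g h : H.carrier) :
    (BicovariantBimodule.unit H).ract (unitMk H g) h = unitMk H (H.mul g h) := rfl

theorem unitMk_lcoact (h : H.carrier) : (BicovariantBimodule.unit H).lcoact (unitMk H h) =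
    sw (H.comul h) fun a b => a ⊗ₜ[k] unitMk H b := (sw_mk _).symm

theorem unitMk_rcoact (h : H.carrier) : (BicovariantBimodule.unit H).rcoact (unitMk H h) =
    sw (H.comul h) fun a b => unitMk H a ⊗ₜ[k] b := (sw_mk _).symm

theorem unitMk_leftUnitIso (M : BicovariantBimodule H) (h : H.carrier) (m : M.carrier) :
    BicovariantBimodule.Hom.toLin (BicovariantBimodule.leftUnitIso M).hom
      (tmk _ M (unitMk H h) m) = M.lact h m := rfl

theorem unitMk_rightUnitIso (M : BicovariantBimodule H) (m : M.carrier) (h : H.carrier) :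
    BicovariantBimodule.Hom.toLin (BicovariantBimodule.rightUnitIso M).hom
      (tmk M _ m (unitMk H h)) = M.ract m h := rfl

open YetterDrinfeldModule (unitVal)

/-- `g ⊗ x ↦ xα(g)`. -/
noncomputable def freeEtaLin (H : MonoidalHomHopfAlgebra k) :
    (freeObj H (YetterDrinfeldModule.unit H)).carrier →ₗ[k]
    (BicovariantBimodule.unit H).carrier :=
  flift _ (bilin (fun g x => unitVal H x • unitMk H (H.twist g)) (by fun_prop) (by fun_prop))

theorem freeEtaLin_fmk (g : H.carrier) (x : (YetterDrinfeldModule.unit H).carrier) :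
    freeEtaLin H (fmk _ g x) = unitVal H x • unitMk H (H.twist g) := rfl

/-- The morphism `g ⊗ x ↦ xα(g)`. -/
noncomputable def freeEta (H : MonoidalHomHopfAlgebra k) :
    freeObj H (YetterDrinfeldModule.unit H) ⟶ BicovariantBimodule.unit H where
  toLin := freeEtaLin H
  map_twist := free_induction (by fun_prop) (by fun_prop) fun g x => by
    rw [fmk_twist, freeEtaLin_fmk, freeEtaLin_fmk, map_smul, unitMk_twist,
      YetterDrinfeldModule.unit_twist]
  map_lact h := free_induction (by fun_prop) (by fun_prop) fun g x => by
    rw [fmk_lact, freeEtaLin_fmk, freeEtaLin_fmk, map_smul, unitMk_lact,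
      YetterDrinfeldModule.unit_twist, H.twist_mul, LinearEquiv.apply_symm_apply]
  map_ract x h := free_induction
    (f := fun x => freeEtaLin H ((freeObj H (YetterDrinfeldModule.unit H)).ract x h))
    (f' := fun x => (BicovariantBimodule.unit H).ract (freeEtaLin H x) h) (by fun_prop)
    (by fun_prop) (fun g x => by
      rw [fmk_ract, map_sw, freeEtaLin_fmk, map_smul, LinearMap.smul_apply, unitMk_ract]
      simp only [freeEtaLin_fmk, YetterDrinfeldModule.unitVal_act, mul_smul]
      rw [sw_comul_counit_right (F := fun a => unitVal H x • unitMk H (H.twist (H.mul g a)))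
        (by fun_prop), H.twist_mul, LinearEquiv.apply_symm_apply]) x
  map_lcoact := free_induction (by fun_prop) (by fun_prop) fun g x => by
    rw [fmk_lcoact, freeEtaLin_fmk, map_smul, unitMk_lcoact, map_sw,
      sw_comul_twist (by fun_prop) (by fun_prop), smul_sw]
    simp only [map_tmul, LinearMap.id_apply, freeEtaLin_fmk, tmul_smul]
    rfl
  map_rcoact := free_induction (by fun_prop) (by fun_prop) fun g x => by
    rw [fmk_rcoact, freeEtaLin_fmk, map_smul, unitMk_rcoact, map_sw,
      sw_comul_twist (by fun_prop) (by fun_prop), smul_sw, YetterDrinfeldModule.unit_coact]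
    simp (disch := fun_prop) only [sw_tmul, map_tmul, LinearMap.id_apply, freeEtaLin_fmk,
      H.mul_one, smul_tmul']

theorem freeEta_fmk (g : H.carrier) (x : (YetterDrinfeldModule.unit H).carrier) :
    BicovariantBimodule.Hom.toLin (freeEta H) (fmk _ g x) = unitVal H x • unitMk H (H.twist g) :=
  rfl

/-- The unit scalar. -/
def unitOne (H : MonoidalHomHopfAlgebra k) : (YetterDrinfeldModule.unit H).carrier := (1 : k)

theorem unitVal_unitOne : unitVal H (unitOne H) = 1 := rfl

theorem unitVal_smul_unitOne (x : (YetterDrinfeldModule.unit H).carrier) :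
    unitVal H x • unitOne H = x := mul_one (M := k) x

/-- `h ↦ α⁻¹(h) ⊗ 1`. -/
def freeEpsLin (H : MonoidalHomHopfAlgebra k) : (BicovariantBimodule.unit H).carrier →ₗ[k]
    (freeObj H (YetterDrinfeldModule.unit H)).carrier :=
  (fmk (YetterDrinfeldModule.unit H)).flip (unitOne H) ∘ₗ H.twist.symm.toLinearMap

theorem freeEpsLin_unitMk (h : H.carrier) :
    freeEpsLin H (unitMk H h) = fmk _ (H.twist.symm h) (unitOne H) := rfl

/-- `F(k) ≅ H`. -/
noncomputable def freeEtaIso (H : MonoidalHomHopfAlgebra k) :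
    freeObj H (YetterDrinfeldModule.unit H) ≅ BicovariantBimodule.unit H :=
  BicovariantBimodule.isoOfInv (freeEta H) (freeEpsLin H)
    (free_induction (f := fun x => freeEpsLin H (BicovariantBimodule.Hom.toLin (freeEta H) x))
      (f' := fun x => x) (by fun_prop) (by fun_prop) fun g x => by
        rw [freeEta_fmk, map_smul, freeEpsLin_unitMk, LinearEquiv.symm_apply_apply, ← map_smul,
          unitVal_smul_unitOne])
    (fun h => by
      obtain ⟨h, rfl⟩ := unitMk_surjective h
      rw [freeEpsLin_unitMk, freeEta_fmk, unitVal_unitOne, one_smul, LinearEquiv.apply_symm_apply])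

variable {V W} in
theorem free_tensor_hom_ext {M : BicovariantBimodule H}
    {f f' : freeObj H (YetterDrinfeldModule.tensor V W) ⟶ M}
    (h : ∀ g v w, BicovariantBimodule.Hom.toLin f (fmk _ g (ymk V W v w)) =
      BicovariantBimodule.Hom.toLin f' (fmk _ g (ymk V W v w))) : f = f' :=
  BicovariantBimodule.hom_ext (LinearMap.ext (free_tensor_induction (by fun_prop) (by fun_prop) h))

theorem tensorMap_tmk {M N M' N' : BicovariantBimodule H} (f : M ⟶ M') (g : N ⟶ N')
    (m : M.carrier) (n : N.carrier) :
    BicovariantBimodule.Hom.toLin (BicovariantBimodule.tensorMap f g) (tmk M N m n) =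
      tmk M' N' (BicovariantBimodule.Hom.toLin f m) (BicovariantBimodule.Hom.toLin g n) := rfl

/-- The morphism `id ⊗ f`. -/
def freeMap {V W : YetterDrinfeldModule H} (f : V ⟶ W) : freeObj H V ⟶ freeObj H W :=
  (freeFunctor H).map f

theorem freeMap_fmk {V W : YetterDrinfeldModule H} (f : V ⟶ W) (g : H.carrier) (v : V.carrier) :
    BicovariantBimodule.Hom.toLin (freeMap f) (fmk V g v) =
      fmk W g (YetterDrinfeldModule.Hom.toLin f v) := rfl

theorem freeMap_id (V : YetterDrinfeldModule H) : freeMap (𝟙 V) = 𝟙 (freeObj H V) :=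
  (freeFunctor H).map_id V

theorem assocIso_hom_tmk (M N P : BicovariantBimodule H) (m : M.carrier) (n : N.carrier)
    (p : P.carrier) :
    BicovariantBimodule.Hom.toLin (BicovariantBimodule.assocIso M N P).hom
      (tmk (BicovariantBimodule.tensor M N) P (tmk M N m n) p) =
      tmk M (BicovariantBimodule.tensor N P) (M.twist m) (tmk N P n (P.twist.symm p)) := rfl

variable {V W} in
theorem freeDelta_natural {V' W' : YetterDrinfeldModule H} (f : V ⟶ V') (g : W ⟶ W') :
    freeMap (YetterDrinfeldModule.tensorMap f g) ≫ freeDelta V' W' =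
      freeDelta V W ≫ BicovariantBimodule.tensorMap (freeMap f) (freeMap g) :=
  free_tensor_hom_ext fun _ _ _ => rfl

/-- On `g ⊗ ((v ⊗ w) ⊗ u)` both composites give `(α⁻¹(g) ⊗ ν(v)) ⊗_H ((1 ⊗ w) ⊗_H (1 ⊗ u'))`, with
`u'` the untwisted `u`. The same identity for `φ₂` would involve iterated comultiplications. -/
theorem freeDelta_assoc (V W U : YetterDrinfeldModule H) :
    freeDelta (YetterDrinfeldModule.tensor V W) U ≫
      BicovariantBimodule.tensorMap (freeDelta V W) (𝟙 (freeObj H U)) ≫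
        (BicovariantBimodule.assocIso (freeObj H V) (freeObj H W) (freeObj H U)).hom =
    freeMap (YetterDrinfeldModule.assocIso V W U).hom ≫
      freeDelta V (YetterDrinfeldModule.tensor W U) ≫
        BicovariantBimodule.tensorMap (𝟙 (freeObj H V)) (freeDelta W U) := by
  refine free_tensor_hom_ext fun g y u => ?_
  refine YetterDrinfeldModule.tensor_induction (f := fun y => BicovariantBimodule.Hom.toLin
    (freeDelta (YetterDrinfeldModule.tensor V W) U ≫
      BicovariantBimodule.tensorMap (freeDelta V W) (𝟙 (freeObj H U)) ≫
        (BicovariantBimodule.assocIso (freeObj H V) (freeObj H W) (freeObj H U)).hom)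
    (fmk _ g (ymk _ U y u))) (f' := fun y => BicovariantBimodule.Hom.toLin
    (freeMap (YetterDrinfeldModule.assocIso V W U).hom ≫
      freeDelta V (YetterDrinfeldModule.tensor W U) ≫
        BicovariantBimodule.tensorMap (𝟙 (freeObj H V)) (freeDelta W U))
    (fmk _ g (ymk _ U y u))) (by fun_prop) (by fun_prop) (fun v w => ?_) y
  simp only [BicovariantBimodule.comp_toLin, LinearMap.comp_apply, freeDelta_fmk, tensorMap_tmk,
    BicovariantBimodule.id_toLin, LinearMap.id_apply, freeMap_fmk,
    YetterDrinfeldModule.assocIso_hom_ymk]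
  rw [assocIso_hom_tmk]
  simp only [fmk_twist, fmk_symm, symm_one, LinearEquiv.apply_symm_apply]

theorem freeDelta_leftUnit (V : YetterDrinfeldModule H) :
    freeDelta (YetterDrinfeldModule.unit H) V ≫
      BicovariantBimodule.tensorMap (freeEta H) (𝟙 (freeObj H V)) ≫
        (BicovariantBimodule.leftUnitIso (freeObj H V)).hom =
      freeMap (YetterDrinfeldModule.leftUnitIso V).hom := by
  refine free_tensor_hom_ext fun g x v => ?_
  simp only [BicovariantBimodule.comp_toLin, LinearMap.comp_apply, freeDelta_fmk, tensorMap_tmk,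
    BicovariantBimodule.id_toLin, LinearMap.id_apply, freeMap_fmk, freeEta_fmk,
    YetterDrinfeldModule.leftUnitIso_ymk, map_smul, LinearMap.smul_apply, unitMk_leftUnitIso,
    LinearEquiv.apply_symm_apply, fmk_one_lact]

theorem freeDelta_rightUnit (V : YetterDrinfeldModule H) :
    freeDelta V (YetterDrinfeldModule.unit H) ≫
      BicovariantBimodule.tensorMap (𝟙 (freeObj H V)) (freeEta H) ≫
        (BicovariantBimodule.rightUnitIso (freeObj H V)).hom =
      freeMap (YetterDrinfeldModule.rightUnitIso V).hom := by
  refine free_tensor_hom_ext fun g v x => ?_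
  simp only [BicovariantBimodule.comp_toLin, LinearMap.comp_apply, freeDelta_fmk, tensorMap_tmk,
    BicovariantBimodule.id_toLin, LinearMap.id_apply, freeMap_fmk, freeEta_fmk,
    YetterDrinfeldModule.rightUnitIso_ymk, map_smul, unitMk_rightUnitIso, H.twist_one,
    BicovariantBimodule.ract_one, fmk_twist, LinearEquiv.apply_symm_apply]

theorem freeMap_inv_hom {V W : YetterDrinfeldModule H} (e : V ≅ W) :
    freeMap e.inv ≫ freeMap e.hom = 𝟙 (freeObj H W) :=
  ((freeFunctor H).map_comp e.inv e.hom).symm.trans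
    ((congrArg _ e.inv_hom_id).trans ((freeFunctor H).map_id W))

/-- Opmonoidal unitality is phrased with inverse unitors; cancelling the unitor reduces it to
`freeDelta_leftUnit`. -/
theorem freeDelta_leftUnit_inv (V : YetterDrinfeldModule H) :
    (BicovariantBimodule.leftUnitIso (freeObj H V)).inv =
      freeMap (YetterDrinfeldModule.leftUnitIso V).inv ≫
        freeDelta (YetterDrinfeldModule.unit H) V ≫
          BicovariantBimodule.tensorMap (freeEta H) (𝟙 (freeObj H V)) := by
  rw [← cancel_mono (BicovariantBimodule.leftUnitIso (freeObj H V)).hom, Iso.inv_hom_id,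
    Category.assoc, Category.assoc, freeDelta_leftUnit, freeMap_inv_hom]

theorem freeDelta_rightUnit_inv (V : YetterDrinfeldModule H) :
    (BicovariantBimodule.rightUnitIso (freeObj H V)).inv =
      freeMap (YetterDrinfeldModule.rightUnitIso V).inv ≫
        freeDelta V (YetterDrinfeldModule.unit H) ≫
          BicovariantBimodule.tensorMap (𝟙 (freeObj H V)) (freeEta H) := by
  rw [← cancel_mono (BicovariantBimodule.rightUnitIso (freeObj H V)).hom, Iso.inv_hom_id,
    Category.assoc, Category.assoc, freeDelta_rightUnit, freeMap_inv_hom]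

/-- The opmonoidal structure of `V ↦ H ⊗ V`. -/
noncomputable instance freeOplaxMonoidal : (freeFunctor H).OplaxMonoidal where
  η := freeEta H
  δ V W := freeDelta V W
  δ_natural_left f W := by
    have e := freeDelta_natural f (𝟙 W)
    rw [freeMap_id] at e
    exact e.symm
  δ_natural_right V f := by
    have e := freeDelta_natural (𝟙 V) f
    rw [freeMap_id] at e
    exact e.symm
  oplax_associativity := freeDelta_assoc
  oplax_left_unitality := freeDelta_leftUnit_inv
  oplax_right_unitality := freeDelta_rightUnit_inv

instance isIso_freeEta : IsIso (Functor.OplaxMonoidal.η (freeFunctor H)) :=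
  (freeEtaIso H).isIso_hom

instance isIso_freeDelta (V W : YetterDrinfeldModule H) :
    IsIso (Functor.OplaxMonoidal.δ (freeFunctor H) V W) :=
  (freeDeltaIso V W).isIso_hom

variable (H) in
/-- The strong monoidal structure of `V ↦ H ⊗ V`. -/
@[reducible]
noncomputable def freeMonoidal : (freeFunctor H).Monoidal :=
  Functor.Monoidal.ofOplaxMonoidal (freeFunctor H)

/-- The structure map is the categorical inverse of `δ`. By uniqueness it is the inverse built from
`freeMuLin`, whose values are explicit. -/
theorem freeMonoidal_μ (V W : YetterDrinfeldModule H) :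
    (freeMonoidal H).μ V W = (freeDeltaIso V W).inv :=
  IsIso.inv_eq_of_hom_inv_id (f := (freeDeltaIso V W).hom) (freeDeltaIso V W).hom_inv_id

theorem freeMonoidal_ε : (freeMonoidal H).ε = (freeEtaIso H).inv :=
  IsIso.inv_eq_of_hom_inv_id (f := (freeEtaIso H).hom) (freeEtaIso H).hom_inv_id

theorem freeMonoidal_μ_tmul (V W : YetterDrinfeldModule H) (g h : H.carrier) (v : V.carrier)
    (w : W.carrier) : BicovariantBimodule.Hom.toLin ((freeMonoidal H).μ V W)
      ((freeObj H V).tmk (freeObj H W) (g ⊗ₜ[k] v) (h ⊗ₜ[k] w)) = freeMu H V W g v h w := by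
  rw [freeMonoidal_μ]
  refine (freeMuBilin_fmk V W g v h w).trans ?_
  rw [freeMu, map_eq_sw]
  rfl

theorem freeMonoidal_ε_apply (h : H.carrier) :
    BicovariantBimodule.Hom.toLin (freeMonoidal H).ε h = H.twist.symm h ⊗ₜ[k] (1 : k) := by
  rw [freeMonoidal_ε]
  rfl

end FreeMonoidal
end HomHopf
-- Transport of prebraidings along strong monoidal functors
namespace HomHopf

section Transport

open scoped MonoidalCategory
open Functor.LaxMonoidal MonoidalCategory

universe v₁ u₁ v₂ u₂

variable {C : Type u₁} [Category.{v₁} C] [MonoidalCategory C]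
variable {D : Type u₂} [Category.{v₂} D] [MonoidalCategory D]

section

variable (F : C ⥤ D) [F.Monoidal] (c : Prebraiding C) (d : ∀ X Y : D, X ⊗ Y ⟶ Y ⊗ X)
  (hd : ∀ {X X' Y Y' : D} (f : X ⟶ X') (g : Y ⟶ Y'), (f ⊗ₘ g) ≫ d X' Y' = d X Y ≫ (g ⊗ₘ f))
  (w : ∀ X Y : C, μ F X Y ≫ F.map (c.braiding X Y) = d (F.obj X) (F.obj Y) ≫ μ F Y X)

include hd in
theorem braiding_natural_left {X X' : D} (f : X ⟶ X') (Y : D) : f ▷ Y ≫ d X' Y = d X Y ≫ Y ◁ f := by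
  simpa only [tensorHom_id, id_tensorHom] using hd f (𝟙 Y)

include hd in
theorem braiding_natural_right (X : D) {Y Y' : D} (g : Y ⟶ Y') :
    X ◁ g ≫ d X Y' = d X Y ≫ g ▷ X := by
  simpa only [tensorHom_id, id_tensorHom] using hd (𝟙 X) g

-- On objects in the image of `F` the hexagon is `F` of the hexagon in `C`, once the structure maps
-- `μ` are carried through by naturality of `d` and the associativity of `F`.
include hd w in
theorem hexagon_forward_map (X Y Z : C) :
    (α_ (F.obj X) (F.obj Y) (F.obj Z)).hom ≫ d (F.obj X) (F.obj Y ⊗ F.obj Z) ≫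
      (α_ (F.obj Y) (F.obj Z) (F.obj X)).hom =
    (d (F.obj X) (F.obj Y) ▷ F.obj Z) ≫ (α_ (F.obj Y) (F.obj X) (F.obj Z)).hom ≫
      (F.obj Y ◁ d (F.obj X) (F.obj Z)) := by
  -- Strength of `F` enters here: the `μ` are invertible, so the equation may be tested after
  -- composing with them.
  rw [← cancel_mono (F.obj Y ◁ μ F Z X), ← cancel_mono (μ F Y (Z ⊗ X))]
  simp only [Category.assoc]
  rw [← associativity F Y Z X, ← reassoc_of% (braiding_natural_right d hd (F.obj X) (μ F Y Z)),
    ← reassoc_of% (w X (Y ⊗ Z)), ← reassoc_of% (associativity F X Y Z), ← whiskerLeft_comp_assoc,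
    ← w X Z, whiskerLeft_comp_assoc, μ_natural_right, ← reassoc_of% (associativity F Y X Z),
    ← comp_whiskerRight_assoc, ← w X Y, comp_whiskerRight_assoc, μ_natural_left_assoc]
  simp only [← F.map_comp, c.hexagon_forward]

include hd w in
theorem hexagon_reverse_map (X Y Z : C) :
    (α_ (F.obj X) (F.obj Y) (F.obj Z)).inv ≫ d (F.obj X ⊗ F.obj Y) (F.obj Z) ≫
      (α_ (F.obj Z) (F.obj X) (F.obj Y)).inv =
    (F.obj X ◁ d (F.obj Y) (F.obj Z)) ≫ (α_ (F.obj X) (F.obj Z) (F.obj Y)).inv ≫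
      (d (F.obj X) (F.obj Z) ▷ F.obj Y) := by
  rw [← cancel_mono (μ F Z X ▷ F.obj Y), ← cancel_mono (μ F (Z ⊗ X) Y)]
  simp only [Category.assoc]
  rw [← associativity_inv F Z X Y, ← reassoc_of% (braiding_natural_left d hd (μ F X Y) (F.obj Z)),
    ← reassoc_of% (w (X ⊗ Y) Z), ← reassoc_of% (associativity_inv F X Y Z),
    ← comp_whiskerRight_assoc, ← w X Z, comp_whiskerRight_assoc, μ_natural_left,
    ← reassoc_of% (associativity_inv F X Z Y),
    ← whiskerLeft_comp_assoc, ← w Y Z, whiskerLeft_comp_assoc, μ_natural_right_assoc]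
  simp only [← F.map_comp, c.hexagon_reverse]

-- Unitality of `F` expresses both unitors through `ε` and `μ`; naturality moves `d` past `ε`, and
-- compatibility reduces the claim to the unit axiom in `C`.
include hd w in
theorem braiding_leftUnitor_map (X : C) :
    d (F.obj X) (𝟙_ D) ≫ (λ_ (F.obj X)).hom = (ρ_ (F.obj X)).hom := by
  rw [left_unitality F X, right_unitality F X,
    ← reassoc_of% (braiding_natural_right d hd (F.obj X) (ε F)), ← reassoc_of% (w X (𝟙_ C)),
    ← F.map_comp, c.braiding_leftUnitor]

include hd w in
theorem braiding_rightUnitor_map (X : C) :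
    d (𝟙_ D) (F.obj X) ≫ (ρ_ (F.obj X)).hom = (λ_ (F.obj X)).hom := by
  rw [left_unitality F X, right_unitality F X,
    ← reassoc_of% (braiding_natural_left d hd (ε F) (F.obj X)), ← reassoc_of% (w (𝟙_ C) X),
    ← F.map_comp, c.braiding_rightUnitor]

/-- A natural family of morphisms that corresponds to a prebraiding under an essentially surjective
strong monoidal functor is a prebraiding. -/
def Prebraiding.ofEssSurj (G : D → C) (e : ∀ M, F.obj (G M) ≅ M) : Prebraiding D where
  braiding := d
  naturality := hd
  hexagon_forward M N P := by
    -- Each object is isomorphic to one in the image of `F`. Precomposing with these isomorphisms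
    -- and sliding them through by naturality leaves the hexagon `h` for image objects.
    rw [← cancel_epi (((e M).hom ⊗ₘ (e N).hom) ⊗ₘ (e P).hom)]
    have h := hexagon_forward_map F c d hd w (G M) (G N) (G P) =≫
      ((e N).hom ⊗ₘ ((e P).hom ⊗ₘ (e M).hom))
    simp only [Category.assoc] at h
    rw [associator_naturality_assoc, reassoc_of% (hd (e M).hom ((e N).hom ⊗ₘ (e P).hom)),
      associator_naturality, h, ← tensorHom_id, ← tensorHom_id, ← id_tensorHom, ← id_tensorHom,
      tensorHom_comp_tensorHom_assoc, hd, Category.comp_id, tensorHom_comp_tensorHom, ← hd,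
      Category.id_comp, ← Category.id_comp (e P).hom, ← tensorHom_comp_tensorHom_assoc,
      Category.id_comp, associator_naturality_assoc, tensorHom_comp_tensorHom, Category.comp_id]
  hexagon_reverse M N P := by
    rw [← cancel_epi ((e M).hom ⊗ₘ ((e N).hom ⊗ₘ (e P).hom))]
    have h := hexagon_reverse_map F c d hd w (G M) (G N) (G P) =≫
      (((e P).hom ⊗ₘ (e M).hom) ⊗ₘ (e N).hom)
    simp only [Category.assoc] at h
    rw [associator_inv_naturality_assoc, reassoc_of% (hd ((e M).hom ⊗ₘ (e N).hom) (e P).hom),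
      associator_inv_naturality, h, ← tensorHom_id, ← tensorHom_id, ← id_tensorHom, ← id_tensorHom,
      tensorHom_comp_tensorHom_assoc, hd, Category.comp_id, tensorHom_comp_tensorHom, ← hd,
      Category.id_comp, ← Category.id_comp (e M).hom, ← tensorHom_comp_tensorHom_assoc,
      Category.id_comp, associator_inv_naturality_assoc, tensorHom_comp_tensorHom,
      Category.comp_id]
  braiding_leftUnitor M := by
    -- The unit of `D` needs no replacement: the unit lemmas are already stated for `𝟙_ D` itself.
    rw [← cancel_epi ((e M).hom ▷ 𝟙_ D), rightUnitor_naturality,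
      reassoc_of% (braiding_natural_left d hd (e M).hom (𝟙_ D)), leftUnitor_naturality,
      reassoc_of% (braiding_leftUnitor_map F c d hd w (G M))]
  braiding_rightUnitor M := by
    rw [← cancel_epi (𝟙_ D ◁ (e M).hom), leftUnitor_naturality,
      reassoc_of% (braiding_natural_right d hd (𝟙_ D) (e M).hom), rightUnitor_naturality,
      reassoc_of% (braiding_rightUnitor_map F c d hd w (G M))]

end

/-- A prebraiding consisting of isomorphisms is a braiding. -/
@[reducible]
noncomputable def Prebraiding.toBraided (c : Prebraiding C) (h : ∀ X Y, IsIso (c.braiding X Y)) :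
    BraidedCategory C where
  braiding X Y := @asIso _ _ _ _ (c.braiding X Y) (h X Y)
  braiding_naturality_right X _ _ f := braiding_natural_right c.braiding c.naturality X f
  braiding_naturality_left f Z := braiding_natural_left c.braiding c.naturality f Z
  hexagon_forward := c.hexagon_forward
  hexagon_reverse := c.hexagon_reverse

end Transport
end HomHopf
-- The prebraiding of bicovariant bimodules
namespace HomHopf

namespace BicovariantBimodule

variable {k : Type u} [CommRing k] {H : MonoidalHomHopfAlgebra k} (M N : BicovariantBimodule H)

/-- `P_R(m₍₀₎)m₍₁₎ = m`. -/
theorem sw_ract_projR (m : M.carrier) :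
    sw (M.rcoact m) (fun x a => M.ract (M.projR x) a) = m := by
  -- The mirror image of the argument for `P_L`: coassociativity brings the factors together as
  -- `S(a₁)a₂`.
  have e := M.isBicovariant.right_comodule.sw_coassoc
    (F := fun x b a => M.ract (M.twist x) (H.mul (H.antipode b) (H.twist.symm a)))
    (by fun_prop) (by fun_prop) (by fun_prop) m
  simp only [projR_eq_sw, map_sw, sw_apply, ract_ract]
  rw [e]
  have e' : ∀ x a, sw (H.comul a) (fun c d => M.ract (M.twist (M.twist.symm x))
      (H.mul (H.antipode c) (H.twist.symm (H.twist d)))) = H.counit a • M.twist x := by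
    intro x a
    simp only [LinearEquiv.apply_symm_apply, LinearEquiv.symm_apply_apply]
    rw [sw_antipode_mul (F := fun z => M.ract x z) (by fun_prop), ract_one]
  simp only [e']
  rw [M.isBicovariant.right_comodule.sw_counit (F := fun x => M.twist x) (by fun_prop),
    LinearEquiv.apply_symm_apply]

theorem projR_symm (m : M.carrier) :
    M.projR (M.twist.symm m) = M.twist.symm (M.projR m) := by
  rw [projR_eq_sw, projR_eq_sw, M.isBicovariant.right_comodule.sw_symm (by fun_prop) (by fun_prop),
    equiv_sw]
  simp only [ract_symm, antipode_symm]

theorem braidBilin_apply (m : M.carrier) (n : N.carrier) :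
    M.braidBilin N m n = sw (M.lcoact m) fun a x => sw (N.rcoact n) fun y b =>
      tmk N M (N.lact a (N.projR y)) (M.ract (M.projL x) b) := by
  rw [braidBilin, LinearMap.compl₁₂_apply, LinearMap.compr₂_apply, map₂_eq_sw, map_sw]
  simp only [map_sw]
  rfl

variable {M N} in
/-- The braiding is natural. -/
theorem map_braidBilin {M' N' : BicovariantBimodule H} (f : M ⟶ M') (g : N ⟶ N') (m : M.carrier)
    (n : N.carrier) : Hom.toLin (tensorMap g f) (M.braidBilin N m n) =
      M'.braidBilin N' (Hom.toLin f m) (Hom.toLin g n) := by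
  rw [braidBilin_apply, braidBilin_apply, f.map_lcoact, g.map_rcoact, map_eq_sw, map_eq_sw]
  simp (disch := fun_prop) only [sw_sw, sw_tmul, map_sw, tensorMap_tmk, f.map_ract, g.map_lact,
    map_projL, map_projR, LinearMap.id_apply]

end BicovariantBimodule

section

variable {k : Type u} [CommRing k] {H : MonoidalHomHopfAlgebra k}

open BicovariantBimodule (tmk)
open YetterDrinfeldModule (ymk)

/-- `x ⊗_H (1 ⊗ v)h = μ⁻¹(x)α(h₁) ⊗_H (1 ⊗ v ◁ h₂)`. -/
theorem tmk_fmk_one_ract (M : BicovariantBimodule H) (V : YetterDrinfeldModule H) (x : M.carrier)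
    (v : V.carrier) (h : H.carrier) :
    tmk M (freeObj H V) x ((freeObj H V).ract (fmk V H.one v) h) = sw (H.comul h) fun a b =>
      tmk M (freeObj H V) (M.ract (M.twist.symm x) (H.twist a)) (fmk V H.one (V.act v b)) := by
  rw [fmk_ract, map_sw]
  congr! 3 with a b
  have e := BicovariantBimodule.tmk_balanced' (M := M) (N := freeObj H V) x (H.twist a)
    (fmk V H.one (V.twist.symm (V.act v b)))
  rw [H.one_mul]
  rwa [fmk_one_lact, fmk_twist, LinearEquiv.apply_symm_apply, H.twist_one] at e

/-- For a free first argument both projections disappear. `P_L(g₂ ⊗ ν⁻¹(v))` is a counit times `1 ⊗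
ν⁻¹(v)`; moving the coaction factor of `n` across `⊗_H` and using coassociativity then produces
`P_R(n₍₀₎)n₍₁₎ = n`. -/
theorem braidBilin_fmk (V : YetterDrinfeldModule H) (N : BicovariantBimodule H) (g : H.carrier)
    (v : V.carrier) (n : N.carrier) :
    (freeObj H V).braidBilin N (fmk V g v) n = sw (N.rcoact n) fun y a =>
      tmk N (freeObj H V) (N.lact g y) (fmk V H.one (V.twist.symm (V.act v a))) := by
  have e₁ : ∀ y b, sw (H.comul g) (fun c d => tmk N (freeObj H V) (N.lact (H.twist c) y)
      ((freeObj H V).ract (H.counit d • fmk V H.one (V.twist.symm v)) b)) =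
      tmk N (freeObj H V) (N.lact g y)
        ((freeObj H V).ract (fmk V H.one (V.twist.symm v)) b) := by
    intro y b
    simp only [map_smul, LinearMap.smul_apply]
    rw [sw_comul_counit_right (F := fun c => tmk N (freeObj H V) (N.lact (H.twist c) y)
      ((freeObj H V).ract (fmk V H.one (V.twist.symm v)) b)) (by fun_prop),
      LinearEquiv.apply_symm_apply]
  -- Right multiplication on the second tensorand is traded for right multiplication on the first,
  -- which places a leg of `b` next to `P_R`.
  have e₂ : ∀ y b, tmk N (freeObj H V) (N.lact g (N.projR y))
        ((freeObj H V).ract (fmk V H.one (V.twist.symm v)) b) =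
      sw (H.comul b) fun c d => tmk N (freeObj H V)
        (N.lact g (N.ract (N.projR (N.twist.symm y)) c))
        (fmk V H.one (V.act (V.twist.symm v) d)) := by
    intro y b
    simp only [tmk_fmk_one_ract, BicovariantBimodule.lact_symm, BicovariantBimodule.ract_lact,
      BicovariantBimodule.projR_symm, LinearEquiv.apply_symm_apply, LinearEquiv.symm_apply_apply]
  have e₃ := N.isBicovariant.right_comodule.sw_coassoc (F := fun y c d => tmk N (freeObj H V)
        (N.lact g (N.ract (N.projR y) c))
        (fmk V H.one (V.act (V.twist.symm v) (H.twist.symm d))))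
        (by fun_prop) (by fun_prop) (by fun_prop) n
  rw [BicovariantBimodule.braidBilin_apply, sw_fmk_lcoact _ (by fun_prop) (by fun_prop)]
  simp only [projL_fmk]
  rw [sw_comm]
  simp only [e₁, e₂]
  simp only [LinearEquiv.symm_apply_apply] at e₃
  rw [← e₃]
  congr! 3 with y a
  -- The inner sum is now `P_R(y₍₀₎)y₍₁₎`, which equals `y`.
  rw [← lin_sw (L := fun y => tmk N (freeObj H V) (N.lact g y)
    (fmk V H.one (V.act (V.twist.symm v) (H.twist.symm a)))) (by fun_prop), N.sw_ract_projR,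
    YetterDrinfeldModule.act_symm]

/-- `φ₂` carries the braiding of free bicovariant Hom-bimodules to that of Yetter-Drinfel'd
Hom-modules. -/
theorem freeDelta_braid (V W : YetterDrinfeldModule H) (x : (freeObj H V).carrier)
    (y : (freeObj H W).carrier) :
    BicovariantBimodule.Hom.toLin (freeDelta W V)
      (BicovariantBimodule.Hom.toLin (freeMap (YetterDrinfeldModule.braidHom V W))
        (freeMuBilin V W x y)) = (freeObj H V).braidBilin (freeObj H W) x y := by
  refine free_induction (f := fun x => BicovariantBimodule.Hom.toLin (freeDelta W V)
      (BicovariantBimodule.Hom.toLin (freeMap (YetterDrinfeldModule.braidHom V W))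
        (freeMuBilin V W x y))) (f' := fun x => (freeObj H V).braidBilin (freeObj H W) x y)
      (by fun_prop) (by fun_prop) (fun g v => ?_) x
  refine free_induction (f := fun y => BicovariantBimodule.Hom.toLin (freeDelta W V)
      (BicovariantBimodule.Hom.toLin (freeMap (YetterDrinfeldModule.braidHom V W))
        (freeMuBilin V W (fmk V g v) y)))
      (f' := fun y => (freeObj H V).braidBilin (freeObj H W) (fmk V g v) y)
      (by fun_prop) (by fun_prop) (fun h w => ?_) y
  -- Both sides are now explicit sums over `Δ(h)` and the coaction of `w`, with second tensorand in
  -- `1 ⊗ V`.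
  rw [braidBilin_fmk, sw_fmk_rcoact _ (by fun_prop) (by fun_prop), freeMuBilin_fmk]
  simp only [map_sw, freeMap_fmk, YetterDrinfeldModule.braidHom_ymk, freeDelta_fmk, mul_symm,
    LinearEquiv.symm_apply_apply, fmk_lact, YetterDrinfeldModule.act_symm,
    YetterDrinfeldModule.act_act, LinearEquiv.apply_symm_apply]

end

namespace BicovariantBimodule

variable {k : Type u} [CommRing k] {H : MonoidalHomHopfAlgebra k} (M N : BicovariantBimodule H)

/-- The prebraiding `m ⊗_H n ↦ m₍₋₁₎P_R(n₍₀₎) ⊗_H P_L(m₍₀₎)n₍₁₎`. -/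
noncomputable def braidHom : tensor M N ⟶ tensor N M :=
  tensorMap M.freeCoinvIso.inv N.freeCoinvIso.inv ≫ (freeDeltaIso M.coinv N.coinv).inv ≫
    freeMap (YetterDrinfeldModule.braidHom M.coinv N.coinv) ≫
      freeDelta N.coinv M.coinv ≫ tensorMap N.freeCoinvIso.hom M.freeCoinvIso.hom

/-- On the free modules over the coinvariants the formula is `freeDelta_braid`; it transfers along
`freeCoinvIso` because it commutes with morphisms. In particular it is well defined on `M ⊗_H N` and
linear and colinear, with no direct verification. -/
theorem braidHom_tmk (m : M.carrier) (n : N.carrier) :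
    Hom.toLin (M.braidHom N) (tmk M N m n) = M.braidBilin N m n := by
  refine (congrArg (Hom.toLin (tensorMap N.freeCoinvIso.hom M.freeCoinvIso.hom))
    (freeDelta_braid M.coinv N.coinv (Hom.toLin M.freeCoinvIso.inv m)
      (Hom.toLin N.freeCoinvIso.inv n))).trans ?_
  rw [map_braidBilin]
  exact congrArg₂ (fun x y => M.braidBilin N x y)
    (LinearMap.congr_fun (congrArg Hom.toLin M.freeCoinvIso.inv_hom_id) m)
    (LinearMap.congr_fun (congrArg Hom.toLin N.freeCoinvIso.inv_hom_id) n)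

/-- Naturality is read off the formula; the coinvariants are not needed as a functor. -/
theorem braidHom_naturality {M M' N N' : BicovariantBimodule H} (f : M ⟶ M') (g : N ⟶ N') :
    tensorMap f g ≫ M'.braidHom N' = M.braidHom N ≫ tensorMap g f :=
  tensor_hom_ext fun m n => by
    rw [comp_toLin, comp_toLin, LinearMap.comp_apply, LinearMap.comp_apply, braidHom_tmk,
      map_braidBilin, tensorMap_tmk, braidHom_tmk]

theorem freeDeltaIso_inv_braid (V W : YetterDrinfeldModule H) :
    (freeDeltaIso V W).inv ≫ freeMap (YetterDrinfeldModule.braidHom V W) =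
      (freeObj H V).braidHom (freeObj H W) ≫ (freeDeltaIso W V).inv := by
  rw [← cancel_mono (freeDeltaIso W V).hom, Category.assoc, Category.assoc, Iso.inv_hom_id,
    Category.comp_id]
  exact tensor_hom_ext fun x y => (freeDelta_braid V W x y).trans (braidHom_tmk _ _ x y).symm

theorem freeMonoidal_μ_braidHom (V W : YetterDrinfeldModule H) :
    (freeMonoidal H).μ V W ≫
      (freeFunctor H).map ((YetterDrinfeldModule.prebraiding H).braiding V W) =
    ((freeFunctor H).obj V).braidHom ((freeFunctor H).obj W) ≫ (freeMonoidal H).μ W V := by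
  rw [freeMonoidal_μ, freeMonoidal_μ]
  exact freeDeltaIso_inv_braid V W

/-- The prebraiding of bicovariant Hom-bimodules. -/
noncomputable def prebraiding (H : MonoidalHomHopfAlgebra k) :
    Prebraiding (BicovariantBimodule H) :=
  letI := freeMonoidal H
  Prebraiding.ofEssSurj (freeFunctor H) (YetterDrinfeldModule.prebraiding H) braidHom
    braidHom_naturality freeMonoidal_μ_braidHom coinv freeCoinvIso

/-- By construction this is a composite of isomorphisms with the image under `F` of the
Yetter-Drinfel'd prebraiding. -/
theorem isIso_braidHom (hS : Function.Bijective H.antipode) : IsIso (M.braidHom N) := by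
  have h₁ : IsIso (freeMap (YetterDrinfeldModule.braidHom M.coinv N.coinv)) := by
    have := YetterDrinfeldModule.isIso_braidHom M.coinv N.coinv hS
    exact inferInstanceAs (IsIso ((freeFunctor H).map (YetterDrinfeldModule.braidHom _ _)))
  have h₂ : IsIso (freeDelta N.coinv M.coinv) := (freeDeltaIso N.coinv M.coinv).isIso_hom
  have h₃ : IsIso (tensorMap M.freeCoinvIso.inv N.freeCoinvIso.inv) :=
    inferInstanceAs (IsIso (MonoidalCategory.tensorHom M.freeCoinvIso.inv N.freeCoinvIso.inv))
  have h₄ : IsIso (tensorMap N.freeCoinvIso.hom M.freeCoinvIso.hom) :=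
    inferInstanceAs (IsIso (MonoidalCategory.tensorHom N.freeCoinvIso.hom M.freeCoinvIso.hom))
  rw [braidHom]
  infer_instance

end BicovariantBimodule
end HomHopf
-- Assembly of the main theorem
theorem mainTheorem1 {k : Type u} [CommRing k] (H : MonoidalHomHopfAlgebra k) :
    ∃ (cB : HomHopf.Prebraiding (HomHopf.BicovariantBimodule H))
      (cY : HomHopf.Prebraiding (HomHopf.YetterDrinfeldModule H))
      (hF : (HomHopf.freeFunctor H).Monoidal),
      -- the prebraiding `m ⊗_H n ↦ m₍₋₁₎P_R(n₍₀₎) ⊗_H P_L(m₍₀₎)n₍₁₎` of bicovariant Hom-bimodules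
      (∀ (M N : HomHopf.BicovariantBimodule H) (m : M.carrier) (n : N.carrier),
        HomHopf.BicovariantBimodule.Hom.toLin (cB.braiding M N) (M.tmk N m n) =
          M.braidBilin N m n) ∧
      -- the prebraiding `m ⊗ n ↦ ν(n₍₀₎) ⊗ μ⁻¹(m) ◁ n₍₁₎` of Yetter-Drinfel'd Hom-modules
      (∀ (M N : HomHopf.YetterDrinfeldModule H) (m : M.carrier) (n : N.carrier),
        HomHopf.YetterDrinfeldModule.Hom.toLin (cY.braiding M N) (m ⊗ₜ[k] n) =
          M.braidElem N m n) ∧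
      -- `φ₂((g ⊗ v) ⊗_H (h ⊗ w)) = gα(h₁) ⊗ (ν⁻¹(v) ◁ h₂ ⊗ w)` and `φ₀(h) = α⁻¹(h) ⊗ 1`
      (∀ (V W : HomHopf.YetterDrinfeldModule H) (g h : H.carrier) (v : V.carrier) (w : W.carrier),
        HomHopf.BicovariantBimodule.Hom.toLin (hF.μ V W)
            ((HomHopf.freeObj H V).tmk (HomHopf.freeObj H W) (g ⊗ₜ[k] v) (h ⊗ₜ[k] w)) =
          HomHopf.freeMu H V W g v h w) ∧
      (∀ h : H.carrier, HomHopf.BicovariantBimodule.Hom.toLin hF.ε h =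
        H.twist.symm h ⊗ₜ[k] (1 : k)) ∧
      -- a prebraided monoidal equivalence
      (HomHopf.freeFunctor H).IsEquivalence ∧
      HomHopf.IsPrebraided cY cB (HomHopf.freeFunctor H) hF ∧
      -- braided if the antipode is bijective
      (Function.Bijective H.antipode →
        ∃ (bB : BraidedCategory (HomHopf.BicovariantBimodule H))
          (bY : BraidedCategory (HomHopf.YetterDrinfeldModule H))
          (hB : (HomHopf.freeFunctor H).Braided),
          (∀ M N, (bB.braiding M N).hom = cB.braiding M N) ∧
          (∀ M N, (bY.braiding M N).hom = cY.braiding M N) ∧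
          hB.toMonoidal = hF) := by
  refine ⟨HomHopf.BicovariantBimodule.prebraiding H, HomHopf.YetterDrinfeldModule.prebraiding H,
    HomHopf.freeMonoidal H, HomHopf.BicovariantBimodule.braidHom_tmk,
    HomHopf.YetterDrinfeldModule.braidHom_ymk_eq,
    fun V W g h v w => HomHopf.freeMonoidal_μ_tmul V W g h v w, HomHopf.freeMonoidal_ε_apply,
    inferInstance, HomHopf.BicovariantBimodule.freeMonoidal_μ_braidHom, fun hS => ?_⟩
  let bB := (HomHopf.BicovariantBimodule.prebraiding H).toBraided
    fun M N => HomHopf.BicovariantBimodule.isIso_braidHom M N hS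
  let bY := (HomHopf.YetterDrinfeldModule.prebraiding H).toBraided
    fun M N => HomHopf.YetterDrinfeldModule.isIso_braidHom M N hS
  -- Being braided is a condition on the monoidal structure already chosen, and it is the same
  -- equation as being prebraided.
  exact ⟨bB, bY, { HomHopf.freeMonoidal H with
    braided := HomHopf.BicovariantBimodule.freeMonoidal_μ_braidHom },
    fun _ _ => rfl, fun _ _ => rfl, rfl⟩
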